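/- **Setting.** Let $S\subset\mathbb V=\mathbb R^3$ be a non-degenerate tetrahedron. For each face $T$ of $S$ (vertices, edges, triangles, $S$ itself) let an inpoint $W_T$ in the relative interior of $T$ be chosen (for a vertex, $W_T$ is that vertex). The split is assumed to be Powell–Sabin/Worsey–Piper: for each edge $E$, the inpoints of $E$, of the two triangles containing $E$, and of $S$ are coplanar. For $m\ge 0$, the refinement $\mathcal R_m(T)$ of $T$ consists of the simplices $[W_{T_j},\dots,W_{T_0},V_0,\dots,V_l]$, where $T'=[V_0,\dots,V_l]$ is a subsimplex of $T$ of dimension $l\le m$ and $T'\subsetneq T_0\subsetneq\dots\subsetneq T_j$ are subsimplices of $T$ of dimension at least $m+1$. $\mathrm C^0\mathrm P^r(\mathcal R_m(T))$ is the space of continuous functions on $T$ that are polynomial of degree at most $r$ on each simplex of $\mathcal R_m(T)$, and $\mathrm C^0\mathrm P^r\Lambda^k(\mathcal R_m(T))$ is the space of $k$-forms on $T$ with such coefficients. For $k=0$ we write $\mathcal R_{k-1}=\mathcal R_0$. Let $X_T(x)=x-W_T$ and let $P_T$ be the Poincaré operator $$(P_Tu)_x(\xi_1,\dots,\xi_k)=\int_0^1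 t^{k}\,u_{W_T+t(x-W_T)}(X_T(x),\xi_1,\dots,\xi_k)\,dt ,$$ for $u$ a $(k+1)$-form on $T$ or a function on $T$ with values in $\mathrm{Alt}^{k+1}(\mathbb V)$. For $u:T\to\mathrm{Alt}^k(\mathbb V)$, $\mathrm{pull}_Tu$ is the $k$-form on $T$ which remembers only the action of $u$ on vectors tangent to $T$. Put $$K^k(T)=\{u\in \mathrm C^0\mathrm P^1\Lambda^k(\mathcal R_{k-1}(T)) : du=0\},\qquad M^k(T)=K^k(T)+P_TK^{k+1}(T),$$ $$\mathbb W_T=\mathrm{span}\{W_S-W_U : U \text{ a face of } S,\ T\subseteq U\}.$$ **Spaces.** For each face $T$ and each $k\geq 0$, let $A^k(T)$ be the set of pairs $(u,v)\in \mathrm C^0\mathrm P^2(\mathcal R_{k-1}(T))\otimes\mathrm{Alt}^k(\mathbb V)\,\oplus\,\mathrm C^0\mathrm P^1(\mathcal R_k(T))\otimes\mathrm{Alt}^{k+1}(\mathbb V)$ such that $d\,\mathrm{pull}_Tu=\mathrm{pull}_Tv$, $\mathrm{pull}_Tu\in M^k(T)$, and, for all $Y\in\mathbb W_T$, the contractions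 of $v$ and of $u-P_Tv$ by $Y$ are affine functions on $T$ with values in $\mathrm{Alt}^{k}(\mathbb V)$ and $\mathrm{Alt}^{k-1}(\mathbb V)$ respectively (the second condition being void for $k=0$). In particular $A^k(S)$ is identified, by $(u,du)\leftrightarrow u$, with $K^k(S)+P_SK^{k+1}(S)$. The differential is $\mathsf d(u,v)=(v,0)$; the restriction $A^k(T)\to A^k(T')$, for $T'\subseteq T$, restricts both components to $T'$ (double-trace); constants are included by $c\mapsto(c,0)$; the evaluation on a $k$-dimensional face $T$ is $(u,v)\mapsto\int_T\mathrm{pull}_Tu$, faces being oriented by an ordering of the vertices of $S$. $\mathrm C^0_d\Lambda^k(S)$ is the space of continuous $k$-forms $u$ on $S$ whose exterior derivative $du$ in the sense of distributions is continuous on $S$; it is identified with the space of pairs $(u,du)$. **Theorem.** Under these assumptions: 1. $A$ is a finite element system on the complex of faces of $S$: each $A^k(T)$ is a vector space; differentials, restrictions and constants map between these spaces as indicated; $\mathsf d\mathsf d=0$; restrictions are functorial and commute with $\mathsf d$ and with the inclusion of constants, and $\mathsf d$ vanishes on constants; the evaluations are linear on $A^k(T)$, $k=\dim T$; and Stokes'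 formula $\int_T\mathrm{pull}_T v=\sum_{T'}\pm\int_{T'}\mathrm{pull}_{T'} u$ holds for $(u,v)\in A^{k}(T)$, $k=\dim T-1\ge0$, where the sum is over the facets $T'$ of $T$ with their relative orientations. 2. $A$ is compatible. That is, it admits extensions (is flabby): for all $T$ and $k$, every family $(w_{T'})$ of elements of $A^k(T')$, $T'\subsetneq T$, stable under restrictions, is the family of restrictions of some element of $A^k(T)$. And it is locally exact: for all $T$ the sequence $0\to\mathbb R\to A^0(T)\to A^1(T)\to A^2(T)\to\cdots$ is exact. 3. For each face $T$, $A^k(T)$ is exactly the space of double-traces on $T$ of the elements of $A^k(S)$. 4. $A^k(S)\subset \mathrm C^0_d\Lambda^k(S)$ for all $k$ (so that $A^0(S)$ consists of $\mathrm C^1$ functions, and the complex ends with continuous vector fields with continuous divergence, mapped by the divergence onto the space $A^3(S)$ of continuous pressures). 5. There are commuting interpolators: for each $u\in\mathrm C^0_d\Lambda^k(S)$ there is a unique $\Pi^ku\in A^k(S)$ such that $\Pi^ku$ and $u$ have the same values at the vertices of $S$, their exterior derivatives have the same values at the vertices of $S$, and they have the same integrals on the $k$-dimensional faces of $S$; and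 $d\,\Pi^ku=\Pi^{k+1}du$. -/

import Mathlib

open MeasureTheory
open scoped ContDiff

noncomputable section

namespace FES

/-- The Euclidean space `ℝⁿ`. -/
abbrev Vec (n : ℕ) : Type := EuclideanSpace ℝ (Fin n)

/-- `Alt^k(E)`: alternating `k`-linear forms on `E`. -/
abbrev Alt (k : ℕ) (E : Type) [NormedAddCommGroup E] [NormedSpace ℝ E] : Type :=
  E [⋀^Fin k]→L[ℝ] ℝ

/-- The faces (subsimplices) of an `n`-simplex: non-empty sets of vertex labels, ordered by
inclusion. -/
abbrev Face (n : ℕ) : Type := {T : Finset (Fin (n + 1)) // T.Nonempty}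

/-- The dimension of a face. -/
def Face.dim {n : ℕ} (T : Face n) : ℕ := T.1.card - 1

/-- The simplex itself, as a face of itself. -/
def Face.top (n : ℕ) : Face n := ⟨Finset.univ, Finset.univ_nonempty⟩

/-- The facet of a `(k+1)`-dimensional face obtained by removing its `i`-th vertex. -/
def Face.facet {n k : ℕ} (T : Face n) (h : T.1.card = k + 2) (i : Fin (k + 2)) : Face n :=
  ⟨T.1.erase (T.1.orderEmbOfFin h i), by
    rw [← Finset.card_pos, Finset.card_erase_of_mem (Finset.orderEmbOfFin_mem _ _ _), h]; simp⟩

theorem Face.facet_card {n k : ℕ} (T : Face n) (h : T.1.card = k + 2) (i : Fin (k + 2)) :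
    (T.facet h i).1.card = k + 1 := by
  simp [Face.facet, Finset.card_erase_of_mem, h]

theorem Face.facet_le {n k : ℕ} (T : Face n) (h : T.1.card = k + 2) (i : Fin (k + 2)) :
    T.facet h i ≤ T :=
  Finset.erase_subset _ _

/-- A non-degenerate `n`-simplex `S` in `ℝⁿ`, together with the choice of an inpoint `W_T` in the
interior of each of its faces `T` (a point of the interior is one with positive barycentric
coordinates; in particular `W_T` is the vertex itself when `T` is a vertex). -/
structure SplitSimplex (n : ℕ) where
  vertex : Fin (n + 1) → Vec n
  affineIndependent : AffineIndependent ℝ vertex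
  inpoint : Face n → Vec n
  inpoint_mem : ∀ T : Face n, ∃ a : Fin (n + 1) → ℝ,
    (∀ i ∈ T.1, 0 < a i) ∧ ∑ i ∈ T.1, a i = 1 ∧ inpoint T = ∑ i ∈ T.1, a i • vertex i

namespace SplitSimplex

variable {n : ℕ} (S : SplitSimplex n)

/-- For a tetrahedron, the split determined by the inpoints is Powell-Sabin/Worsey-Piper: for each
edge `E`, the inpoints of all the faces containing `E` (namely of `E`, of its two adjacent
triangles, and of the tetrahedron) are coplanar. -/
def IsPowellSabin (S : SplitSimplex 3) : Prop :=
  ∀ E : Face 3, E.dim = 1 → Coplanar ℝ (S.inpoint '' {T | E ≤ T})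

/-- The geometric realization `|T|` of a face `T`. -/
def real (T : Face n) : Set (Vec n) := convexHull ℝ (S.vertex '' (T.1 : Set (Fin (n + 1))))

/-- The space of vectors tangent to the face `T`. -/
def dir (T : Face n) : Submodule ℝ (Vec n) :=
  vectorSpan ℝ (S.vertex '' (T.1 : Set (Fin (n + 1))))

theorem real_mono {T' T : Face n} (h : T' ≤ T) : S.real T' ⊆ S.real T :=
  convexHull_mono (Set.image_mono (Finset.coe_subset.2 h))

theorem inpoint_mem_real (T : Face n) : S.inpoint T ∈ S.real T := by
  obtain ⟨a, ha, hsum, hW⟩ := S.inpoint_mem T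
  rw [hW]
  exact (convex_convexHull ℝ _).sum_mem (fun i hi => (ha i hi).le) hsum
    (fun i hi => subset_convexHull ℝ _ (Set.mem_image_of_mem _ (Finset.mem_coe.2 hi)))

theorem sub_inpoint_mem_dir (T : Face n) (x : S.real T) : (x : Vec n) - S.inpoint T ∈ S.dir T := by
  unfold dir
  rw [← direction_affineSpan]
  exact AffineSubspace.vsub_mem_direction (convexHull_subset_affineSpan _ x.2)
    (convexHull_subset_affineSpan _ (S.inpoint_mem_real T))

/-- The vector field `X_T : x ↦ x - W_T` on `|T|`, with values in the tangent space of `T`. Since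
`x = W_T + X_T(x)`, it is also the affine coordinate on `|T|` with origin `W_T`. -/
def radial (T : Face n) (x : S.real T) : S.dir T :=
  ⟨(x : Vec n) - S.inpoint T, S.sub_inpoint_mem_dir T x⟩

/-! ### Refinements and piecewise polynomials -/

/-- The (geometric) simplices of the `m`-refinement `R_m(T)`:
`[W_{T_j}, …, W_{T_0}, V_0, …, V_l]`, where `T' = [V_0, …, V_l]` is a subsimplex of `T` of dimension
at most `m`, and `T' < T_0 < ⋯ < T_j` are subsimplices of `T` of dimension at least `m + 1`. -/
def refinement (m : ℕ) (T : Face n) : Set (Set (Vec n)) :=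
  {σ | ∃ (T' : Face n) (C : Set (Face n)), T' ≤ T ∧ T'.dim ≤ m ∧ IsChain (· ≤ ·) C ∧
    (∀ U ∈ C, T' < U ∧ U ≤ T ∧ m + 1 ≤ U.dim) ∧
    σ = convexHull ℝ (S.vertex '' (T'.1 : Set (Fin (n + 1))) ∪ S.inpoint '' C)}

/-- `q` is a polynomial map of degree at most `r`: a sum of homogeneous polynomial maps of degrees
`0, …, r`, a homogeneous one being a multilinear map evaluated on the diagonal. -/
def IsPolynomial {D E : Type} [NormedAddCommGroup D] [NormedSpace ℝ D] [NormedAddCommGroup E]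
    [NormedSpace ℝ E] (r : ℕ) (q : D → E) : Prop :=
  ∃ c : (i : ℕ) → ContinuousMultilinearMap ℝ (fun _ : Fin i => D) E,
    ∀ y, q y = ∑ i ∈ Finset.range (r + 1), c i (fun _ => y)

/-- `C⁰P^r(R_m(T)) ⊗ E`: continuous functions on `|T|`, with values in `E`, which coincide on each
simplex of `R_m(T)` with a polynomial of degree at most `r`. -/
def C0P (r m : ℕ) (T : Face n) {E : Type} [NormedAddCommGroup E] [NormedSpace ℝ E] :
    Set (S.real T → E) :=
  {u | Continuous u ∧ ∀ σ ∈ S.refinement m T, ∃ q : S.dir T → E, IsPolynomial r q ∧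
    ∀ x : S.real T, (x : Vec n) ∈ σ → u x = q (S.radial T x)}

/-- `d u = v` on `|T|`, for a differential form `u` on `|T|` which is piecewise polynomial with
respect to `R_m(T)`. The exterior derivative is computed on each simplex of `R_m(T)`; for a
continuous `u` this is the exterior derivative in the sense of distributions. -/
def ExtDeriv (m : ℕ) (T : Face n) {k : ℕ} (u : S.real T → Alt k (S.dir T))
    (v : S.real T → Alt (k + 1) (S.dir T)) : Prop :=
  ∀ σ ∈ S.refinement m T, ∃ q : S.dir T → Alt k (S.dir T), (∃ r, IsPolynomial r q) ∧
    ∀ x : S.real T, (x : Vec n) ∈ σ →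
      u x = q (S.radial T x) ∧ v x = extDeriv q (S.radial T x)

/-- Extension by zero of a function on `|T|`; it will only be evaluated at points of `|T|`. -/
def extendZero (T : Face n) {E : Type} [Zero E] (u : S.real T → E) : Vec n → E :=
  Function.extend Subtype.val u 0

/-- The Poincaré operator associated with the inpoint `W_T`:
`(P u)_x(ξ₁, …, ξ_k) = ∫₀¹ t^k u_{W_T + t (x - W_T)}(x - W_T, ξ₁, …, ξ_k) dt`.
It acts on `Alt^{k+1}(E)`-valued functions on `|T|`, where `E` is either the tangent space of `T` or
the whole space, and `X` is the vector field `x ↦ x - W_T`, as a function with values in `E`. -/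
def poincareOn (T : Face n) {E : Type} [NormedAddCommGroup E] [NormedSpace ℝ E]
    (X : S.real T → E) {k : ℕ} (u : S.real T → Alt (k + 1) E) (x : S.real T) : Alt k E :=
  ∫ t in (0 : ℝ)..1,
    t ^ k • (S.extendZero T u (S.inpoint T + t • ((x : Vec n) - S.inpoint T))).curryLeft (X x)

/-- The Poincaré operator `P_T` on differential forms on `|T|`. -/
def poincare (T : Face n) {k : ℕ} (u : S.real T → Alt (k + 1) (S.dir T)) :
    S.real T → Alt k (S.dir T) :=
  S.poincareOn T (S.radial T) u

/-- The Poincaré operator `P_T` on `Alt^{k+1}(ℝⁿ)`-valued functions on `|T|`. -/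
def poincareTrace (T : Face n) {k : ℕ} (u : S.real T → Alt (k + 1) (Vec n)) :
    S.real T → Alt k (Vec n) :=
  S.poincareOn T (fun x => (x : Vec n) - S.inpoint T) u

/-- The pullback to `T` of an `Alt^k(ℝⁿ)`-valued function on `|T|`: it remembers only the action on
vectors tangent to `T`. -/
def pull (T : Face n) {k : ℕ} (u : S.real T → Alt k (Vec n)) : S.real T → Alt k (S.dir T) :=
  fun x => (u x).compContinuousLinearMap (S.dir T).subtypeL

/-! ### The finite element spaces -/

/-- `K^k(T) = {u ∈ C⁰P¹Λ^k(R_{k-1}(T)) : du = 0}`, where `R_0(T)` is used if `k = 0`. -/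
def K (k : ℕ) (T : Face n) : Set (S.real T → Alt k (S.dir T)) :=
  {u | u ∈ S.C0P 1 (k - 1) T ∧ S.ExtDeriv (k - 1) T u 0}

/-- `M^k(T) = K^k(T) + P_T K^{k+1}(T)`. -/
def M (k : ℕ) (T : Face n) : Set (S.real T → Alt k (S.dir T)) :=
  {u | ∃ a ∈ S.K k T, ∃ b ∈ S.K (k + 1) T, u = a + S.poincare T b}

/-- `𝕎_T = span {W_S - W_U : U a face of S containing T}`. -/
def transverse (T : Face n) : Submodule ℝ (Vec n) :=
  Submodule.span ℝ {y | ∃ U : Face n, T ≤ U ∧ y = S.inpoint (Face.top n) - S.inpoint U}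

/-- For every `Y ∈ 𝕎_T`, the contraction of `w` by `Y` is affine on `|T|` (as a function with values
in the alternating forms on `ℝⁿ`; componentwise, `x ↦ w x (ξ₁, …, ξ_k)` is affine as soon as one of
the `ξ_i` is in `𝕎_T`). -/
def TransverselyAffine (T : Face n) {k : ℕ} (w : S.real T → Alt k (Vec n)) : Prop :=
  ∀ ξ : Fin k → Vec n, (∃ i, ξ i ∈ S.transverse T) →
    ∃ f : Vec n →ᵃ[ℝ] ℝ, ∀ x : S.real T, w x ξ = f x

/-- Pairs `(u, v)` of an `Alt^k(ℝⁿ)`-valued and an `Alt^{k+1}(ℝⁿ)`-valued function on `|T|`. -/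
abbrev Pairs (k : ℕ) (T : Face n) : Type := S.real T → Alt k (Vec n) × Alt (k + 1) (Vec n)

/-- The space `A^k(T)`. An element is a pair `(u, v)`, thought of as the double trace of a `k`-form
and its exterior derivative. When `T = S` the pullback loses no information and `𝕎_S = 0`, so that
`A^k(S)` consists of the pairs `(u, du)` with `u ∈ K^k(S) + P_S K^{k+1}(S)`. -/
def A (k : ℕ) (T : Face n) : Set (S.Pairs k T) :=
  {p | let u : S.real T → Alt k (Vec n) := fun x => (p x).1
       let v : S.real T → Alt (k + 1) (Vec n) := fun x => (p x).2
       u ∈ S.C0P 2 (k - 1) T ∧ v ∈ S.C0P 1 k T ∧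
       S.ExtDeriv (k - 1) T (S.pull T u) (S.pull T v) ∧
       S.pull T u ∈ S.M k T ∧
       S.TransverselyAffine T v ∧
       S.TransverselyAffine T (u - S.poincareTrace T v)}

/-! ### Finite element systems with double-traces as restrictions -/

/-- The differential `(u, v) ↦ (v, 0)`. -/
def d {k : ℕ} {T : Face n} (p : S.Pairs k T) : S.Pairs (k + 1) T := fun x => ((p x).2, 0)

/-- The restriction from `T` to a subcell `T'`: both components are restricted. -/
def restr {k : ℕ} {T' T : Face n} (h : T' ≤ T) (p : S.Pairs k T) : S.Pairs k T' :=
  fun x => p (Set.inclusion (S.real_mono h) x)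

/-- The inclusion of constant functions. -/
def const (T : Face n) (c : ℝ) : S.Pairs 0 T :=
  fun _ => (ContinuousAlternatingMap.constOfIsEmpty ℝ (Vec n) (Fin 0) c, 0)

/-- The evaluation: the integral of the pullback of `u` to the `k`-dimensional face `T`, oriented by
the ordering of its vertices `V_0, …, V_k`, in the parametrization
`t ↦ V_0 + ∑ⱼ tⱼ (Vⱼ - V_0)` of `|T|`. -/
def eval {k : ℕ} {T : Face n} (h : T.1.card = k + 1) (p : S.Pairs k T) : ℝ :=
  let V : Fin (k + 1) → Vec n := fun i => S.vertex (T.1.orderEmbOfFin h i)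
  ∫ t in {t : Fin k → ℝ | (∀ j, 0 ≤ t j) ∧ ∑ j, t j ≤ 1},
    S.extendZero T (fun x => (p x).1) (V 0 + ∑ j, t j • (V j.succ - V 0))
      (fun j => V j.succ - V 0)

/-- The family of sets `B^k(T)` of pairs is a finite element system on the complex of faces of `S`,
for the differential `d`, the double-trace restrictions `restr`, the inclusion of constants `const`
and the evaluations `eval`. -/
structure IsFiniteElementSystem (B : (k : ℕ) → (T : Face n) → Set (S.Pairs k T)) : Prop where
  zero_mem : ∀ k T, 0 ∈ B k T
  add_mem : ∀ k T, ∀ p ∈ B k T, ∀ q ∈ B k T, p + q ∈ B k T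
  smul_mem : ∀ k T (c : ℝ), ∀ p ∈ B k T, c • p ∈ B k T
  d_mem : ∀ k T, ∀ p ∈ B k T, S.d p ∈ B (k + 1) T
  d_d : ∀ k T, ∀ p ∈ B k T, S.d (S.d p) = 0
  restr_mem : ∀ k T' T (h : T' ≤ T), ∀ p ∈ B k T, S.restr h p ∈ B k T'
  restr_d : ∀ k T' T (h : T' ≤ T), ∀ p ∈ B k T, S.restr h (S.d p) = S.d (S.restr h p)
  restr_restr : ∀ k T'' T' T (h' : T'' ≤ T') (h : T' ≤ T), ∀ p ∈ B k T,
    S.restr h' (S.restr h p) = S.restr (h'.trans h) p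
  const_mem : ∀ T c, S.const T c ∈ B 0 T
  d_const : ∀ T c, S.d (S.const T c) = 0
  restr_const : ∀ T' T (h : T' ≤ T) c, S.restr h (S.const T c) = S.const T' c
  eval_add : ∀ k T (h : T.1.card = k + 1), ∀ p ∈ B k T, ∀ q ∈ B k T,
    S.eval h (p + q) = S.eval h p + S.eval h q
  eval_smul : ∀ k T (h : T.1.card = k + 1) (c : ℝ), ∀ p ∈ B k T,
    S.eval h (c • p) = c * S.eval h p
  stokes : ∀ k T (h : T.1.card = k + 2), ∀ p ∈ B k T,
    S.eval h (S.d p) =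
      ∑ i : Fin (k + 2), (-1 : ℝ) ^ (i : ℕ) *
        S.eval (T.facet_card h i) (S.restr (T.facet_le h i) p)

/-- `B` admits extensions (is flabby): for each face `T` and each `k`, every family of elements of
`B^k(T')`, indexed by the strict subfaces `T'` of `T` and stable under restrictions, is the family
of restrictions of an element of `B^k(T)`. -/
def AdmitsExtensions (B : (k : ℕ) → (T : Face n) → Set (S.Pairs k T)) : Prop :=
  ∀ (k : ℕ) (T : Face n) (w : (T' : Face n) → S.Pairs k T'),
    (∀ T' < T, w T' ∈ B k T') →
    (∀ T' < T, ∀ T'' (h : T'' ≤ T'), S.restr h (w T') = w T'') →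
    ∃ p ∈ B k T, ∀ T' (h : T' < T), S.restr h.le p = w T'

/-- `B` is locally exact: on each face `T`, the sequence `0 → ℝ → B⁰(T) → B¹(T) → ⋯` is exact. -/
def LocallyExact (B : (k : ℕ) → (T : Face n) → Set (S.Pairs k T)) : Prop :=
  ∀ T : Face n,
    Function.Injective (S.const T) ∧
    (∀ p ∈ B 0 T, S.d p = 0 ↔ ∃ c, S.const T c = p) ∧
    (∀ k, ∀ p ∈ B (k + 1) T, S.d p = 0 ↔ ∃ q ∈ B k T, S.d q = p)

/-- Compatibility: extensions and local exactness. -/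
def Compatible (B : (k : ℕ) → (T : Face n) → Set (S.Pairs k T)) : Prop :=
  S.AdmitsExtensions B ∧ S.LocallyExact B

/-! ### Regularity and interpolation -/

/-- `C⁰_dΛ^k(S)`: pairs `(u, v)` where `u` is a continuous `k`-form on `|S|` whose exterior
derivative, in the sense of distributions in the interior of `|S|`, is the continuous `(k+1)`-form
`v` on `|S|`. -/
def C0d (k : ℕ) : Set (S.Pairs k (Face.top n)) :=
  {p | Continuous p ∧
    ∀ φ : Vec n → ℝ, ContDiff ℝ ∞ φ → HasCompactSupport φ →
      tsupport φ ⊆ interior (S.real (Face.top n)) → ∀ ξ : Fin (k + 1) → Vec n,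
      ∫ x, φ x * S.extendZero _ (fun y => (p y).2) x ξ =
        -∑ i : Fin (k + 1), (-1 : ℝ) ^ (i : ℕ) *
          ∫ x, fderiv ℝ φ x (ξ i) * S.extendZero _ (fun y => (p y).1) x (i.removeNth ξ)}

/-- The pairs `p` and `q` on `S` have the same degrees of freedom: the same values of both components
at the vertices, and the same integrals on the `k`-dimensional faces. -/
def SameDofs {k : ℕ} (p q : S.Pairs k (Face.top n)) : Prop :=
  (∀ (T : Face n) (hT : T ≤ Face.top n), T.dim = 0 → S.restr hT p = S.restr hT q) ∧
  ∀ (T : Face n) (hT : T ≤ Face.top n) (h : T.1.card = k + 1),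
    S.eval h (S.restr hT p) = S.eval h (S.restr hT q)

/-- The degrees of freedom (values at vertices of the form and of its exterior derivative, integrals
on `k`-faces) determine an interpolator from `C⁰_dΛ^k(S)` to `B^k(S)`, and it commutes with the
differential. -/
def HasCommutingInterpolators (B : (k : ℕ) → (T : Face n) → Set (S.Pairs k T)) : Prop :=
  (∀ k, ∀ p ∈ S.C0d k, ∃! q, q ∈ B k (Face.top n) ∧ S.SameDofs p q) ∧
  (∀ k, ∀ p ∈ S.C0d k, ∀ q ∈ B k (Face.top n), S.SameDofs p q →
    S.d p ∈ S.C0d (k + 1) ∧ S.d q ∈ B (k + 1) (Face.top n) ∧ S.SameDofs (S.d p) (S.d q))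

end SplitSimplex

end FES

end

/-! Let Z^k(T) (`Z`) be the space of continuous fields of ambient k-forms on T, affine on the cells
of R_{k-1}(T), whose pullback to T is closed and whose components in a direction of 𝕎_T are affine
on T. Such forms are affine on segments issued from W_T, so the Poincaré operator acts on them by an
explicit formula `Q`, and A^k(T) is exactly the set of pairs (w + Q_T v, v) with w in Z^k(T) and v
in Z^{k+1}(T) (`mem_A_iff`). Everything thus reduces to Z.

General position. The Powell–Sabin condition enters only through `isTransversal_of_isPowellSabin`:
the ambient space is the direct sum of the directions of T and of 𝕎_T. The rest of the argument
works in any dimension under this hypothesis.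

Rigidity. A p-form that is affine on the cells of R_p(T), whose exterior derivative on T is one and
the same constant form on all cells, and which vanishes at the vertices, vanishes on T
(`DConst.eq_zero`). Indeed, if it vanishes on the boundary of T, then λ_i(W_T) θ = dλ_i ∧ g(W_T) on
the cone over each facet, where θ = dg; summing over i gives θ = 0, and then g(W_T) pulls back to
zero on all facets. The boundary values are treated by induction on faces, because contraction by
W_T - W_G, for a facet G, preserves constancy of the derivative by Cartan's identity.

Restriction. If w is closed on T, its contraction by W_T - W_G has constant exterior derivative on
G, hence is affine on G by rigidity; since 𝕎_G is spanned by 𝕎_T and W_T - W_G, Z restricts to faces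
(`Z.mono`). The operators Q of nested faces differ by an element of Z (`Z.Q_sub_Q`), so A restricts
too.

Unisolvence. For k ≥ 1, an element of Z^k(T) is determined by its vertex values and its integrals on
k-faces (`Z.eq_zero_of_integral`). Conversely, coning produces closed forms with arbitrary vertex
values and a free constant form κ in the inpoint values (`exists_Z`); κ adjusts the integrals on the
k-faces that contain the first vertex (`exists_Z_integral`), and Stokes' formula determines the
others. Combining the two for v and w, the vertex values of u and v and the integrals of u on
k-faces are unisolvent degrees of freedom on A^k(T) (`eq_of_mem_A`, `exists_mem_A`), the only
compatibility being that for k = 0 the integrals are the vertex values.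

Conclusion. Extensions, the description of traces and the interpolators all follow by matching
degrees of freedom. Local exactness follows because Q inverts the differential on closed forms.
Regularity, and Stokes' formula on A, hold because continuous piecewise polynomials are Lipschitz,
so that integration by parts applies. The interpolators commute with d because Stokes' formula also
holds on C⁰_dΛ^k(S), by mollification in the interior and a homothety towards the inpoint. -/

noncomputable section

namespace FES

/-! ### Combinatorics of the faces of a simplex -/

namespace Face

variable {n : ℕ}

/-- The facet of `T` opposite to its vertex `i`. -/
def erase (T : Face n) (i : Fin (n + 1)) (h : 1 < T.1.card) : Face n :=
  ⟨T.1.erase i, by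
    rw [← Finset.card_pos]
    have := Finset.pred_card_le_card_erase (s := T.1) (a := i)
    omega⟩

theorem erase_le (T : Face n) (i : Fin (n + 1)) (h : 1 < T.1.card) : T.erase i h ≤ T :=
  Finset.erase_subset _ _

theorem card_pos (T : Face n) : 0 < T.1.card := Finset.card_pos.2 T.2

theorem card_erase {T : Face n} {i : Fin (n + 1)} (h : 1 < T.1.card) (hi : i ∈ T.1) :
    (T.erase i h).1.card = T.1.card - 1 := Finset.card_erase_of_mem hi

theorem erase_lt {T : Face n} {i : Fin (n + 1)} (h : 1 < T.1.card) (hi : i ∈ T.1) :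
    T.erase i h < T := Finset.erase_ssubset hi

theorem dim_erase {T : Face n} {i : Fin (n + 1)} (h : 1 < T.1.card) (hi : i ∈ T.1) :
    (T.erase i h).dim = T.dim - 1 := by
  unfold dim; rw [card_erase h hi]

theorem not_mem_erase (T : Face n) (i : Fin (n + 1)) (h : 1 < T.1.card) :
    i ∉ (T.erase i h).1 := Finset.notMem_erase _ _

theorem dim_mono {T U : Face n} (h : T ≤ U) : T.dim ≤ U.dim :=
  Nat.sub_le_sub_right (Finset.card_le_card h) 1

theorem dim_lt {T U : Face n} (h : T < U) : T.dim < U.dim := by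
  have h1 := Finset.card_lt_card h
  have h2 := T.card_pos
  unfold dim; omega

theorem one_lt_card {T : Face n} (h : 0 < T.dim) : 1 < T.1.card := by
  unfold dim at h; omega

theorem exists_le_erase {T U : Face n} (h : U < T) :
    ∃ i ∈ T.1, ∃ hT : 1 < T.1.card, U ≤ T.erase i hT := by
  obtain ⟨h1, i, hi, hiU⟩ := Finset.ssubset_iff_subset_ne.1 h |>.elim fun h1 h2 =>
    (⟨h1, Finset.exists_of_ssubset h⟩ : U.1 ⊆ T.1 ∧ ∃ i ∈ T.1, i ∉ U.1)
  have hT : 1 < T.1.card := by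
    have h1 := Finset.card_lt_card h
    have h2 := U.card_pos
    omega
  exact ⟨i, hi, hT, Finset.subset_erase.2 ⟨h1, hiU⟩⟩

/-- Induction over faces, along facets. -/
theorem facet_induction {P : Face n → Prop}
    (h : ∀ T : Face n, (∀ i ∈ T.1, ∀ hT : 1 < T.1.card, P (T.erase i hT)) → P T) (T : Face n) :
    P T := by
  induction hN : T.1.card using Nat.strong_induction_on generalizing T with
  | _ N ih =>
    refine h T fun i hi hT => ih _ ?_ _ rfl
    rw [card_erase hT hi]; omega

theorem le_top (T : Face n) : T ≤ top n := Finset.subset_univ _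

/-- The vertex `i`, as a face. -/
def single (i : Fin (n + 1)) : Face n := ⟨{i}, Finset.singleton_nonempty i⟩

theorem single_le {T : Face n} {i : Fin (n + 1)} (h : i ∈ T.1) : single i ≤ T :=
  Finset.singleton_subset_iff.2 h

end Face

namespace SplitSimplex

variable {n : ℕ} (S : SplitSimplex n)

/-! ### Barycentric coordinates -/

theorem affineSpan_vertex : affineSpan ℝ (Set.range S.vertex) = ⊤ :=
  S.affineIndependent.affineSpan_eq_top_iff_card_eq_finrank_add_one.2 (by simp)

/-- The vertices as an affine basis. -/
def basis : AffineBasis (Fin (n + 1)) ℝ (Vec n) :=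
  ⟨S.vertex, S.affineIndependent, S.affineSpan_vertex⟩

/-- The barycentric coordinates. -/
def bary (i : Fin (n + 1)) (x : Vec n) : ℝ := S.basis.coord i x

/-- The differentials of the barycentric coordinates. -/
def dbary (i : Fin (n + 1)) : Vec n →L[ℝ] ℝ := LinearMap.toContinuousLinearMap (S.basis.coord i).linear

theorem bary_eq (i : Fin (n + 1)) (x : Vec n) : S.bary i x = S.bary i 0 + S.dbary i x := by
  have := (S.basis.coord i).map_vadd 0 x
  simp only [vadd_eq_add, add_zero] at this
  rw [bary, this, add_comm]; rfl

theorem dbary_sub (i : Fin (n + 1)) (x y : Vec n) :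
    S.dbary i (x - y) = S.bary i x - S.bary i y := by
  rw [S.bary_eq i x, S.bary_eq i y, map_sub]; ring

theorem continuous_bary (i : Fin (n + 1)) : Continuous (S.bary i) := by
  have : S.bary i = fun x => S.bary i 0 + S.dbary i x := funext (S.bary_eq i)
  rw [this]; fun_prop

theorem bary_vertex (i j : Fin (n + 1)) : S.bary i (S.vertex j) = if i = j then 1 else 0 :=
  S.basis.coord_apply i j

theorem sum_bary (x : Vec n) : ∑ i, S.bary i x = 1 := S.basis.sum_coord_apply_eq_one x

theorem sum_bary_smul (x : Vec n) : ∑ i, S.bary i x • S.vertex i = x :=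
  S.basis.linear_combination_coord_eq_self x

theorem sum_dbary (ξ : Vec n) : ∑ i, S.dbary i ξ = 0 := by
  have h1 := S.sum_bary ξ
  have h2 := S.sum_bary 0
  have : ∀ i, S.dbary i ξ = S.bary i ξ - S.bary i 0 := fun i => by rw [S.bary_eq i ξ]; ring
  simp only [this, Finset.sum_sub_distrib, h1, h2, sub_self]

theorem sum_dbary_smul (ξ : Vec n) : ∑ i, S.dbary i ξ • S.vertex i = ξ := by
  have h1 := S.sum_bary_smul ξ
  have h2 := S.sum_bary_smul 0
  have : ∀ i, S.dbary i ξ = S.bary i ξ - S.bary i 0 := fun i => by rw [S.bary_eq i ξ]; ring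
  simp only [this, sub_smul, Finset.sum_sub_distrib, h1, h2, sub_zero]

theorem bary_ext {x y : Vec n} (h : ∀ i, S.bary i x = S.bary i y) : x = y :=
  S.basis.ext_elem h

theorem bary_combo (i : Fin (n + 1)) {s : Finset (Fin (n + 1))} {a : Fin (n + 1) → ℝ}
    (h : ∑ j ∈ s, a j = 1) :
    S.bary i (∑ j ∈ s, a j • S.vertex j) = if i ∈ s then a i else 0 := by
  have h0 : S.bary i (∑ j ∈ s, a j • S.vertex j) = ∑ j ∈ s, a j * S.bary i (S.vertex j) := by
    rw [S.bary_eq, map_sum]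
    simp only [map_smul, smul_eq_mul]
    rw [← one_mul (S.bary i 0), ← h, Finset.sum_mul, ← Finset.sum_add_distrib]
    refine Finset.sum_congr rfl fun j _ => ?_
    rw [S.bary_eq i (S.vertex j)]; ring
  rw [h0]; simp [bary_vertex]

theorem mem_real {T : Face n} {x : Vec n} :
    x ∈ S.real T ↔ (∀ i, 0 ≤ S.bary i x) ∧ ∀ i ∉ T.1, S.bary i x = 0 := by
  constructor
  · intro hx
    have hconv : Convex ℝ {x | (∀ i, 0 ≤ S.bary i x) ∧ ∀ i ∉ T.1, S.bary i x = 0} := by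
      intro x hx y hy a b ha hb hab
      have key : ∀ i, S.bary i (a • x + b • y) = a * S.bary i x + b * S.bary i y := fun i => by
        rw [S.bary_eq, S.bary_eq i x, S.bary_eq i y, map_add, map_smul, map_smul, smul_eq_mul,
          smul_eq_mul]
        linear_combination -S.bary i 0 * hab
      refine ⟨fun i => ?_, fun i hi => ?_⟩
      · rw [key]; exact add_nonneg (mul_nonneg ha (hx.1 i)) (mul_nonneg hb (hy.1 i))
      · rw [key, hx.2 i hi, hy.2 i hi]; simp
    refine convexHull_min ?_ hconv hx
    rintro _ ⟨j, hj, rfl⟩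
    refine ⟨fun i => ?_, fun i hi => ?_⟩
    · rw [bary_vertex]; split_ifs <;> norm_num
    · rw [bary_vertex, if_neg]; rintro rfl; exact hi hj
  · rintro ⟨h1, h2⟩
    have hx : x = ∑ i ∈ T.1, S.bary i x • S.vertex i := by
      conv_lhs => rw [← S.sum_bary_smul x]
      refine (Finset.sum_subset (Finset.subset_univ _) fun i _ hi => ?_).symm
      rw [h2 i hi, zero_smul]
    have hs : ∑ i ∈ T.1, S.bary i x = 1 := by
      rw [← S.sum_bary x]
      exact (Finset.sum_subset (Finset.subset_univ _) fun i _ hi => h2 i hi)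
    rw [hx]
    exact (convex_convexHull ℝ _).sum_mem (fun i _ => h1 i) hs fun i hi =>
      subset_convexHull ℝ _ (Set.mem_image_of_mem _ (Finset.mem_coe.2 hi))

theorem bary_inpoint_pos {T : Face n} {i : Fin (n + 1)} (hi : i ∈ T.1) :
    0 < S.bary i (S.inpoint T) := by
  obtain ⟨a, ha, hs, hW⟩ := S.inpoint_mem T
  rw [hW, S.bary_combo i hs, if_pos hi]; exact ha i hi

theorem bary_inpoint_eq_zero {T : Face n} {i : Fin (n + 1)} (hi : i ∉ T.1) :
    S.bary i (S.inpoint T) = 0 := (S.mem_real.1 (S.inpoint_mem_real T)).2 i hi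

theorem vertex_mem_real {T : Face n} {i : Fin (n + 1)} (hi : i ∈ T.1) : S.vertex i ∈ S.real T :=
  subset_convexHull ℝ _ (Set.mem_image_of_mem _ (Finset.mem_coe.2 hi))

theorem convex_real (T : Face n) : Convex ℝ (S.real T) := convex_convexHull ℝ _

theorem isCompact_real (T : Face n) : IsCompact (S.real T) :=
  ((Finset.finite_toSet T.1).image S.vertex).isCompact_convexHull (𝕜 := ℝ)

/-! ### Tangent directions of faces, and cones over facets -/

theorem mem_dir {T : Face n} {ξ : Vec n} : ξ ∈ S.dir T ↔ ∀ i ∉ T.1, S.dbary i ξ = 0 := by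
  constructor
  · intro h i hi
    have : S.dir T ≤ LinearMap.ker (S.dbary i : Vec n →ₗ[ℝ] ℝ) := by
      unfold dir
      rw [vectorSpan_def, Submodule.span_le]
      rintro _ ⟨_, ⟨j, hj, rfl⟩, _, ⟨l, hl, rfl⟩, rfl⟩
      have hj' : i ≠ j := by rintro rfl; exact hi hj
      have hl' : i ≠ l := by rintro rfl; exact hi hl
      simp [dbary_sub, bary_vertex, hj', hl']
    exact this h
  · intro h
    obtain ⟨o, ho⟩ := T.2
    have hξ : ξ = ∑ i ∈ T.1, S.dbary i ξ • (S.vertex i - S.vertex o) := by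
      conv_lhs => rw [← S.sum_dbary_smul ξ]
      have h1 : ∑ i, S.dbary i ξ • S.vertex i = ∑ i ∈ T.1, S.dbary i ξ • S.vertex i :=
        (Finset.sum_subset (Finset.subset_univ _) fun i _ hi => by rw [h i hi, zero_smul]).symm
      have h2 : ∑ i ∈ T.1, S.dbary i ξ = 0 := by
        rw [← S.sum_dbary ξ]
        exact Finset.sum_subset (Finset.subset_univ _) fun i _ hi => h i hi
      simp only [smul_sub, Finset.sum_sub_distrib, ← Finset.sum_smul, h2, zero_smul, sub_zero, h1]
    rw [hξ]
    refine Submodule.sum_mem _ fun i hi => Submodule.smul_mem _ _ ?_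
    exact vsub_mem_vectorSpan ℝ (Set.mem_image_of_mem _ (Finset.mem_coe.2 hi))
      (Set.mem_image_of_mem _ (Finset.mem_coe.2 ho))

theorem dir_mono {T U : Face n} (h : T ≤ U) : S.dir T ≤ S.dir U :=
  vectorSpan_mono ℝ (Set.image_mono (Finset.coe_subset.2 h))

theorem sub_mem_dir {T : Face n} {x y : Vec n} (hx : x ∈ S.real T) (hy : y ∈ S.real T) :
    x - y ∈ S.dir T := by
  rw [mem_dir]
  intro i hi
  rw [dbary_sub, (S.mem_real.1 hx).2 i hi, (S.mem_real.1 hy).2 i hi, sub_self]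

theorem finrank_dir (T : Face n) : Module.finrank ℝ (S.dir T) = T.dim := by
  classical
  have := S.affineIndependent.finrank_vectorSpan_image_finset (s := T.1) (n := T.dim)
    (by unfold Face.dim; have := T.card_pos; omega)
  unfold dir
  rw [← this, Finset.coe_image]

theorem inpoint_mem_of_le {T U : Face n} (h : T ≤ U) : S.inpoint T ∈ S.real U :=
  S.real_mono h (S.inpoint_mem_real T)

theorem dbary_inpoint_sub_erase {T : Face n} (i : Fin (n + 1)) (h : 1 < T.1.card) :
    S.dbary i (S.inpoint T - S.inpoint (T.erase i h)) = S.bary i (S.inpoint T) := by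
  rw [dbary_sub, S.bary_inpoint_eq_zero (T.not_mem_erase i h), sub_zero]

theorem inpoint_sub_mem_dir {T U : Face n} (h : T ≤ U) :
    S.inpoint U - S.inpoint T ∈ S.dir U :=
  S.sub_mem_dir (S.inpoint_mem_real U) (S.inpoint_mem_of_le h)

/-- A vector tangent to `T` is decomposed along a facet and the line joining the inpoints. -/
theorem sub_smul_mem_dir_erase {T : Face n} {i : Fin (n + 1)} (hi : i ∈ T.1) (h : 1 < T.1.card)
    {ξ : Vec n} (hξ : ξ ∈ S.dir T) :
    ξ - (S.dbary i ξ / S.bary i (S.inpoint T)) • (S.inpoint T - S.inpoint (T.erase i h)) ∈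
      S.dir (T.erase i h) := by
  rw [mem_dir] at hξ ⊢
  intro j hj
  rw [map_sub, map_smul, smul_eq_mul]
  by_cases hij : j = i
  · subst hij
    rw [dbary_inpoint_sub_erase, div_mul_cancel₀ _ (S.bary_inpoint_pos hi).ne', sub_self]
  · have hjT : j ∉ T.1 := fun hjT => hj (Finset.mem_erase.2 ⟨hij, hjT⟩)
    rw [hξ j hjT, S.mem_dir.1 (S.inpoint_sub_mem_dir (T.erase_le i h)) j hjT]; simp

theorem mem_dir_erase {T : Face n} {i : Fin (n + 1)} {h : 1 < T.1.card} {ξ : Vec n} :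
    ξ ∈ S.dir (T.erase i h) ↔ ξ ∈ S.dir T ∧ S.dbary i ξ = 0 := by
  constructor
  · exact fun hξ => ⟨S.dir_mono (T.erase_le i h) hξ, S.mem_dir.1 hξ i (T.not_mem_erase i h)⟩
  · rintro ⟨h1, h2⟩
    rw [mem_dir] at h1 ⊢
    intro j hj
    by_cases hij : j = i
    · rw [hij, h2]
    · exact h1 j fun hjT => hj (Finset.mem_erase.2 ⟨hij, hjT⟩)

/-- A simplex is covered by the cones over its facets. -/
theorem exists_mem_cone {T : Face n} (h : 1 < T.1.card) {x : Vec n} (hx : x ∈ S.real T) :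
    ∃ i ∈ T.1, ∃ y ∈ S.real (T.erase i h), ∃ s ∈ Set.Icc (0 : ℝ) 1,
      x = s • S.inpoint T + (1 - s) • y := by
  -- The minimal ratio `s` is the largest multiple of the coordinates of W_T that fits below those
  -- of x. The remainder vanishes at the minimizing index, so it lies over the opposite facet.
  obtain ⟨i, hi, hmin⟩ := Finset.exists_min_image T.1
    (fun i => S.bary i x / S.bary i (S.inpoint T)) T.2
  rw [mem_real] at hx
  set s := S.bary i x / S.bary i (S.inpoint T) with hs
  have hle : ∀ j, s * S.bary j (S.inpoint T) ≤ S.bary j x := by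
    intro j
    by_cases hj : j ∈ T.1
    · exact (le_div_iff₀ (S.bary_inpoint_pos hj)).1 (hmin j hj)
    · rw [S.bary_inpoint_eq_zero hj, mul_zero]; exact hx.1 j
  have hs0 : 0 ≤ s := div_nonneg (hx.1 i) (S.bary_inpoint_pos hi).le
  have hs1 : s ≤ 1 := by
    have := Finset.sum_le_sum fun j (_ : j ∈ Finset.univ) => hle j
    rwa [← Finset.mul_sum, S.sum_bary, S.sum_bary, mul_one] at this
  have hsi : s * S.bary i (S.inpoint T) = S.bary i x :=
    div_mul_cancel₀ _ (S.bary_inpoint_pos hi).ne'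
  refine ⟨i, hi, ?_⟩
  -- If s = 1, the inequalities `hle` are equalities because both sides sum to 1. Then x is the
  -- inpoint and y may be any point of the facet.
  rcases hs1.eq_or_lt with h1 | h1
  · refine ⟨S.inpoint (T.erase i h), S.inpoint_mem_real _, 1, by simp, ?_⟩
    rw [h1] at hle
    simp only [one_mul] at hle
    have : ∀ j, S.bary j x = S.bary j (S.inpoint T) := by
      have h2 : ∑ j, (S.bary j x - S.bary j (S.inpoint T)) = 0 := by
        rw [Finset.sum_sub_distrib, S.sum_bary, S.sum_bary, sub_self]
      rw [Finset.sum_eq_zero_iff_of_nonneg fun j _ => sub_nonneg.2 (hle j)] at h2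
      exact fun j => sub_eq_zero.1 (h2 j (Finset.mem_univ _))
    rw [S.bary_ext this]; simp
  · have h1' : 0 < 1 - s := by linarith
    have hy : ∀ j, S.bary j ((1 - s)⁻¹ • (x - s • S.inpoint T)) =
        (1 - s)⁻¹ * (S.bary j x - s * S.bary j (S.inpoint T)) := fun j => by
      rw [S.bary_eq j, S.bary_eq j x, S.bary_eq j (S.inpoint T)]
      simp only [map_smul, map_sub, smul_eq_mul]
      field_simp
      ring
    refine ⟨(1 - s)⁻¹ • (x - s • S.inpoint T), ?_, s, ⟨hs0, hs1⟩, ?_⟩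
    · rw [mem_real]
      refine ⟨fun j => ?_, fun j hj => ?_⟩
      · rw [hy]; exact mul_nonneg (inv_nonneg.2 h1'.le) (sub_nonneg.2 (hle j))
      · rw [hy]
        by_cases hji : j = i
        · rw [hji, hsi]; simp
        · have hjT : j ∉ T.1 := fun hjT => hj (Finset.mem_erase.2 ⟨hji, hjT⟩)
          rw [hx.2 j hjT, S.bary_inpoint_eq_zero hjT]; simp
    · rw [smul_inv_smul₀ h1'.ne']; simp

end SplitSimplex

end FES

namespace FES

namespace SplitSimplex

variable {n : ℕ} (S : SplitSimplex n)

/-! ### Cells of the refinements -/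

theorem refinement_mono {m : ℕ} {T' T : Face n} (h : T' ≤ T) :
    S.refinement m T' ⊆ S.refinement m T := by
  rintro σ ⟨U, C, hU, hm, hC, hCU, rfl⟩
  exact ⟨U, C, hU.trans h, hm, hC, fun X hX => ⟨(hCU X hX).1, (hCU X hX).2.1.trans h,
    (hCU X hX).2.2⟩, rfl⟩

theorem real_mem_refinement {m : ℕ} {T : Face n} (h : T.dim ≤ m) :
    S.real T ∈ S.refinement m T :=
  ⟨T, ∅, le_rfl, h, Set.pairwise_empty _, by simp, by simp [real]⟩

theorem cell_subset {m : ℕ} {T : Face n} {σ : Set (Vec n)} (hσ : σ ∈ S.refinement m T) :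
    σ ⊆ S.real T := by
  obtain ⟨U, C, hU, hm, hC, hCU, rfl⟩ := hσ
  refine convexHull_min (Set.union_subset ?_ ?_) (S.convex_real T)
  · rintro _ ⟨i, hi, rfl⟩
    exact S.vertex_mem_real (hU hi)
  · rintro _ ⟨X, hX, rfl⟩
    exact S.inpoint_mem_of_le (hCU X hX).2.1

theorem convex_cell {m : ℕ} {T : Face n} {σ : Set (Vec n)} (hσ : σ ∈ S.refinement m T) :
    Convex ℝ σ := by
  obtain ⟨U, C, hU, hm, hC, hCU, rfl⟩ := hσ
  exact convex_convexHull ℝ _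

theorem isCompact_cell {m : ℕ} {T : Face n} {σ : Set (Vec n)} (hσ : σ ∈ S.refinement m T) :
    IsCompact σ := by
  obtain ⟨U, C, hU, hm, hC, hCU, rfl⟩ := hσ
  exact (((Finset.finite_toSet _).image _).union (C.toFinite.image _)).isCompact_convexHull (𝕜 := ℝ)

theorem finite_refinement (m : ℕ) (T : Face n) : (S.refinement m T).Finite := by
  refine (Set.finite_range fun p : Face n × Set (Face n) =>
    convexHull ℝ (S.vertex '' (p.1.1 : Set (Fin (n + 1))) ∪ S.inpoint '' p.2)).subset ?_
  rintro σ ⟨U, C, hU, hm, hC, hCU, rfl⟩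
  exact ⟨(U, C), rfl⟩

/-- Adding T to the chain adds the vertex W_T to the cell. Together with `exists_subset_cone` this
presents R_m(T) as the cone over the R_m of the facets, which is the recursion used in all
inductions on faces. -/
theorem cone_mem_refinement {m : ℕ} {T' T : Face n} (h : T' < T) (hm : m + 1 ≤ T.dim)
    {σ : Set (Vec n)} (hσ : σ ∈ S.refinement m T') :
    convexHull ℝ (insert (S.inpoint T) σ) ∈ S.refinement m T := by
  obtain ⟨U, C, hU, hm', hC, hCU, rfl⟩ := hσ
  refine ⟨U, insert T C, hU.trans h.le, hm', hC.insert fun X hX _ => ?_, ?_, ?_⟩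
  · exact Or.inr ((hCU X hX).2.1.trans h.le)
  · rintro X (rfl | hX)
    · exact ⟨hU.trans_lt h, le_rfl, hm⟩
    · exact ⟨(hCU X hX).1, (hCU X hX).2.1.trans h.le, (hCU X hX).2.2⟩
  · rw [Set.image_insert_eq, Set.union_insert, ← Set.singleton_union,
      convexHull_convexHull_union_right, Set.singleton_union]

theorem exists_subset_cone {m : ℕ} {T : Face n} (hm : m + 1 ≤ T.dim) {σ : Set (Vec n)}
    (hσ : σ ∈ S.refinement m T) : ∃ i ∈ T.1, ∃ h : 1 < T.1.card,
      ∃ σ' ∈ S.refinement m (T.erase i h), σ ⊆ convexHull ℝ (insert (S.inpoint T) σ') := by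
  obtain ⟨U, C, hU, hm', hC, hCU, rfl⟩ := hσ
  have hUT : U < T := lt_of_le_of_ne hU (by rintro rfl; omega)
  -- The largest face of the chain other than T, or U if there is none, is a proper subface. Any
  -- facet containing it contains the base of the cone.
  obtain ⟨M, hMT, hUM, hM⟩ : ∃ M < T, U ≤ M ∧ ∀ X ∈ C \ {T}, X ≤ M := by
    rcases (C \ {T}).eq_empty_or_nonempty with h | h
    · exact ⟨U, hUT, le_rfl, by simp [h]⟩
    · obtain ⟨M, hM, hmax⟩ := Set.exists_max_image _ Face.dim (C \ {T}).toFinite h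
      refine ⟨M, lt_of_le_of_ne (hCU M hM.1).2.1 hM.2, (hCU M hM.1).1.le, fun X hX => ?_⟩
      rcases hC.total hX.1 hM.1 with h1 | h1
      · exact h1
      · rcases h1.eq_or_lt with h2 | h2
        · exact h2.ge
        · exact absurd (Face.dim_lt h2) (not_lt.2 (hmax X hX))
  obtain ⟨i, hi, h, hMi⟩ := Face.exists_le_erase hMT
  refine ⟨i, hi, h, _, ⟨U, C \ {T}, hUM.trans hMi, hm', hC.mono Set.sdiff_subset, fun X hX =>
    ⟨(hCU X hX.1).1, (hM X hX).trans hMi, (hCU X hX.1).2.2⟩, rfl⟩, ?_⟩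
  rw [← Set.singleton_union, convexHull_convexHull_union_right]
  refine convexHull_mono ?_
  rintro x (hx | ⟨X, hX, rfl⟩)
  · exact Or.inr (Or.inl hx)
  · by_cases hXT : X = T
    · exact Or.inl (by rw [hXT]; rfl)
    · exact Or.inr (Or.inr ⟨X, ⟨hX, hXT⟩, rfl⟩)

theorem dir_le_vectorSpan_cone {T : Face n} {i : Fin (n + 1)} (hi : i ∈ T.1) (h : 1 < T.1.card)
    {σ : Set (Vec n)} (hσ : S.inpoint (T.erase i h) ∈ σ)
    (hd : S.dir (T.erase i h) ≤ vectorSpan ℝ σ) :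
    S.dir T ≤ vectorSpan ℝ (convexHull ℝ (insert (S.inpoint T) σ)) := by
  intro ξ hξ
  have h1 := S.sub_smul_mem_dir_erase hi h hξ
  have h2 : σ ⊆ convexHull ℝ (insert (S.inpoint T) σ) :=
    (Set.subset_insert _ _).trans (subset_convexHull ℝ _)
  have h3 := vectorSpan_mono ℝ h2 (hd h1)
  rw [← sub_add_cancel ξ ((S.dbary i ξ / S.bary i (S.inpoint T)) •
    (S.inpoint T - S.inpoint (T.erase i h)))]
  refine add_mem h3 (Submodule.smul_mem _ _ ?_)
  exact vsub_mem_vectorSpan ℝ (subset_convexHull ℝ _ (Set.mem_insert _ _)) (h2 hσ)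

theorem dir_eq_vectorSpan_real (T : Face n) : S.dir T ≤ vectorSpan ℝ (S.real T) :=
  vectorSpan_mono ℝ (subset_convexHull ℝ _)

/-- Every cell is contained in a cell of full dimension, with the inpoint as a vertex. -/
theorem exists_full_cell {m : ℕ} {T : Face n} {σ : Set (Vec n)} (hσ : σ ∈ S.refinement m T) :
    ∃ τ ∈ S.refinement m T, σ ⊆ τ ∧ S.inpoint T ∈ τ ∧ S.dir T ≤ vectorSpan ℝ τ := by
  induction T using Face.facet_induction generalizing σ with
  | _ T ih =>
    rcases Nat.lt_or_ge m T.dim with hm | hm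
    · obtain ⟨i, hi, h, σ', hσ', hsub⟩ := S.exists_subset_cone hm hσ
      obtain ⟨τ, hτ, h1, h2, h3⟩ := ih i hi h hσ'
      exact ⟨_, S.cone_mem_refinement (Face.erase_lt h hi) hm hτ,
        hsub.trans (convexHull_mono (Set.insert_subset_insert h1)),
        subset_convexHull ℝ _ (Set.mem_insert _ _), S.dir_le_vectorSpan_cone hi h h2 h3⟩
    · exact ⟨_, S.real_mem_refinement hm, S.cell_subset hσ, S.inpoint_mem_real T,
        S.dir_eq_vectorSpan_real T⟩

/-- Both refinements are obtained by coning; for m + 1 the coning starts one dimension later, the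
faces of dimension at most m + 1 being unsplit. -/
theorem exists_coarser_cell {m : ℕ} {T : Face n} {σ : Set (Vec n)} (hσ : σ ∈ S.refinement m T) :
    ∃ τ ∈ S.refinement (m + 1) T, σ ⊆ τ := by
  induction T using Face.facet_induction generalizing σ with
  | _ T ih =>
    rcases Nat.lt_or_ge (m + 1) T.dim with hm | hm
    · obtain ⟨i, hi, h, σ', hσ', hsub⟩ := S.exists_subset_cone (by omega) hσ
      obtain ⟨τ, hτ, h1⟩ := ih i hi h hσ'
      exact ⟨_, S.cone_mem_refinement (Face.erase_lt h hi) hm hτ,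
        hsub.trans (convexHull_mono (Set.insert_subset_insert h1))⟩
    · exact ⟨_, S.real_mem_refinement hm, S.cell_subset hσ⟩

theorem exists_coarser_cell_pred {k : ℕ} {T : Face n} {σ : Set (Vec n)}
    (hσ : σ ∈ S.refinement (k - 1) T) : ∃ τ ∈ S.refinement k T, σ ⊆ τ := by
  cases k with
  | zero => exact ⟨σ, hσ, subset_rfl⟩
  | succ k => exact S.exists_coarser_cell hσ

theorem exists_mem_cell (m : ℕ) {T : Face n} {x : Vec n} (hx : x ∈ S.real T) :
    ∃ σ ∈ S.refinement m T, x ∈ σ := by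
  induction T using Face.facet_induction generalizing x with
  | _ T ih =>
    rcases Nat.lt_or_ge m T.dim with hm | hm
    · have h : 1 < T.1.card := Face.one_lt_card (by omega)
      obtain ⟨i, hi, y, hy, s, hs, rfl⟩ := S.exists_mem_cone h hx
      obtain ⟨σ, hσ, hyσ⟩ := ih i hi h hy
      refine ⟨_, S.cone_mem_refinement (Face.erase_lt h hi) hm hσ, ?_⟩
      exact convex_convexHull ℝ _ (subset_convexHull ℝ _ (Set.mem_insert _ _))
        (subset_convexHull ℝ _ (Set.mem_insert_of_mem _ hyσ)) hs.1 (by linarith [hs.2]) (by ring)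
    · exact ⟨_, S.real_mem_refinement hm, hx⟩

/-- A cell of a subface, together with the inpoint of the face, is contained in a cell. -/
theorem exists_cell_insert {m : ℕ} {T' T : Face n} (h : T' ≤ T) {σ : Set (Vec n)}
    (hσ : σ ∈ S.refinement m T') : ∃ τ ∈ S.refinement m T, σ ⊆ τ ∧ S.inpoint T ∈ τ := by
  obtain ⟨τ, h1, h2, h3, -⟩ := S.exists_full_cell (S.refinement_mono h hσ)
  exact ⟨τ, h1, h2, h3⟩

end SplitSimplex

end FES

namespace FES

open ContinuousAlternatingMap Matrix

/-! ### Alternating forms -/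

section Alternating

variable {E : Type} [NormedAddCommGroup E] [NormedSpace ℝ E]

/-- Contraction of alternating forms by a vector. -/
def contract {p : ℕ} (Y : E) : Alt (p + 1) E →L[ℝ] Alt p E :=
  (curryLeftLI (𝕜 := ℝ) (E := E) (F := ℝ) (n := p)).toContinuousLinearMap.flip Y

theorem contract_eq {p : ℕ} (Y : E) (f : Alt (p + 1) E) : contract Y f = f.curryLeft Y := rfl

theorem contract_apply {p : ℕ} (Y : E) (f : Alt (p + 1) E) (ξ : Fin p → E) :
    contract Y f ξ = f (vecCons Y ξ) := rfl

theorem map_vecCons_swap {p : ℕ} (f : Alt (p + 2) E) (x y : E) (ξ : Fin p → E) :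
    f (vecCons x (vecCons y ξ)) = -f (vecCons y (vecCons x ξ)) := by
  have h := f.toAlternatingMap.map_swap (vecCons y (vecCons x ξ)) (i := 0) (j := 1) (by simp)
  refine Eq.trans ?_ h
  refine congrArg f ?_
  ext i : 1
  refine Fin.cases ?_ (fun i => Fin.cases ?_ (fun i => ?_) i) i
  · simp
  · simp
  · rw [Function.comp_apply, Equiv.swap_apply_of_ne_of_ne] <;> simp [Fin.ext_iff]

theorem map_vecCons_add {p : ℕ} (f : Alt (p + 1) E) (x y : E) (ξ : Fin p → E) :
    f (vecCons (x + y) ξ) = f (vecCons x ξ) + f (vecCons y ξ) := by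
  simp only [← contract_apply, contract_eq, map_add, ContinuousAlternatingMap.add_apply]

theorem map_vecCons_smul {p : ℕ} (f : Alt (p + 1) E) (c : ℝ) (x : E) (ξ : Fin p → E) :
    f (vecCons (c • x) ξ) = c * f (vecCons x ξ) := by
  simp only [← contract_apply, contract_eq, map_smul, ContinuousAlternatingMap.smul_apply,
    smul_eq_mul]

theorem map_vecCons_same {p : ℕ} (f : Alt (p + 2) E) (x : E) (ξ : Fin p → E) :
    f (vecCons x (vecCons x ξ)) = 0 := by
  have := map_vecCons_swap f x x ξ
  linarith

/-- Cartan's identity for an affine form with linear part L and a constant field Y: the contraction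
of d by Y is the derivative L Y along Y minus d of the contraction. -/
theorem alternatizeUncurryFin_vecCons {p : ℕ} (L : E →L[ℝ] Alt (p + 1) E) (Y : E)
    (η : Fin (p + 1) → E) :
    alternatizeUncurryFin L (vecCons Y η) =
      L Y η - alternatizeUncurryFin ((contract Y).comp L) η := by
  rw [alternatizeUncurryFin_apply, alternatizeUncurryFin_apply, Fin.sum_univ_succ, sub_eq_add_neg,
    ← Finset.sum_neg_distrib]
  congr 1
  · simp
  · refine Finset.sum_congr rfl fun i _ => ?_
    have : i.succ.removeNth (vecCons Y η) = vecCons Y (i.removeNth η) := by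
      ext j : 1
      refine Fin.cases ?_ (fun j => ?_) j <;> simp [Fin.removeNth]
    rw [this]
    simp [pow_succ, contract_apply]

theorem contract_alternatizeUncurryFin {p : ℕ} (L : E →L[ℝ] Alt (p + 1) E) (Y : E) :
    contract Y (alternatizeUncurryFin L) = L Y - alternatizeUncurryFin ((contract Y).comp L) := by
  ext η
  rw [contract_apply, alternatizeUncurryFin_vecCons]; rfl

theorem alternatizeUncurryFin_sub {p : ℕ} (L L' : E →L[ℝ] Alt p E) :
    alternatizeUncurryFin (L - L') = alternatizeUncurryFin L - alternatizeUncurryFin L' :=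
  map_sub (alternatizeUncurryFinCLM ℝ E ℝ) L L'

theorem alternatizeUncurryFin_sum {p : ℕ} {ι : Type} (s : Finset ι) (L : ι → E →L[ℝ] Alt p E) :
    alternatizeUncurryFin (∑ i ∈ s, L i) = ∑ i ∈ s, alternatizeUncurryFin (L i) :=
  map_sum (alternatizeUncurryFinCLM ℝ E ℝ) L s

/-- `alternatizeUncurryFin` only depends on the restriction to a subspace, for arguments in it. -/
theorem alternatizeUncurryFin_congr {p : ℕ} {L L' : E →L[ℝ] Alt p E} {ξ : Fin (p + 1) → E}
    (h : ∀ i, L (ξ i) (i.removeNth ξ) = L' (ξ i) (i.removeNth ξ)) :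
    alternatizeUncurryFin L ξ = alternatizeUncurryFin L' ξ := by
  simp only [alternatizeUncurryFin_apply, h]

/-- Membership in a subspace of a family of alternating forms, from its components along two
subspaces. -/
theorem forms_mem_of_add {X : Type} (P : Submodule ℝ (X → ℝ)) (D : Submodule ℝ E) (B : Set E)
    (U : Set E) (hU : ∀ ξ ∈ U, ∃ d ∈ D, ∃ z ∈ B, ξ = d + z) (hDU : ∀ d ∈ D, d ∈ U) {p : ℕ}
    (h : X → Alt p E) (h1 : ∀ ξ : Fin p → E, (∀ i, ξ i ∈ D) → (fun x => h x ξ) ∈ P)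
    (h2 : ∀ q, ∀ e : q + 1 = p, ∀ z ∈ B, ∀ η : Fin q → E, (∀ i, η i ∈ U) →
      (fun x => h x (vecCons z η ∘ Fin.cast e.symm)) ∈ P)
    (ξ : Fin p → E) (hξ : ∀ i, ξ i ∈ U) : (fun x => h x ξ) ∈ P := by
  induction p with
  | zero => exact h1 ξ fun i => i.elim0
  | succ p ih =>
    -- Only the first argument is split. Its part in `B` is covered by `h2`, and its part d in `D`
    -- by the induction hypothesis applied to the contraction by d.
    obtain ⟨d, hd, z, hz, hdz⟩ := hU _ (hξ 0)
    have e : ξ = vecCons (d + z) (vecTail ξ) := by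
      rw [← hdz]; exact (Matrix.cons_head_tail ξ).symm
    have e2 : (fun x => h x ξ) = (fun x => (contract d (h x)) (vecTail ξ)) +
        fun x => h x (vecCons z (vecTail ξ)) := by
      ext x
      conv_lhs => rw [e]
      rw [map_vecCons_add]; rfl
    have hv : ∀ i, vecTail ξ i ∈ U := fun i => hξ i.succ
    rw [e2]
    refine P.add_mem (ih (fun x => contract d (h x)) (fun η hη => ?_) (fun q e z hz η hη => ?_)
      _ hv) (h2 p rfl z hz _ hv)
    · exact h1 (vecCons d η) (Fin.cases hd hη)
    · subst e
      have hη' : ∀ i, (vecCons d η) i ∈ U := Fin.cases (hDU d hd) hη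
      -- Since `h2` only concerns the first slot, z is moved in front of d at the cost of a sign.
      have := P.neg_mem (h2 (q + 1) rfl z hz (vecCons d η) hη')
      refine cast (congrArg (· ∈ P) ?_) this
      ext x
      exact (map_vecCons_swap _ _ _ _).symm

/-- An alternating form vanishes on `D + ℝ Y` if it vanishes on `D` and its contraction with `Y`
does. -/
theorem form_eq_zero_of_add {D : Submodule ℝ E} {Y : E} {U : Set E}
    (hU : ∀ ξ ∈ U, ∃ d ∈ D, ∃ c : ℝ, ξ = d + c • Y) {p : ℕ} (f : Alt p E)
    (h1 : ∀ ξ : Fin p → E, (∀ i, ξ i ∈ D) → f ξ = 0)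
    (h2 : ∀ q, ∀ e : q + 1 = p, ∀ η : Fin q → E, (∀ i, η i ∈ D) →
      f (vecCons Y η ∘ Fin.cast e.symm) = 0)
    (ξ : Fin p → E) (hξ : ∀ i, ξ i ∈ U) : f ξ = 0 := by
  have key : ∀ {p : ℕ} (f : Alt p E), (∀ ξ : Fin p → E, (∀ i, ξ i ∈ D) → f ξ = 0) →
      (∀ q, ∀ e : q + 1 = p, ∀ η : Fin q → E, (∀ i, η i ∈ (D ⊔ Submodule.span ℝ {Y} : Submodule ℝ E)) →
        f (vecCons Y η ∘ Fin.cast e.symm) = 0) →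
      ∀ ξ : Fin p → E, (∀ i, ξ i ∈ (D ⊔ Submodule.span ℝ {Y} : Submodule ℝ E)) → f ξ = 0 := by
    intro p f h1 h2 ξ hξ
    have h4 : ∀ q, ∀ e : q + 1 = p, ∀ z ∈ (Submodule.span ℝ {Y} : Set E), ∀ η : Fin q → E,
        (∀ i, η i ∈ ((D ⊔ Submodule.span ℝ {Y} : Submodule ℝ E) : Set E)) →
        (fun _ : Unit => f (vecCons z η ∘ Fin.cast e.symm)) ∈ (⊥ : Submodule ℝ (Unit → ℝ)) := by
      intro q e z hz η hη
      subst e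
      obtain ⟨c, rfl⟩ := Submodule.mem_span_singleton.1 hz
      rw [Submodule.mem_bot]; ext
      have := h2 q rfl η hη
      exact (map_vecCons_smul f c Y η).trans (by rw [show f (vecCons Y η) = 0 from this, mul_zero]; rfl)
    have := forms_mem_of_add (X := Unit) ⊥ D (Submodule.span ℝ {Y} : Set E)
      ((D ⊔ Submodule.span ℝ {Y} : Submodule ℝ E) : Set E) ?_ ?_ (fun _ => f) ?_ ?_ ξ hξ
    · exact congrFun ((Submodule.mem_bot ℝ).1 this) ()
    · intro ξ hξ
      obtain ⟨d, hd, z, hz, rfl⟩ := Submodule.mem_sup.1 hξ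
      exact ⟨d, hd, z, hz, rfl⟩
    · exact fun d hd => Submodule.mem_sup_left hd
    · intro ξ hξ
      rw [Submodule.mem_bot]; ext; exact h1 ξ hξ
    · exact h4
  -- `key` asks that the contraction by Y vanish on all of D + ℝY. This is `key` again, applied to
  -- that contraction, whose own contraction by Y is zero by alternation.
  refine key f h1 ?_ ξ fun i => ?_
  · intro q e η hη
    subst e
    refine key (contract Y f) (fun η hη => h2 q rfl η hη) ?_ η hη
    intro r e ζ _
    subst e
    exact map_vecCons_same f Y ζ
  · obtain ⟨d, hd, c, h⟩ := hU _ (hξ i)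
    rw [h]
    exact Submodule.add_mem_sup hd (Submodule.smul_mem _ _ (Submodule.mem_span_singleton_self Y))

end Alternating

/-! ### Alternating forms on the tangent spaces of faces -/

namespace SplitSimplex

variable {n : ℕ} (S : SplitSimplex n)

theorem exists_dir_erase_add {T : Face n} {i : Fin (n + 1)} (hi : i ∈ T.1) (h : 1 < T.1.card) :
    ∀ ξ ∈ (S.dir T : Set (Vec n)), ∃ d ∈ S.dir (T.erase i h), ∃ c : ℝ,
      ξ = d + c • (S.inpoint T - S.inpoint (T.erase i h)) := fun _ hξ =>
  ⟨_, S.sub_smul_mem_dir_erase hi h hξ, _, (sub_add_cancel _ _).symm⟩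

theorem form_eq_zero_of_erase {T : Face n} {i : Fin (n + 1)} (hi : i ∈ T.1) (h : 1 < T.1.card)
    {p : ℕ} (f : Alt p (Vec n))
    (h1 : ∀ ξ : Fin p → Vec n, (∀ j, ξ j ∈ S.dir (T.erase i h)) → f ξ = 0)
    (h2 : ∀ q, ∀ e : q + 1 = p, ∀ η : Fin q → Vec n, (∀ j, η j ∈ S.dir (T.erase i h)) →
      f (vecCons (S.inpoint T - S.inpoint (T.erase i h)) η ∘ Fin.cast e.symm) = 0)
    {ξ : Fin p → Vec n} (hξ : ∀ j, ξ j ∈ S.dir T) : f ξ = 0 :=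
  form_eq_zero_of_add (S.exists_dir_erase_add hi h) f h1 h2 ξ hξ

/-- As the dλ_i sum to zero, any vertex o may serve as origin: ξ is the sum of the dλ_i(ξ) (V_i -
V_o), and the form is expanded by multilinearity. -/
theorem map_eq_sum_vertex {p : ℕ} (f : Alt p (Vec n)) (o : Fin (n + 1)) (ξ : Fin p → Vec n) :
    f ξ = ∑ r : Fin p → Fin (n + 1), (∏ l, S.dbary (r l) (ξ l)) *
      f fun l => S.vertex (r l) - S.vertex o := by
  have h : ξ = fun l => ∑ i, S.dbary i (ξ l) • (S.vertex i - S.vertex o) := by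
    ext l : 1
    simp only [smul_sub, Finset.sum_sub_distrib, ← Finset.sum_smul, sum_dbary, zero_smul, sub_zero,
      sum_dbary_smul]
  conv_lhs => rw [h]
  have := f.toMultilinearMap.map_sum fun l i => S.dbary i (ξ l) • (S.vertex i - S.vertex o)
  refine this.trans (Finset.sum_congr rfl fun r _ => ?_)
  exact (f.toMultilinearMap.map_smul_univ _ _).trans (smul_eq_mul _ _)

/-- A form of degree less than the dimension is determined on `T` by its pullbacks to facets. -/
theorem form_eq_zero_of_facets {T : Face n} {p : ℕ} (hp : p < T.dim) (f : Alt p (Vec n))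
    (h : ∀ i ∈ T.1, ∀ hT : 1 < T.1.card, ∀ ξ : Fin p → Vec n,
      (∀ j, ξ j ∈ S.dir (T.erase i hT)) → f ξ = 0)
    {ξ : Fin p → Vec n} (hξ : ∀ j, ξ j ∈ S.dir T) : f ξ = 0 := by
  classical
  obtain ⟨o, ho⟩ := T.2
  rw [S.map_eq_sum_vertex f o ξ]
  refine Finset.sum_eq_zero fun r _ => ?_
  by_cases hr : ∀ l, r l ∈ T.1
  -- A term involves at most p + 1 vertices of T, which has more than that. Some vertex i is
  -- missing, and all vectors of the term are tangent to the facet opposite i.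
  · have hcard : (Finset.univ.image r ∪ {o}).card < T.1.card := by
      refine (Finset.card_union_le _ _).trans_lt ?_
      have h1 : (Finset.univ.image r).card ≤ p := Finset.card_image_le.trans (by simp)
      rw [Finset.card_singleton]
      unfold Face.dim at hp; omega
    obtain ⟨i, hi, hir⟩ := Finset.exists_mem_notMem_of_card_lt_card hcard
    simp only [Finset.mem_union, Finset.mem_image, Finset.mem_univ, true_and,
      Finset.mem_singleton, not_or, not_exists] at hir
    have hT : 1 < T.1.card := Face.one_lt_card (by omega)
    rw [h i hi hT _ fun l => ?_, mul_zero]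
    exact S.sub_mem_dir
      (S.vertex_mem_real (Finset.mem_erase.2 ⟨hir.1 l, hr l⟩))
      (S.vertex_mem_real (Finset.mem_erase.2 ⟨fun e => hir.2 e.symm, ho⟩))
  · push Not at hr
    obtain ⟨l, hl⟩ := hr
    rw [Finset.prod_eq_zero (Finset.mem_univ l) (S.mem_dir.1 (hξ l) _ hl), zero_mul]

/-- Forms of degree larger than the dimension of `T` vanish on `T`. -/
theorem form_eq_zero_of_dim_lt {T : Face n} {p : ℕ} (hp : T.dim < p) (f : Alt p (Vec n))
    {ξ : Fin p → Vec n} (hξ : ∀ j, ξ j ∈ S.dir T) : f ξ = 0 := by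
  classical
  obtain ⟨o, ho⟩ := T.2
  rw [S.map_eq_sum_vertex f o ξ]
  refine Finset.sum_eq_zero fun r _ => ?_
  by_cases hr : ∀ l, r l ∈ T.1
  · by_cases hro : ∃ l, r l = o
    · obtain ⟨l, hl⟩ := hro
      rw [f.map_coord_zero l (by simp [hl]), mul_zero]
    · obtain ⟨i, -, j, -, hij, he⟩ := Finset.exists_ne_map_eq_of_card_lt_of_maps_to
        (s := Finset.univ) (t := T.1.erase o) (f := r) (by
          rw [Finset.card_erase_of_mem ho]; simpa [Face.dim] using hp)
        fun l _ => Finset.mem_coe.2 (Finset.mem_erase.2 ⟨fun e => hro ⟨l, e⟩, hr l⟩)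
      rw [f.map_eq_zero_of_eq _ (by simp [he]) hij, mul_zero]
  · push Not at hr
    obtain ⟨l, hl⟩ := hr
    rw [Finset.prod_eq_zero (Finset.mem_univ l) (S.mem_dir.1 (hξ l) _ hl), zero_mul]

end SplitSimplex

end FES

namespace FES

open ContinuousAlternatingMap Matrix

namespace SplitSimplex

variable {n : ℕ} (S : SplitSimplex n)

/-! ### Piecewise affine forms -/

section Interp

variable {E : Type} [NormedAddCommGroup E] [NormedSpace ℝ E]

/-- The linear part of the affine interpolation of values at the vertices. -/
def interpLinear (α : Fin (n + 1) → E) : Vec n →L[ℝ] E := ∑ i, (S.dbary i).smulRight (α i)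

/-- The affine interpolation of values at the vertices. -/
def interp (α : Fin (n + 1) → E) (x : Vec n) : E := ∑ i, S.bary i x • α i

theorem interpLinear_apply (α : Fin (n + 1) → E) (x : Vec n) :
    S.interpLinear α x = ∑ i, S.dbary i x • α i := by
  simp [interpLinear]

theorem interp_eq (α : Fin (n + 1) → E) (x : Vec n) :
    S.interp α x = S.interp α 0 + S.interpLinear α x := by
  rw [interp, interp, interpLinear_apply, ← Finset.sum_add_distrib]
  exact Finset.sum_congr rfl fun i _ => by rw [S.bary_eq i x, add_smul]

theorem interp_vertex (α : Fin (n + 1) → E) (i : Fin (n + 1)) :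
    S.interp α (S.vertex i) = α i := by
  simp [interp, bary_vertex]

theorem affine_eq_interp (c : E) (L : Vec n →L[ℝ] E) (x : Vec n) :
    c + L x = S.interp (fun i => c + L (S.vertex i)) x := by
  simp only [interp, smul_add, Finset.sum_add_distrib, ← Finset.sum_smul, sum_bary, one_smul]
  congr 1
  conv_lhs => rw [← S.sum_bary_smul x, _root_.map_sum]
  simp only [map_smul]

theorem interp_congr {T : Face n} {α α' : Fin (n + 1) → E} (h : ∀ i ∈ T.1, α i = α' i) {x : Vec n}
    (hx : x ∈ S.real T) : S.interp α x = S.interp α' x := by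
  refine Finset.sum_congr rfl fun i _ => ?_
  by_cases hi : i ∈ T.1
  · rw [h i hi]
  · rw [(S.mem_real.1 hx).2 i hi, zero_smul, zero_smul]

end Interp

/-- The functions that are affine on `T`. -/
def affineFns (T : Face n) : Submodule ℝ (Vec n → ℝ) where
  carrier := {f | ∃ (c : ℝ) (L : Vec n →L[ℝ] ℝ), ∀ x ∈ S.real T, f x = c + L x}
  add_mem' := by
    rintro f g ⟨c, L, h⟩ ⟨c', L', h'⟩
    exact ⟨c + c', L + L', fun x hx => by
      rw [Pi.add_apply, h x hx, h' x hx, _root_.add_apply]; ring⟩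
  zero_mem' := ⟨0, 0, fun x _ => by simp⟩
  smul_mem' := by
    rintro a f ⟨c, L, h⟩
    exact ⟨a * c, a • L, fun x hx => by
      rw [Pi.smul_apply, h x hx, _root_.smul_apply, smul_eq_mul, smul_eq_mul]; ring⟩

theorem affineFns_eq_interp {T : Face n} {f : Vec n → ℝ} (h : f ∈ S.affineFns T) {x : Vec n}
    (hx : x ∈ S.real T) : f x = S.interp (fun i => f (S.vertex i)) x := by
  obtain ⟨c, L, h⟩ := h
  rw [h x hx, S.affine_eq_interp]
  exact S.interp_congr (fun i hi => (h _ (S.vertex_mem_real hi)).symm) hx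

theorem affineFns_mono {T' T : Face n} (hT : T' ≤ T) {f : Vec n → ℝ} (h : f ∈ S.affineFns T) :
    f ∈ S.affineFns T' := by
  obtain ⟨c, L, h⟩ := h
  exact ⟨c, L, fun x hx => h x (S.real_mono hT hx)⟩

theorem affineFns_congr {T : Face n} {f g : Vec n → ℝ} (h : ∀ x ∈ S.real T, f x = g x)
    (hg : g ∈ S.affineFns T) : f ∈ S.affineFns T := by
  obtain ⟨c, L, hg⟩ := hg
  exact ⟨c, L, fun x hx => (h x hx).trans (hg x hx)⟩

theorem form_mem_affineFns (T : Face n) {k : ℕ} (c : Alt k (Vec n)) (L : Vec n →L[ℝ] Alt k (Vec n))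
    (ξ : Fin k → Vec n) : (fun x => (c + L x) ξ) ∈ S.affineFns T :=
  ⟨c ξ, (ContinuousAlternatingMap.apply ℝ (Vec n) ℝ ξ).comp L, fun _ _ => rfl⟩

/-- `w` is affine on each cell, and there the exterior derivative of its pullback to `T` is the
pullback of the constant form `θ`. -/
def DConst (m : ℕ) (T : Face n) {k : ℕ} (w : Vec n → Alt k (Vec n)) (θ : Alt (k + 1) (Vec n)) :
    Prop :=
  ∀ σ ∈ S.refinement m T, ∃ (c : Alt k (Vec n)) (L : Vec n →L[ℝ] Alt k (Vec n)),
    (∀ x ∈ σ, w x = c + L x) ∧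
    ∀ ξ : Fin (k + 1) → Vec n, (∀ j, ξ j ∈ S.dir T) → alternatizeUncurryFin L ξ = θ ξ

/-- The components of `w` involving a direction in `𝕎_T` are affine on `T`. -/
def TransAffine (T : Face n) {k : ℕ} (w : Vec n → Alt k (Vec n)) : Prop :=
  ∀ ξ : Fin k → Vec n, (∃ i, ξ i ∈ S.transverse T) → (fun x => w x ξ) ∈ S.affineFns T

/-- The space of closed piecewise affine forms in terms of which `A^k(T)` is described. -/
structure Z (k : ℕ) (T : Face n) (w : Vec n → Alt k (Vec n)) : Prop where
  cont : ContinuousOn w (S.real T)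
  dconst : S.DConst (k - 1) T w 0
  trans : S.TransAffine T w

/-- The inpoints are in general position: `V` is the direct sum of the directions of `T` and of
`𝕎_T`. -/
def IsTransversal : Prop := ∀ T : Face n, IsCompl (S.dir T) (S.transverse T)

variable {S}

theorem DConst.mono {m : ℕ} {T' T : Face n} (h : T' ≤ T) {k : ℕ} {w : Vec n → Alt k (Vec n)}
    {θ : Alt (k + 1) (Vec n)} (hw : S.DConst m T w θ) : S.DConst m T' w θ := by
  intro σ hσ
  obtain ⟨c, L, h1, h2⟩ := hw σ (S.refinement_mono h hσ)
  exact ⟨c, L, h1, fun ξ hξ => h2 ξ fun j => S.dir_mono h (hξ j)⟩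

theorem DConst.refine {m m' : ℕ} {T : Face n}
    (h : ∀ σ ∈ S.refinement m T, ∃ τ ∈ S.refinement m' T, σ ⊆ τ) {k : ℕ}
    {w : Vec n → Alt k (Vec n)} {θ : Alt (k + 1) (Vec n)} (hw : S.DConst m' T w θ) :
    S.DConst m T w θ := by
  intro σ hσ
  obtain ⟨τ, hτ, hστ⟩ := h σ hσ
  obtain ⟨c, L, h1, h2⟩ := hw τ hτ
  exact ⟨c, L, fun x hx => h1 x (hστ hx), h2⟩

theorem DConst.congr {m : ℕ} {T : Face n} {k : ℕ} {w w' : Vec n → Alt k (Vec n)}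
    {θ : Alt (k + 1) (Vec n)} (hw : S.DConst m T w θ) (h : ∀ x ∈ S.real T, w' x = w x) :
    S.DConst m T w' θ := by
  intro σ hσ
  obtain ⟨c, L, h1, h2⟩ := hw σ hσ
  exact ⟨c, L, fun x hx => (h x (S.cell_subset hσ hx)).trans (h1 x hx), h2⟩

theorem DConst.add {m : ℕ} {T : Face n} {k : ℕ} {w w' : Vec n → Alt k (Vec n)}
    {θ θ' : Alt (k + 1) (Vec n)} (hw : S.DConst m T w θ) (hw' : S.DConst m T w' θ') :
    S.DConst m T (w + w') (θ + θ') := by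
  intro σ hσ
  obtain ⟨c, L, h1, h2⟩ := hw σ hσ
  obtain ⟨c', L', h1', h2'⟩ := hw' σ hσ
  refine ⟨c + c', L + L', fun x hx => ?_, fun ξ hξ => ?_⟩
  · rw [Pi.add_apply, h1 x hx, h1' x hx, _root_.add_apply]; abel
  · rw [alternatizeUncurryFin_add, ContinuousAlternatingMap.add_apply, h2 ξ hξ, h2' ξ hξ]; rfl

theorem DConst.smul {m : ℕ} {T : Face n} {k : ℕ} {w : Vec n → Alt k (Vec n)}
    {θ : Alt (k + 1) (Vec n)} (a : ℝ) (hw : S.DConst m T w θ) :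
    S.DConst m T (a • w) (a • θ) := by
  intro σ hσ
  obtain ⟨c, L, h1, h2⟩ := hw σ hσ
  refine ⟨a • c, a • L, fun x hx => ?_, fun ξ hξ => ?_⟩
  · rw [Pi.smul_apply, h1 x hx, _root_.smul_apply, smul_add]
  · rw [alternatizeUncurryFin_smul, ContinuousAlternatingMap.smul_apply, h2 ξ hξ]; rfl

theorem dconst_affine (m : ℕ) (T : Face n) {k : ℕ} (c : Alt k (Vec n))
    (L : Vec n →L[ℝ] Alt k (Vec n)) :
    S.DConst m T (fun x => c + L x) (alternatizeUncurryFin L) :=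
  fun _ _ => ⟨c, L, fun _ _ => rfl, fun _ _ => rfl⟩

/-- Piecewise affine forms are affine on the segments issued from the inpoint. -/
theorem DConst.segment {m : ℕ} {T' T : Face n} (h : T' ≤ T) {k : ℕ} {w : Vec n → Alt k (Vec n)}
    {θ : Alt (k + 1) (Vec n)} (hw : S.DConst m T w θ) {y : Vec n} (hy : y ∈ S.real T') (s : ℝ)
    (hs : s ∈ Set.Icc (0 : ℝ) 1) :
    w (s • S.inpoint T + (1 - s) • y) = s • w (S.inpoint T) + (1 - s) • w y := by
  obtain ⟨σ, hσ, hyσ⟩ := S.exists_mem_cell m hy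
  obtain ⟨τ, hτ, h1, h2⟩ := S.exists_cell_insert h hσ
  obtain ⟨c, L, h3, -⟩ := hw τ hτ
  have hx : s • S.inpoint T + (1 - s) • y ∈ τ :=
    S.convex_cell hτ h2 (h1 hyσ) hs.1 (by linarith [hs.2]) (by ring)
  rw [h3 _ hx, h3 _ h2, h3 _ (h1 hyσ), map_add, map_smul, map_smul]
  module

/-- The contraction by the difference of two inpoints preserves constancy of the exterior
derivative. -/
theorem DConst.contract {m : ℕ} {U T : Face n} (h : U ≤ T) {p : ℕ}
    {w : Vec n → Alt (p + 1) (Vec n)} {θ : Alt (p + 2) (Vec n)} (hw : S.DConst m T w θ) :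
    S.DConst m U (fun x => contract (S.inpoint T - S.inpoint U) (w x))
      (w (S.inpoint T) - w (S.inpoint U) - FES.contract (S.inpoint T - S.inpoint U) θ) := by
  intro σ hσ
  obtain ⟨σ', hσ', hsub, hU, -⟩ := S.exists_full_cell hσ
  obtain ⟨τ, hτ, hτ1, hT⟩ := S.exists_cell_insert h hσ'
  obtain ⟨c, L, h1, h2⟩ := hw τ hτ
  refine ⟨FES.contract (S.inpoint T - S.inpoint U) c,
    (FES.contract (S.inpoint T - S.inpoint U)).comp L, fun x hx => ?_, fun ξ hξ => ?_⟩
  · change FES.contract _ (w x) = _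
    rw [h1 x (hτ1 (hsub hx)), map_add]; rfl
  -- In Cartan's identity the derivative of w along W_T - W_U is w(W_T) - w(W_U), because the cell τ
  -- contains both inpoints. This form does not depend on the cell.
  · have h3 := alternatizeUncurryFin_vecCons L (S.inpoint T - S.inpoint U) ξ
    rw [h2 _ (Fin.cases (S.inpoint_sub_mem_dir h) fun j => S.dir_mono h (hξ j))] at h3
    simp only [ContinuousAlternatingMap.sub_apply, contract_apply]
    rw [h3, h1 _ hT, h1 _ (hτ1 hU)]
    simp only [ContinuousAlternatingMap.add_apply, map_sub, ContinuousAlternatingMap.sub_apply]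
    ring

theorem linear_eq_of_mem_vectorSpan {F : Type} [NormedAddCommGroup F] [NormedSpace ℝ F]
    {σ : Set (Vec n)} {L L' : Vec n →L[ℝ] F} (h : ∀ a ∈ σ, ∀ b ∈ σ, L (a - b) = L' (a - b))
    {η : Vec n} (hη : η ∈ vectorSpan ℝ σ) : L η = L' η := by
  have : vectorSpan ℝ σ ≤ LinearMap.eqLocus (L : Vec n →ₗ[ℝ] F) (L' : Vec n →ₗ[ℝ] F) := by
    rw [vectorSpan_def, Submodule.span_le]
    rintro _ ⟨a, ha, b, hb, rfl⟩
    exact h a ha b hb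
  exact this hη

theorem alternatizeUncurryFin_smulRight_vecCons {p : ℕ} (l : Vec n →L[ℝ] ℝ) (f : Alt p (Vec n))
    (Y : Vec n) (η : Fin p → Vec n) (h : ∀ j, l (η j) = 0) :
    alternatizeUncurryFin (l.smulRight f) (vecCons Y η) = l Y * f η := by
  rw [alternatizeUncurryFin_apply, Fin.sum_univ_succ, Finset.sum_eq_zero fun i _ => ?_]
  · simp
  · simp [h i]

/-- If `g` vanishes on the boundary of `T`, its exterior derivative is determined by its value at the
inpoint. -/
theorem DConst.mul_eq {m : ℕ} {T : Face n} (hm : m + 1 ≤ T.dim) {p : ℕ} {g : Vec n → Alt p (Vec n)}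
    {θ : Alt (p + 1) (Vec n)} (hg : S.DConst m T g θ) {i : Fin (n + 1)} (hi : i ∈ T.1)
    (hT : 1 < T.1.card)
    (h0 : ∀ y ∈ S.real (T.erase i hT), ∀ ξ : Fin p → Vec n, (∀ j, ξ j ∈ S.dir T) → g y ξ = 0)
    {ξ : Fin (p + 1) → Vec n} (hξ : ∀ j, ξ j ∈ S.dir T) :
    S.bary i (S.inpoint T) * θ ξ =
      alternatizeUncurryFin ((S.dbary i).smulRight (g (S.inpoint T))) ξ := by
  obtain ⟨σ₀, hσ₀, -⟩ := S.exists_mem_cell m (S.inpoint_mem_real (T.erase i hT))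
  obtain ⟨σ, hσ, -, hG, hfull⟩ := S.exists_full_cell hσ₀
  have hτ := S.cone_mem_refinement (Face.erase_lt hT hi) hm hσ
  obtain ⟨c, L, h1, h2⟩ := hg _ hτ
  have hsub : σ ⊆ convexHull ℝ (insert (S.inpoint T) σ) :=
    (Set.subset_insert _ _).trans (subset_convexHull ℝ _)
  have hW : S.inpoint T ∈ convexHull ℝ (insert (S.inpoint T) σ) :=
    subset_convexHull ℝ _ (Set.mem_insert _ _)
  have hw := S.bary_inpoint_pos hi
  -- On the cone over the facet, g is affine and vanishes on the base, so tangentially it is λ_i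
  -- g(W_T) / λ_i(W_T). This determines its linear part on the directions of T.
  have key : ∀ ζ : Fin p → Vec n, (∀ j, ζ j ∈ S.dir T) → ∀ η ∈ S.dir T,
      S.bary i (S.inpoint T) * L η ζ = S.dbary i η * g (S.inpoint T) ζ := by
    intro ζ hζ η hη
    have h3 : ∀ d ∈ S.dir (T.erase i hT), L d ζ = 0 := fun d hd =>
      linear_eq_of_mem_vectorSpan (σ := σ) (L := (ContinuousAlternatingMap.apply ℝ _ ℝ ζ).comp L)
        (L' := 0) (fun a ha b hb => by
          have e1 := h0 a (S.cell_subset hσ ha) ζ hζ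
          have e2 := h0 b (S.cell_subset hσ hb) ζ hζ
          rw [h1 a (hsub ha)] at e1
          rw [h1 b (hsub hb)] at e2
          simp only [ContinuousAlternatingMap.add_apply] at e1 e2
          simp only [ContinuousLinearMap.comp_apply, map_sub, ContinuousAlternatingMap.apply_apply,
            _root_.zero_apply]
          linarith) (hfull hd)
    have h4 : L (S.inpoint T - S.inpoint (T.erase i hT)) ζ = g (S.inpoint T) ζ := by
      have e1 := h0 _ (S.inpoint_mem_real (T.erase i hT)) ζ hζ
      rw [h1 _ (hsub hG)] at e1
      rw [h1 _ hW]
      simp only [ContinuousAlternatingMap.add_apply, map_sub,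
        ContinuousAlternatingMap.sub_apply] at e1 ⊢
      linarith
    have h5 := h3 _ (S.sub_smul_mem_dir_erase hi hT hη)
    rw [map_sub, map_smul, ContinuousAlternatingMap.sub_apply, ContinuousAlternatingMap.smul_apply,
      h4, smul_eq_mul, sub_eq_zero] at h5
    rw [h5]; field_simp
  rw [← h2 ξ hξ, alternatizeUncurryFin_apply, alternatizeUncurryFin_apply, Finset.mul_sum]
  refine Finset.sum_congr rfl fun j _ => ?_
  have := key (j.removeNth ξ) (fun l => hξ _) (ξ j) (hξ j)
  simp only [ContinuousLinearMap.smulRight_apply, ContinuousAlternatingMap.smul_apply, smul_eq_mul,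
    ← this]
  rw [mul_smul_comm]

/-- By `DConst.mul_eq`, λ_i(W_T) θ = dλ_i ∧ g(W_T) on T for every i. The λ_i sum to 1 and the dλ_i
to 0, so θ = 0. Then dλ_i ∧ g(W_T) = 0 says that g(W_T) pulls back to zero on the facet opposite i,
and a form of degree less than dim T is determined by these pullbacks. -/
theorem DConst.inpoint_eq_zero {m : ℕ} {T : Face n} (hm : m + 1 ≤ T.dim) {p : ℕ} (hp : p < T.dim)
    {g : Vec n → Alt p (Vec n)} {θ : Alt (p + 1) (Vec n)} (hg : S.DConst m T g θ)
    (h0 : ∀ i ∈ T.1, ∀ hT : 1 < T.1.card, ∀ y ∈ S.real (T.erase i hT),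
      ∀ ξ : Fin p → Vec n, (∀ j, ξ j ∈ S.dir T) → g y ξ = 0)
    {ξ : Fin p → Vec n} (hξ : ∀ j, ξ j ∈ S.dir T) : g (S.inpoint T) ξ = 0 := by
  have hT : 1 < T.1.card := Face.one_lt_card (by omega)
  have hθ : ∀ ξ : Fin (p + 1) → Vec n, (∀ j, ξ j ∈ S.dir T) → θ ξ = 0 := by
    intro ξ hξ
    have h1 : ∀ i, S.bary i (S.inpoint T) * θ ξ =
        alternatizeUncurryFin ((S.dbary i).smulRight (g (S.inpoint T))) ξ := by
      intro i
      by_cases hi : i ∈ T.1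
      · exact hg.mul_eq hm hi hT (h0 i hi hT) hξ
      · rw [S.bary_inpoint_eq_zero hi, zero_mul, alternatizeUncurryFin_apply,
          Finset.sum_eq_zero fun j _ => ?_]
        simp [S.mem_dir.1 (hξ j) i hi]
    have h2 : ∑ i, S.bary i (S.inpoint T) * θ ξ = θ ξ := by
      rw [← Finset.sum_mul, S.sum_bary, one_mul]
    rw [← h2, Finset.sum_congr rfl fun i _ => h1 i]
    have h3 : ∑ i, (S.dbary i).smulRight (g (S.inpoint T)) = 0 := by
      ext x : 1
      simp [← Finset.sum_smul, sum_dbary]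
    rw [← ContinuousAlternatingMap.sum_apply, ← alternatizeUncurryFin_sum, h3]
    simp [alternatizeUncurryFin_apply]
  refine S.form_eq_zero_of_facets hp _ (fun i hi hT η hη => ?_) hξ
  have h1 := hg.mul_eq hm hi hT (h0 i hi hT)
    (ξ := vecCons (S.inpoint T - S.inpoint (T.erase i hT)) η)
    (Fin.cases (S.inpoint_sub_mem_dir (T.erase_le i hT)) fun j => S.dir_mono (T.erase_le i hT) (hη j))
  rw [hθ _ (Fin.cases (S.inpoint_sub_mem_dir (T.erase_le i hT))
    fun j => S.dir_mono (T.erase_le i hT) (hη j)), mul_zero,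
    alternatizeUncurryFin_smulRight_vecCons _ _ _ _ fun j => (S.mem_dir_erase.1 (hη j)).2,
    dbary_inpoint_sub_erase] at h1
  exact (mul_eq_zero.1 h1.symm).resolve_left (S.bary_inpoint_pos hi).ne'

/-- A piecewise affine `p`-form on the `p`-th refinement, with constant exterior derivative and
vanishing at vertices, vanishes. -/
theorem DConst.eq_zero {T : Face n} {p : ℕ} {g : Vec n → Alt p (Vec n)}
    {θ : Alt (p + 1) (Vec n)} (hg : S.DConst p T g θ)
    (h0 : ∀ i ∈ T.1, ∀ ξ : Fin p → Vec n, (∀ j, ξ j ∈ S.dir T) → g (S.vertex i) ξ = 0)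
    {x : Vec n} (hx : x ∈ S.real T) {ξ : Fin p → Vec n} (hξ : ∀ j, ξ j ∈ S.dir T) : g x ξ = 0 := by
  induction T using Face.facet_induction generalizing p x with
  | _ T ih =>
    rcases Nat.lt_or_ge p T.dim with hp | hp
    · have hT : 1 < T.1.card := Face.one_lt_card (by omega)
      -- On a facet G, the pullback of g vanishes by induction. So does the contraction by W_T -
      -- W_G, which is a form of one degree less with constant exterior derivative; it is affine on
      -- the cells of R_p(G), hence on those of the finer R_{p-1}(G).
      have hG : ∀ i ∈ T.1, ∀ hT : 1 < T.1.card, ∀ y ∈ S.real (T.erase i hT),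
          ∀ ξ : Fin p → Vec n, (∀ j, ξ j ∈ S.dir T) → g y ξ = 0 := by
        intro i hi hT y hy ξ hξ
        have hle := T.erase_le i hT
        have h2 : ∀ q, ∀ e : q + 1 = p, ∀ η : Fin q → Vec n,
            (∀ j, η j ∈ S.dir (T.erase i hT)) → g y (vecCons (S.inpoint T -
              S.inpoint (T.erase i hT)) η ∘ Fin.cast e.symm) = 0 := by
          intro q e η hη
          subst e
          refine ih i hi hT ((hg.contract hle).refine fun σ => S.exists_coarser_cell)
            (fun j hj ζ hζ => ?_) hy hη
          exact h0 j (hle hj) _ (Fin.cases (S.inpoint_sub_mem_dir hle) fun l =>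
            S.dir_mono hle (hζ l))
        exact S.form_eq_zero_of_erase hi hT _ (fun ξ hξ => ih i hi hT (hg.mono hle)
          (fun j hj ζ hζ => h0 j (hle hj) ζ fun l => S.dir_mono hle (hζ l)) hy hξ) h2 hξ
      obtain ⟨i, hi, y, hy, s, hs, rfl⟩ := S.exists_mem_cone hT hx
      rw [hg.segment (T.erase_le i hT) hy s hs, ContinuousAlternatingMap.add_apply,
        ContinuousAlternatingMap.smul_apply, ContinuousAlternatingMap.smul_apply,
        hg.inpoint_eq_zero hp hp hG hξ, hG i hi hT y hy ξ hξ]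
      simp
    -- A face of dimension at most p is not split, so g is affine there and determined by its vertex
    -- values.
    · obtain ⟨c, L, h1, -⟩ := hg _ (S.real_mem_refinement hp)
      have h2 := S.affineFns_eq_interp (S.affineFns_congr (f := fun x => g x ξ)
        (fun x hx => by rw [h1 x hx]) (S.form_mem_affineFns T c L ξ)) hx
      refine h2.trans (Finset.sum_eq_zero fun i _ => ?_)
      by_cases hi : i ∈ T.1
      · exact (congrArg _ (h0 i hi ξ hξ)).trans (smul_zero _)
      · rw [(S.mem_real.1 hx).2 i hi, zero_smul]

/-! ### The transverse directions -/

variable (S)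

theorem transverse_anti {T' T : Face n} (h : T' ≤ T) : S.transverse T ≤ S.transverse T' := by
  refine Submodule.span_mono ?_
  rintro y ⟨U, hU, rfl⟩
  exact ⟨U, h.trans hU, rfl⟩

theorem inpoint_sub_mem_transverse {R T U : Face n} (hU : R ≤ U) (hT : R ≤ T) :
    S.inpoint T - S.inpoint U ∈ S.transverse R := by
  have h1 : S.inpoint (Face.top n) - S.inpoint U ∈ S.transverse R :=
    Submodule.subset_span ⟨U, hU, rfl⟩
  have h2 : S.inpoint (Face.top n) - S.inpoint T ∈ S.transverse R :=
    Submodule.subset_span ⟨T, hT, rfl⟩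
  have := sub_mem h1 h2
  rwa [sub_sub_sub_cancel_left] at this

/-- This half of general position holds for any inpoints. Induction on the codimension: passing from
T' to its facet T, the lost tangent direction is recovered from W_{T'} - W_T, which belongs to 𝕎_T.
-/
theorem codisjoint_dir_transverse (T : Face n) : Codisjoint (S.dir T) (S.transverse T) := by
  rw [codisjoint_iff]
  induction hN : (n + 1 - T.1.card) generalizing T with
  | zero =>
    have hT : T.1 = Finset.univ := by
      refine Finset.eq_univ_of_card _ (le_antisymm (Finset.card_le_univ _) ?_)
      rw [Fintype.card_fin]; omega
    rw [eq_top_iff]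
    exact fun ξ _ => Submodule.mem_sup_left (S.mem_dir.2 fun i hi => absurd (hT ▸ Finset.mem_univ i) hi)
  | succ N ih =>
    obtain ⟨j, hj⟩ : ∃ j, j ∉ T.1 := by
      by_contra! h
      have : T.1 = Finset.univ := Finset.eq_univ_of_forall h
      rw [this, Finset.card_univ, Fintype.card_fin] at hN; omega
    let T' : Face n := ⟨insert j T.1, Finset.insert_nonempty _ _⟩
    have hc : T'.1.card = T.1.card + 1 := Finset.card_insert_of_notMem hj
    have hT' : 1 < T'.1.card := by have := T.card_pos; omega
    have he : T'.erase j hT' = T := Subtype.ext (Finset.erase_insert hj)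
    have hle : T ≤ T' := Finset.subset_insert _ _
    rw [← top_le_iff, ← ih T' (by omega)]
    refine sup_le (fun ξ hξ => ?_) ((S.transverse_anti hle).trans le_sup_right)
    have h1 := S.sub_smul_mem_dir_erase (Finset.mem_insert_self j T.1) hT' hξ
    rw [he] at h1
    rw [← sub_add_cancel ξ ((S.dbary j ξ / S.bary j (S.inpoint T')) •
      (S.inpoint T' - S.inpoint T))]
    exact Submodule.add_mem_sup h1 (Submodule.smul_mem _ _ (S.inpoint_sub_mem_transverse le_rfl hle))

variable {S}

theorem IsTransversal.exists_add (H : S.IsTransversal) (T : Face n) (ξ : Vec n) :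
    ∃ d ∈ S.dir T, ∃ z ∈ S.transverse T, ξ = d + z := by
  have : ξ ∈ S.dir T ⊔ S.transverse T := by rw [(H T).sup_eq_top]; trivial
  obtain ⟨d, hd, z, hz, h⟩ := Submodule.mem_sup.1 this
  exact ⟨d, hd, z, hz, h.symm⟩

/-- For the facet G this gives that 𝕎_G is spanned by 𝕎_T and W_T - W_G. If d is the part of Y
tangent to T, then d minus a suitable multiple of W_T - W_G is both tangent to G and in 𝕎_G, hence
zero by general position. -/
theorem IsTransversal.transverse_erase (H : S.IsTransversal) {T : Face n} {i : Fin (n + 1)}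
    (hi : i ∈ T.1) (hT : 1 < T.1.card) {Y : Vec n} (hY : Y ∈ S.transverse (T.erase i hT)) :
    ∃ z ∈ S.transverse T, ∃ c : ℝ, Y = c • (S.inpoint T - S.inpoint (T.erase i hT)) + z := by
  obtain ⟨d, hd, z, hz, rfl⟩ := H.exists_add T Y
  have h1 := S.sub_smul_mem_dir_erase hi hT hd
  set c := S.dbary i d / S.bary i (S.inpoint T)
  refine ⟨z, hz, c, ?_⟩
  have h2 : d - c • (S.inpoint T - S.inpoint (T.erase i hT)) ∈ S.transverse (T.erase i hT) := by
    refine sub_mem ?_ (Submodule.smul_mem _ _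
      (S.inpoint_sub_mem_transverse le_rfl (T.erase_le i hT)))
    have := sub_mem hY (S.transverse_anti (T.erase_le i hT) hz)
    rwa [add_sub_cancel_right] at this
  have h3 := Submodule.disjoint_def.1 (H (T.erase i hT)).disjoint _ h1 h2
  rw [sub_eq_zero.1 h3]

theorem coplanar_finrank_transverse {S : SplitSimplex 3} (hS : S.IsPowellSabin) {T : Face 3}
    (hT : T.dim = 1) : Module.finrank ℝ (S.transverse T) ≤ 2 := by
  have h1 := (coplanar_iff_finrank_le_two.1 (hS T hT))
  refine le_trans (Submodule.finrank_mono ?_) h1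
  refine Submodule.span_le.2 ?_
  rintro y ⟨U, hU, rfl⟩
  exact vsub_mem_vectorSpan ℝ ⟨_, Face.le_top T, rfl⟩ ⟨U, hU, rfl⟩

/-- Codisjointness being automatic, it suffices that 𝕎_T have dimension at most 3 - dim T. This is
trivial at vertices; a triangle has a single non-zero generator, the tetrahedron none; for edges it
is the coplanarity assumption. -/
theorem isTransversal_of_isPowellSabin {S : SplitSimplex 3} (hS : S.IsPowellSabin) :
    S.IsTransversal := by
  intro T
  refine ⟨?_, S.codisjoint_dir_transverse T⟩
  have hsup := Submodule.finrank_sup_add_finrank_inf_eq (S.dir T) (S.transverse T)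
  rw [(S.codisjoint_dir_transverse T).eq_top, finrank_top, S.finrank_dir] at hsup
  have hV : Module.finrank ℝ (Vec 3) = 3 := by simp
  rw [hV] at hsup
  have hle : Module.finrank ℝ (S.transverse T) ≤ 3 - T.dim := by
    have hcard : T.1.card ≤ 4 := by simpa using Finset.card_le_univ T.1
    have hpos := T.card_pos
    have hd : T.dim = T.1.card - 1 := rfl
    have h4 : T.dim = 0 ∨ T.dim = 1 ∨ T.dim = 2 ∨ T.dim = 3 := by omega
    rcases h4 with h | h | h | h
    · rw [h]; exact (Submodule.finrank_le _).trans hV.le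
    · rw [h]; exact coplanar_finrank_transverse hS h
    · rw [h]
      have : S.transverse T ≤ Submodule.span ℝ {S.inpoint (Face.top 3) - S.inpoint T} := by
        refine Submodule.span_le.2 ?_
        rintro y ⟨U, hU, rfl⟩
        by_cases hUT : U = T
        · rw [hUT]; exact Submodule.mem_span_singleton_self _
        · have : U = Face.top 3 := by
            refine Subtype.ext (Finset.eq_univ_of_card _ (le_antisymm (Finset.card_le_univ _) ?_))
            have := Finset.card_lt_card (lt_of_le_of_ne hU (Ne.symm hUT) : T < U)
            rw [Fintype.card_fin]; omega
          rw [this, sub_self]; exact Submodule.zero_mem _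
      exact (Submodule.finrank_mono this).trans ((finrank_span_le_card _).trans (by simp))
    · have : S.transverse T ≤ ⊥ := by
        refine Submodule.span_le.2 ?_
        rintro y ⟨U, hU, rfl⟩
        have hT : T = Face.top 3 :=
          Subtype.ext (Finset.eq_univ_of_card _ (by rw [Fintype.card_fin]; omega))
        have : U = Face.top 3 := le_antisymm (Face.le_top U) (hT ▸ hU)
        rw [this, sub_self]; exact Submodule.zero_mem _
      rw [le_bot_iff.1 this, finrank_bot]; exact Nat.zero_le _
  rw [disjoint_iff]
  refine Submodule.finrank_eq_zero.1 ?_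
  have hd : T.dim ≤ 3 := by
    have hcard : T.1.card ≤ 4 := by simpa using Finset.card_le_univ T.1
    unfold Face.dim; omega
  omega

end SplitSimplex

end FES

namespace FES

open ContinuousAlternatingMap Matrix

namespace SplitSimplex

variable {n : ℕ} {S : SplitSimplex n}

theorem alt_zero_apply {E : Type} [NormedAddCommGroup E] [NormedSpace ℝ E] {k : ℕ}
    (ξ : Fin k → E) : (0 : Alt k E) ξ = 0 := rfl

/-! ### Traces of closed piecewise affine forms -/

theorem Z.congr {k : ℕ} {T : Face n} {w w' : Vec n → Alt k (Vec n)} (hw : S.Z k T w)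
    (h : ∀ x ∈ S.real T, w' x = w x) : S.Z k T w' where
  cont := hw.cont.congr h
  dconst := hw.dconst.congr h
  trans ξ hξ := S.affineFns_congr (fun x hx => by rw [h x hx]) (hw.trans ξ hξ)

theorem Z.add {k : ℕ} {T : Face n} {w w' : Vec n → Alt k (Vec n)} (hw : S.Z k T w)
    (hw' : S.Z k T w') : S.Z k T (w + w') where
  cont := hw.cont.add hw'.cont
  dconst := by simpa using hw.dconst.add hw'.dconst
  trans ξ hξ := Submodule.add_mem _ (hw.trans ξ hξ) (hw'.trans ξ hξ)

theorem Z.smul {k : ℕ} {T : Face n} {w : Vec n → Alt k (Vec n)} (a : ℝ) (hw : S.Z k T w) :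
    S.Z k T (a • w) where
  cont := hw.cont.const_smul a
  dconst := by simpa using hw.dconst.smul a
  trans ξ hξ := Submodule.smul_mem _ a (hw.trans ξ hξ)

theorem Z.sub {k : ℕ} {T : Face n} {w w' : Vec n → Alt k (Vec n)} (hw : S.Z k T w)
    (hw' : S.Z k T w') : S.Z k T (w - w') := by
  refine (hw.add (hw'.smul (-1))).congr fun x _ => ?_
  simp only [Pi.sub_apply, Pi.add_apply, Pi.smul_apply]
  module

theorem Z.const (k : ℕ) (T : Face n) (c : Alt k (Vec n)) : S.Z k T fun _ => c where
  cont := continuousOn_const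
  dconst := by
    have := S.dconst_affine (k - 1) T c 0
    simpa [show alternatizeUncurryFin (0 : Vec n →L[ℝ] Alt k (Vec n)) = 0 by
      ext; simp [alternatizeUncurryFin_apply]] using this
  trans ξ _ := ⟨c ξ, 0, fun _ _ => by simp⟩

theorem Z.zero (k : ℕ) (T : Face n) : S.Z k T 0 := Z.const k T 0

/-- Closed functions are constant: some cell contains both x and W_T, and closedness says that the
linear part there kills x - W_T. -/
theorem Z.eq_inpoint {T : Face n} {w : Vec n → Alt 0 (Vec n)} (hw : S.Z 0 T w) {x : Vec n}
    (hx : x ∈ S.real T) : w x = w (S.inpoint T) := by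
  obtain ⟨σ, hσ, hxσ⟩ := S.exists_mem_cell 0 hx
  obtain ⟨τ, hτ, hsub, hW⟩ := S.exists_cell_insert le_rfl hσ
  obtain ⟨c, L, h1, h2⟩ := hw.dconst τ hτ
  ext ξ
  have h3 := h2 (fun _ => x - S.inpoint T) fun _ => S.sub_mem_dir hx (S.inpoint_mem_real T)
  rw [h1 x (hsub hxσ), h1 _ hW, ContinuousAlternatingMap.add_apply,
    ContinuousAlternatingMap.add_apply]
  rw [alternatizeUncurryFin_apply, Fin.sum_univ_one, alt_zero_apply,
    Subsingleton.elim (Fin.removeNth _ _) ξ] at h3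
  simp at h3
  linarith

/-- The key to restriction. Let G be the facet and Y = W_T - W_G. If an argument of the contraction
by Y lies in 𝕎_T, affineness is known; if it is Y, the value is zero. For arguments tangent to G,
the contraction is a piecewise affine p-form on R_p(G) with constant exterior derivative, and
rigidity identifies it with its affine interpolation. -/
theorem Z.trans_erase (H : S.IsTransversal) {p : ℕ} {T : Face n}
    {w : Vec n → Alt (p + 1) (Vec n)} (hw : S.Z (p + 1) T w) {i : Fin (n + 1)} (hi : i ∈ T.1)
    (hT : 1 < T.1.card) (η : Fin p → Vec n) :
    (fun x => w x (vecCons (S.inpoint T - S.inpoint (T.erase i hT)) η)) ∈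
      S.affineFns (T.erase i hT) := by
  have hle := T.erase_le i hT
  set G := T.erase i hT
  set Y := S.inpoint T - S.inpoint G with hY
  have h2 : ∀ q, ∀ e : q + 1 = p, ∀ z ∈ {z | ∃ z' ∈ S.transverse T, ∃ c : ℝ, z = c • Y + z'},
      ∀ ζ : Fin q → Vec n, (∀ i, ζ i ∈ (Set.univ : Set (Vec n))) →
      (fun x => contract Y (w x) (vecCons z ζ ∘ Fin.cast e.symm)) ∈ S.affineFns G := by
    rintro q e z ⟨z', hz', c, rfl⟩ ζ -
    subst e
    have h3 := S.affineFns_mono hle (hw.trans (vecCons z' (vecCons Y ζ)) ⟨0, hz'⟩)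
    refine S.affineFns_congr (fun x hx => ?_) (Submodule.neg_mem _ h3)
    change w x (vecCons Y (vecCons (c • Y + z') ζ)) = -w x (vecCons z' (vecCons Y ζ))
    rw [map_vecCons_swap, map_vecCons_add, map_vecCons_smul, map_vecCons_same, mul_zero, zero_add]
  refine forms_mem_of_add (S.affineFns G) (S.dir G)
    {z | ∃ z' ∈ S.transverse T, ∃ c : ℝ, z = c • Y + z'} Set.univ (fun ξ _ => ?_)
    (fun _ _ => trivial) (fun x => contract Y (w x)) (fun ξ hξ => ?_) h2 η fun _ => trivial
  · obtain ⟨d, hd, z, hz, h⟩ := H.exists_add G ξ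
    obtain ⟨z', hz', c, h'⟩ := H.transverse_erase hi hT hz
    exact ⟨d, hd, z, ⟨z', hz', c, h'⟩, h⟩
  · have h3 := DConst.contract (p := p) hle hw.dconst
    set β : Fin (n + 1) → Alt p (Vec n) := fun i => contract Y (w (S.vertex i))
    -- An affine form has constant exterior derivative, so subtracting the interpolation of the
    -- vertex values leaves a form to which `DConst.eq_zero` applies.
    have h4 := h3.add ((S.dconst_affine p G (S.interp β 0) (S.interpLinear β)).smul (-1))
    have h5 : ∀ x ∈ S.real G, contract Y (w x) ξ = S.interp β x ξ := by
      intro x hx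
      have h6 := h4.eq_zero (fun j hj ζ hζ => ?_) hx hξ
      · simp only [Pi.add_apply, Pi.smul_apply, ← interp_eq,
          ContinuousAlternatingMap.add_apply, ContinuousAlternatingMap.smul_apply, smul_eq_mul] at h6
        linarith
      · simp only [Pi.add_apply, Pi.smul_apply, ← interp_eq, interp_vertex,
          ContinuousAlternatingMap.add_apply, ContinuousAlternatingMap.smul_apply, smul_eq_mul]
        simp only [β]; ring
    refine S.affineFns_congr h5 ?_
    have := S.form_mem_affineFns G (S.interp β 0) (S.interpLinear β) ξ
    simpa only [← interp_eq] using this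

/-- Only the transverse condition is at stake. By `IsTransversal.transverse_erase`, a direction of
𝕎_G is a multiple of W_T - W_G, for which `Z.trans_erase` applies, plus one of 𝕎_T. -/
theorem Z.erase (H : S.IsTransversal) {k : ℕ} {T : Face n} {w : Vec n → Alt k (Vec n)}
    (hw : S.Z k T w) {i : Fin (n + 1)} (hi : i ∈ T.1) (hT : 1 < T.1.card) :
    S.Z k (T.erase i hT) w where
  cont := hw.cont.mono (S.real_mono (T.erase_le i hT))
  dconst := hw.dconst.mono (T.erase_le i hT)
  trans := by
    rintro ξ ⟨j, hj⟩
    cases k with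
    | zero => exact j.elim0
    | succ p =>
      obtain ⟨z, hz, c, hY⟩ := H.transverse_erase hi hT hj
      have h1 := hw.trans_erase H hi hT (j.removeNth ξ)
      have h2 := S.affineFns_mono (T.erase_le i hT) (hw.trans (vecCons z (j.removeNth ξ)) ⟨0, hz⟩)
      refine S.affineFns_congr (fun x _ => ?_) (Submodule.smul_mem _ ((-1 : ℝ) ^ (j : ℕ))
        (Submodule.add_mem _ (Submodule.smul_mem _ c h1) h2))
      conv_lhs => rw [← Fin.insertNth_self_removeNth j ξ, ContinuousAlternatingMap.map_insertNth]
      rw [hY, map_vecCons_add, map_vecCons_smul]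
      simp only [Pi.smul_apply, Pi.add_apply, smul_eq_mul, zsmul_eq_mul]
      push_cast
      ring

theorem Z.mono (H : S.IsTransversal) {k : ℕ} {T' T : Face n} (h : T' ≤ T)
    {w : Vec n → Alt k (Vec n)} (hw : S.Z k T w) : S.Z k T' w := by
  induction T using Face.facet_induction with
  | _ T ih =>
    rcases h.eq_or_lt with rfl | h
    · exact hw
    · obtain ⟨i, hi, hT, hle⟩ := Face.exists_le_erase h
      exact ih i hi hT hle (hw.erase H hi hT)

theorem Z.affine_of_dim_lt {k : ℕ} (hk : 1 ≤ k) {T : Face n} (hT : T.dim < k)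
    {w : Vec n → Alt k (Vec n)} (hw : S.Z k T w) {x : Vec n} (hx : x ∈ S.real T) :
    w x = S.interp (fun i => w (S.vertex i)) x := by
  obtain ⟨c, L, h1, -⟩ := hw.dconst _ (S.real_mem_refinement (by omega))
  rw [h1 x hx, S.affine_eq_interp]
  exact S.interp_congr (fun i hi => (h1 _ (S.vertex_mem_real hi)).symm) hx

theorem interp_eq_zero {E : Type} [NormedAddCommGroup E] [NormedSpace ℝ E] {T : Face n}
    {α : Fin (n + 1) → E} (h : ∀ i ∈ T.1, α i = 0) {x : Vec n} (hx : x ∈ S.real T) :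
    S.interp α x = 0 := by
  rw [S.interp_congr (α' := 0) h hx]; simp [interp]

theorem form_eq_zero_of_transversal (H : S.IsTransversal) (T : Face n) {k : ℕ}
    (f : Alt k (Vec n)) (h1 : ∀ ξ : Fin k → Vec n, (∀ i, ξ i ∈ S.dir T) → f ξ = 0)
    (h2 : ∀ ξ : Fin k → Vec n, (∃ i, ξ i ∈ S.transverse T) → f ξ = 0) : f = 0 := by
  ext ξ
  have := forms_mem_of_add (X := Unit) ⊥ (S.dir T) (S.transverse T : Set (Vec n)) Set.univ
    (fun ξ _ => H.exists_add T ξ) (fun _ _ => trivial) (fun _ => f) (fun ξ hξ => by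
      rw [Submodule.mem_bot]; ext; exact h1 ξ hξ) (fun q e z hz η _ => by
      rw [Submodule.mem_bot]; ext; exact h2 _ ⟨Fin.cast e 0, hz⟩) ξ fun _ => trivial
  exact congrFun ((Submodule.mem_bot ℝ).1 this) ()

/-- Uniqueness of closed piecewise affine forms, given vertex values and the vanishing of the
inpoint values on faces of dimension `k`. -/
theorem Z.eq_zero (H : S.IsTransversal) {k : ℕ} (hk : 1 ≤ k) {T : Face n}
    {w : Vec n → Alt k (Vec n)} (hw : S.Z k T w) (h0 : ∀ i ∈ T.1, w (S.vertex i) = 0)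
    (hint : ∀ F ≤ T, F.dim = k →
      (∀ i ∈ F.1, ∀ hF : 1 < F.1.card, ∀ y ∈ S.real (F.erase i hF), w y = 0) →
      ∀ ξ : Fin k → Vec n, (∀ j, ξ j ∈ S.dir F) → w (S.inpoint F) ξ = 0)
    {x : Vec n} (hx : x ∈ S.real T) : w x = 0 := by
  induction T using Face.facet_induction generalizing x with
  | _ T ih =>
    rcases Nat.lt_or_ge T.dim k with hT | hT
    · rw [hw.affine_of_dim_lt hk hT hx]; exact interp_eq_zero h0 hx
    · have hG : ∀ i ∈ T.1, ∀ hT : 1 < T.1.card, ∀ y ∈ S.real (T.erase i hT), w y = 0 :=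
        fun i hi hT y hy => ih i hi hT (hw.erase H hi hT) (fun j hj => h0 j (T.erase_le i hT hj))
          (fun F hF => hint F (hF.trans (T.erase_le i hT))) hy
      -- At the inpoint, the tangential components vanish by `hint` if dim T = k, and by
      -- `DConst.inpoint_eq_zero` if dim T > k. The components with a direction in 𝕎_T are affine on
      -- T, so they vanish with the vertex values.
      have hW : w (S.inpoint T) = 0 := by
        refine form_eq_zero_of_transversal H T _ (fun ξ hξ => ?_) fun ξ hξ => ?_
        · rcases hT.eq_or_lt with h | h
          · exact hint T le_rfl h.symm hG ξ hξ
          · exact hw.dconst.inpoint_eq_zero (by omega) h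
              (fun i hi hT y hy ζ _ => by rw [hG i hi hT y hy]; rfl) hξ
        · have h1 := S.affineFns_eq_interp (hw.trans ξ hξ) (S.inpoint_mem_real T)
          exact h1.trans (interp_eq_zero (fun i hi => by
            change w (S.vertex i) ξ = 0
            rw [h0 i hi]; rfl) (S.inpoint_mem_real T))
      have hT1 : 1 < T.1.card := Face.one_lt_card (by omega)
      obtain ⟨i, hi, y, hy, s, hs, rfl⟩ := S.exists_mem_cone hT1 hx
      rw [hw.dconst.segment (T.erase_le i hT1) hy s hs, hW, hG i hi hT1 y hy]; simp

/-! ### The Poincaré operator in closed form, and its dependence on the face -/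

variable (S)

/-- The Poincaré operator, on forms that are affine on the segments issued from the inpoint. -/
def Q {k : ℕ} (T : Face n) (v : Vec n → Alt (k + 1) (Vec n)) (x : Vec n) : Alt k (Vec n) :=
  (1 / ((k + 1 : ℝ) * (k + 2))) • contract (x - S.inpoint T) (v (S.inpoint T)) +
    (1 / (k + 2 : ℝ)) • contract (x - S.inpoint T) (v x)

variable {S}

theorem continuousOn_Q {k : ℕ} {T U : Face n} {v : Vec n → Alt (k + 1) (Vec n)}
    (hv : ContinuousOn v (S.real U)) : ContinuousOn (S.Q T v) (S.real U) := by
  have h1 : ∀ f : Vec n → Alt (k + 1) (Vec n), ContinuousOn f (S.real U) →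
      ContinuousOn (fun x => contract (x - S.inpoint T) (f x)) (S.real U) := fun f hf => by
    have h2 : ContinuousOn (fun x => (f x).curryLeft) (S.real U) :=
      (curryLeftLI (𝕜 := ℝ) (E := Vec n) (F := ℝ) (n := k)).continuous.comp_continuousOn hf
    have h3 : ContinuousOn (fun x => x - S.inpoint T) (S.real U) :=
      continuousOn_id.sub continuousOn_const
    simp only [contract_eq]
    exact h2.clm_apply h3
  unfold Q
  refine ContinuousOn.add ?_ ?_
  · exact (h1 (fun _ => v (S.inpoint T)) continuousOn_const).fun_const_smul
      (1 / ((k + 1 : ℝ) * (k + 2)))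
  · exact (h1 v hv).fun_const_smul (1 / (k + 2 : ℝ))

/-- The difference of the Poincaré operators of two nested faces is affine on the smaller one. -/
theorem Z.Q_sub_Q (H : S.IsTransversal) {k : ℕ} {T' T : Face n} (h : T' ≤ T)
    {v : Vec n → Alt (k + 1) (Vec n)} (hv : S.Z (k + 1) T v) :
    S.Z k T' (S.Q T v - S.Q T' v) := by
  have hv' := hv.mono H h
  have hk1 : (k + 1 : ℝ) ≠ 0 := by positivity
  have hk2 : (k + 2 : ℝ) ≠ 0 := by positivity
  -- The quadratic terms cancel: v(x) is only contracted by the constant vector W_{T'} - W_T, and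
  -- the remaining terms are affine in x.
  have key : ∀ x, (S.Q T v - S.Q T' v) x =
      (1 / ((k + 1 : ℝ) * (k + 2))) • ((v (S.inpoint T)).curryLeft (x - S.inpoint T) -
        (v (S.inpoint T')).curryLeft (x - S.inpoint T')) +
      (1 / (k + 2 : ℝ)) • contract (S.inpoint T' - S.inpoint T) (v x) := by
    intro x
    have e : S.inpoint T' - S.inpoint T = (x - S.inpoint T) - (x - S.inpoint T') := by abel
    rw [e, Pi.sub_apply, Q, Q]
    simp only [contract_eq, map_sub]
    module
  refine ⟨(continuousOn_Q hv'.cont).sub (continuousOn_Q hv'.cont),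
    DConst.refine (m' := k) (fun σ => S.exists_coarser_cell_pred) fun σ hσ => ?_, ?_⟩
  · obtain ⟨σ', hσ', hsub, hW', -⟩ := S.exists_full_cell hσ
    obtain ⟨τ, hτ, hτ1, hW⟩ := S.exists_cell_insert h hσ'
    obtain ⟨c, L, h1, h2⟩ := hv.dconst τ hτ
    refine ⟨(1 / ((k + 1 : ℝ) * (k + 2))) • ((v (S.inpoint T)).curryLeft (-S.inpoint T) -
        (v (S.inpoint T')).curryLeft (-S.inpoint T')) +
        (1 / (k + 2 : ℝ)) • FES.contract (S.inpoint T' - S.inpoint T) c,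
      (1 / ((k + 1 : ℝ) * (k + 2))) • ((v (S.inpoint T)).curryLeft -
        (v (S.inpoint T')).curryLeft) +
        (1 / (k + 2 : ℝ)) • (FES.contract (S.inpoint T' - S.inpoint T)).comp L,
      fun x hx => ?_, fun ξ hξ => ?_⟩
    · rw [key, h1 x (hτ1 (hsub hx))]
      simp only [map_add, map_sub, map_neg, _root_.add_apply, _root_.smul_apply, _root_.sub_apply,
        ContinuousLinearMap.comp_apply]
      module
    -- Closedness of v and Cartan's identity turn d of the contraction of v into v(W_{T'}) - v(W_T),
    -- with factor 1/(k+2). The affine terms contribute (k+1)/((k+1)(k+2)) times the opposite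
    -- difference, so the sum vanishes.
    · have h3 := congrArg (fun f => f ξ)
        (contract_alternatizeUncurryFin L (S.inpoint T' - S.inpoint T))
      simp only [contract_apply, ContinuousAlternatingMap.sub_apply] at h3
      rw [h2 _ (Fin.cases (neg_sub (S.inpoint T) (S.inpoint T') ▸
        neg_mem (S.inpoint_sub_mem_dir h)) fun j => S.dir_mono h (hξ j))] at h3
      simp only [alternatizeUncurryFin_add, alternatizeUncurryFin_smul, alternatizeUncurryFin_sub,
        alternatizeUncurryFin_curryLeft, ContinuousAlternatingMap.add_apply,
        ContinuousAlternatingMap.smul_apply, ContinuousAlternatingMap.sub_apply,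
        alt_zero_apply, nsmul_eq_mul, smul_eq_mul] at h3 ⊢
      rw [← sub_eq_zero.1 h3.symm, h1 _ hW, h1 _ (hτ1 hW')]
      simp only [ContinuousAlternatingMap.add_apply, map_sub, ContinuousAlternatingMap.sub_apply]
      push_cast
      field_simp
      ring
  · intro ξ _
    simp only [key]
    -- As W_{T'} - W_T is in 𝕎_{T'}, the contraction of v by it is affine on T' for all arguments ξ,
    -- not only those with a transverse direction.
    have h1 := hv'.trans (vecCons (S.inpoint T' - S.inpoint T) ξ)
      ⟨0, S.inpoint_sub_mem_transverse h le_rfl⟩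
    have h2 := S.form_mem_affineFns T'
      ((v (S.inpoint T)).curryLeft (-S.inpoint T) - (v (S.inpoint T')).curryLeft (-S.inpoint T'))
      ((v (S.inpoint T)).curryLeft - (v (S.inpoint T')).curryLeft) ξ
    refine S.affineFns_congr (fun x _ => ?_) (Submodule.add_mem _
      (Submodule.smul_mem _ (1 / ((k + 1 : ℝ) * (k + 2))) h2)
      (Submodule.smul_mem _ (1 / (k + 2 : ℝ)) h1))
    simp only [Pi.add_apply, Pi.smul_apply, contract_apply, map_sub, map_neg,
      ContinuousAlternatingMap.add_apply, ContinuousAlternatingMap.sub_apply,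
      ContinuousAlternatingMap.neg_apply, ContinuousAlternatingMap.smul_apply, _root_.sub_apply,
      smul_eq_mul]
    ring

end SplitSimplex

end FES

namespace FES

open ContinuousAlternatingMap Matrix

namespace SplitSimplex

variable {n : ℕ} (S : SplitSimplex n)

/-! ### Piecewise affine interpolation -/

section PiecewiseLinear

variable {E : Type} [NormedAddCommGroup E] [NormedSpace ℝ E]

/-- The barycentric coordinates of the inpoint of `U`. -/
def weight (U : Face n) (i : Fin (n + 1)) : ℝ := S.bary i (S.inpoint U)

/-- The coefficient of the inpoint of `U`, as a homogeneous function of barycentric coordinates. -/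
def hat (U : Face n) (b : Fin (n + 1) → ℝ) : ℝ := U.1.inf' U.2 fun i => b i / S.weight U i

theorem continuous_hat (U : Face n) : Continuous (S.hat U) :=
  Continuous.finset_inf'_apply U.2 fun i _ => (continuous_apply i).div_const _

theorem weight_pos {U : Face n} {i : Fin (n + 1)} (hi : i ∈ U.1) : 0 < S.weight U i :=
  S.bary_inpoint_pos hi

theorem weight_nonneg (U : Face n) (i : Fin (n + 1)) : 0 ≤ S.weight U i :=
  (S.mem_real.1 (S.inpoint_mem_real U)).1 i

/-- The minimal ratio is attained at an index where the remainder y vanishes. So `hat` reads off the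
cone parameter of W_U without knowing which facet the point lies over. -/
theorem hat_add {U : Face n} {y : Fin (n + 1) → ℝ} (hy : ∀ i, 0 ≤ y i) {i : Fin (n + 1)}
    (hi : i ∈ U.1) (h0 : y i = 0) (s : ℝ) : S.hat U (s • S.weight U + y) = s := by
  refine le_antisymm ((Finset.inf'_le _ hi).trans ?_) (Finset.le_inf' _ _ fun j hj => ?_)
  · simp [h0, (S.weight_pos hi).ne']
  · rw [le_div_iff₀ (S.weight_pos hj)]
    simpa using hy j

theorem hat_eq_zero {U : Face n} {y : Fin (n + 1) → ℝ} (hy : ∀ i, 0 ≤ y i) {i : Fin (n + 1)}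
    (hi : i ∈ U.1) (h0 : y i = 0) : S.hat U y = 0 := by
  simpa using S.hat_add hy hi h0 0

theorem hat_smul (U : Face n) {t : ℝ} (ht : 0 ≤ t) (b : Fin (n + 1) → ℝ) :
    S.hat U (t • b) = t * S.hat U b := by
  refine le_antisymm ?_ (Finset.le_inf' _ _ fun j hj => ?_)
  · obtain ⟨i, hi, h⟩ := Finset.exists_mem_eq_inf' U.2 fun i => b i / S.weight U i
    refine (Finset.inf'_le _ hi).trans (le_of_eq ?_)
    rw [hat, h, Pi.smul_apply, smul_eq_mul, mul_div_assoc]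
  · rw [Pi.smul_apply, smul_eq_mul, mul_div_assoc]
    exact mul_le_mul_of_nonneg_left (Finset.inf'_le _ hj) ht

/-- The homogeneous piecewise linear function of barycentric coordinates with given values at
vertices, and at inpoints of faces of dimension between `m + 1` and `m + d`. -/
def pl (val : Face n → E) (α : Fin (n + 1) → E) (m : ℕ) : ℕ → (Fin (n + 1) → ℝ) → E
  | 0, b => ∑ i, b i • α i
  | d + 1, b => ∑ U : Face n with U.dim = m + d + 1, S.hat U b • val U +
      pl val α m d (b - ∑ U : Face n with U.dim = m + d + 1, S.hat U b • S.weight U)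

variable (val : Face n → E) (α : Fin (n + 1) → E) (m : ℕ)

theorem continuous_pl (d : ℕ) : Continuous (S.pl val α m d) := by
  induction d with
  | zero => exact continuous_finsetSum _ fun i _ => (continuous_apply i).smul continuous_const
  | succ d ih =>
    have h := S.continuous_hat
    refine Continuous.add (continuous_finsetSum _ fun U _ => (h U).smul continuous_const)
      (ih.comp (continuous_id.sub (continuous_finsetSum _ fun U _ => (h U).smul continuous_const)))

theorem pl_smul (d : ℕ) {t : ℝ} (ht : 0 ≤ t) (b : Fin (n + 1) → ℝ) :
    S.pl val α m d (t • b) = t • S.pl val α m d b := by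
  induction d generalizing b with
  | zero => simp [pl, Finset.smul_sum, smul_smul]
  | succ d ih =>
    simp only [pl, S.hat_smul _ ht, smul_add, ← ih, Finset.smul_sum, smul_sub, smul_smul]

/-- Every face U of dimension m + d + 1 has a vertex outside T, where b vanishes, so its coefficient
is zero. -/
theorem pl_succ_of_dim_le {T : Face n} {d : ℕ} (hT : T.dim ≤ m + d) {b : Fin (n + 1) → ℝ}
    (hb : ∀ i, 0 ≤ b i) (hbT : ∀ i ∉ T.1, b i = 0) :
    S.pl val α m (d + 1) b = S.pl val α m d b := by
  have h : ∀ U ∈ Finset.univ.filter (fun U : Face n => U.dim = m + d + 1), S.hat U b = 0 := by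
    intro U hU
    have hU := (Finset.mem_filter.1 hU).2
    obtain ⟨i, hi, hiT⟩ : ∃ i ∈ U.1, i ∉ T.1 := by
      by_contra! hc
      have := Face.dim_mono (show U ≤ T from hc)
      omega
    exact S.hat_eq_zero hb hi (hbT i hiT)
  rw [pl, Finset.sum_eq_zero fun U hU => by rw [h U hU, zero_smul],
    Finset.sum_eq_zero fun U hU => by rw [h U hU, zero_smul], zero_add, sub_zero]

theorem pl_eq_of_dim_le {T : Face n} {d e : ℕ} (hT : T.dim ≤ m + d) (hde : d ≤ e)
    {b : Fin (n + 1) → ℝ} (hb : ∀ i, 0 ≤ b i) (hbT : ∀ i ∉ T.1, b i = 0) :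
    S.pl val α m e b = S.pl val α m d b := by
  induction e, hde using Nat.le_induction with
  | base => rfl
  | succ e he ih => rw [S.pl_succ_of_dim_le val α m (by omega) hb hbT, ih]

/-- Among the faces of the dimension of T, only T itself has no vertex outside T, so only the term
of W_T survives, with coefficient s. -/
theorem pl_cone {T : Face n} {d : ℕ} (hT : T.dim = m + d + 1) {i : Fin (n + 1)} (hi : i ∈ T.1)
    {y : Fin (n + 1) → ℝ} (hy : ∀ j, 0 ≤ y j) (hyi : y i = 0) (hyT : ∀ j ∉ T.1, y j = 0) {s : ℝ}
    (hs : 0 ≤ s) :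
    S.pl val α m (d + 1) (s • S.weight T + y) = s • val T + S.pl val α m d y := by
  have h : ∀ U ∈ Finset.univ.filter (fun U : Face n => U.dim = m + d + 1), U ≠ T →
      S.hat U (s • S.weight T + y) = 0 := by
    intro U hU hUT
    have hU := (Finset.mem_filter.1 hU).2
    obtain ⟨j, hj, hjT⟩ : ∃ j ∈ U.1, j ∉ T.1 := by
      by_contra! hc
      have := Face.dim_lt (lt_of_le_of_ne (show U ≤ T from hc) hUT)
      omega
    refine S.hat_eq_zero (fun l => add_nonneg (mul_nonneg hs (S.weight_nonneg T l)) (hy l)) hj ?_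
    simp [weight, S.bary_inpoint_eq_zero hjT, hyT j hjT]
  have hmem : T ∈ Finset.univ.filter (fun U : Face n => U.dim = m + d + 1) := by simp [hT]
  rw [pl, Finset.sum_eq_single_of_mem T hmem fun U hU hUT => by rw [h U hU hUT, zero_smul],
    Finset.sum_eq_single_of_mem T hmem fun U hU hUT => by rw [h U hU hUT, zero_smul],
    S.hat_add hy hi hyi, add_sub_cancel_left]

/-- Continuous piecewise affine functions come from a single global formula: minima of ratios of
barycentric coordinates, peeled off from the highest dimension down. This avoids any gluing over
cells. -/
theorem exists_pl : ∃ φ : Vec n → E, Continuous φ ∧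
    (∀ T : Face n, T.dim ≤ m → ∀ x ∈ S.real T, φ x = S.interp α x) ∧
    ∀ T : Face n, m < T.dim → ∀ i ∈ T.1, ∀ hT : 1 < T.1.card, ∀ y ∈ S.real (T.erase i hT),
      ∀ s ∈ Set.Icc (0 : ℝ) 1,
        φ (s • S.inpoint T + (1 - s) • y) = s • val T + (1 - s) • φ y := by
  have hn : ∀ T : Face n, T.dim ≤ n := fun T => by
    have := Finset.card_le_univ T.1
    rw [Fintype.card_fin] at this
    unfold Face.dim; omega
  refine ⟨fun x => S.pl val α m n fun i => S.bary i x,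
    (S.continuous_pl val α m n).comp (continuous_pi S.continuous_bary), fun T hT x hx => ?_,
    fun T hT i hi hT1 y hy s hs => ?_⟩
  · rw [S.mem_real] at hx
    exact S.pl_eq_of_dim_le val α m (d := 0) hT (Nat.zero_le _) hx.1 hx.2
  · obtain ⟨d, hd⟩ := Nat.exists_eq_add_of_lt hT
    have hyT := S.mem_real.1 (S.real_mono (T.erase_le i hT1) hy)
    have hyi := (S.mem_real.1 hy).2 i (T.not_mem_erase i hT1)
    have hs1 : 0 ≤ 1 - s := by linarith [hs.2]
    have e : (fun j => S.bary j (s • S.inpoint T + (1 - s) • y)) =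
        s • S.weight T + (1 - s) • fun j => S.bary j y := by
      ext j
      simp only [Pi.add_apply, Pi.smul_apply, smul_eq_mul, weight]
      rw [S.bary_eq j, S.bary_eq j (S.inpoint T), S.bary_eq j y, map_add, map_smul, map_smul,
        smul_eq_mul, smul_eq_mul]
      ring
    have hx0 : ∀ j, 0 ≤ (s • S.weight T + (1 - s) • fun j => S.bary j y) j := fun j =>
      add_nonneg (mul_nonneg hs.1 (S.weight_nonneg T j)) (mul_nonneg hs1 (hyT.1 j))
    have hxT : ∀ j ∉ T.1, (s • S.weight T + (1 - s) • fun j => S.bary j y) j = 0 := fun j hj => by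
      simp [weight, S.bary_inpoint_eq_zero hj, hyT.2 j hj]
    have hTn := hn T
    simp only [e]
    rw [S.pl_eq_of_dim_le val α m (T := T) (d := d + 1) (by omega) (by omega) hx0 hxT,
      S.pl_cone val α m hd hi (y := (1 - s) • fun j => S.bary j y) (fun j => mul_nonneg hs1 (hyT.1 j)) (by simp [hyi])
        (fun j hj => by simp [hyT.2 j hj]) hs.1, S.pl_smul val α m d hs1]
    have hyG := S.mem_real.1 hy
    rw [S.pl_eq_of_dim_le val α m (T := T.erase i hT1) (d := d) (e := n)
      (by rw [Face.dim_erase hT1 hi]; omega) (by omega) hyG.1 hyG.2]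

end PiecewiseLinear

/-! ### Existence of closed piecewise affine forms -/

/-- The projection onto the directions of `T`, along `𝕎_T`. -/
def proj {S : SplitSimplex n} (H : S.IsTransversal) (T : Face n) : Vec n →L[ℝ] S.dir T :=
  LinearMap.toContinuousLinearMap ((S.dir T).projectionOnto (S.transverse T) (H T))

variable {S}

theorem proj_of_mem_dir (H : S.IsTransversal) {T : Face n} {ξ : Vec n} (hξ : ξ ∈ S.dir T) :
    (proj H T ξ : Vec n) = ξ :=
  congrArg Subtype.val (Submodule.projectionOnto_apply_left (H T) ⟨ξ, hξ⟩)

theorem proj_of_mem_transverse (H : S.IsTransversal) {T : Face n} {ξ : Vec n}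
    (hξ : ξ ∈ S.transverse T) : proj H T ξ = 0 :=
  (Submodule.projectionOnto_apply_eq_zero_iff (H T)).2 hξ

theorem mem_cone_iff {T : Face n} {σ : Set (Vec n)} (hσ : Convex ℝ σ) (hne : σ.Nonempty)
    {x : Vec n} (hx : x ∈ convexHull ℝ (insert (S.inpoint T) σ)) :
    ∃ y ∈ σ, ∃ s ∈ Set.Icc (0 : ℝ) 1, x = s • S.inpoint T + (1 - s) • y := by
  rw [convexHull_insert hne, hσ.convexHull_eq, mem_convexJoin] at hx
  obtain ⟨w, hw, y, hy, a, b, ha, hb, hab, rfl⟩ := hx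
  rw [Set.mem_singleton_iff.1 hw]
  exact ⟨y, hy, a, ⟨ha, by linarith⟩, by rw [← hab, add_sub_cancel_left]⟩

/-- Extension of closed piecewise affine forms from the boundary of `T`, by coning. -/
theorem dconst_cone {p : ℕ} {T : Face n} (hT : p < T.dim)
    {w : Vec n → Alt (p + 1) (Vec n)} {α : Fin (n + 1) → Alt (p + 1) (Vec n)}
    {W : Alt (p + 1) (Vec n)}
    (hG : ∀ i ∈ T.1, ∀ h : 1 < T.1.card, S.DConst p (T.erase i h) w 0)
    (htr : ∀ i ∈ T.1, ∀ h : 1 < T.1.card, ∀ y ∈ S.real (T.erase i h), ∀ ξ : Fin (p + 1) → Vec n,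
      (∃ j, ξ j ∈ S.transverse (T.erase i h)) → w y ξ = S.interp α y ξ)
    (hcone : ∀ i ∈ T.1, ∀ h : 1 < T.1.card, ∀ y ∈ S.real (T.erase i h), ∀ s ∈ Set.Icc (0 : ℝ) 1,
      w (s • S.inpoint T + (1 - s) • y) = s • W + (1 - s) • w y)
    (hW : ∀ i ∈ T.1, ∀ h : 1 < T.1.card, p + 1 < T.dim → ∀ η : Fin (p + 1) → Vec n,
      (∀ j, η j ∈ S.dir (T.erase i h)) → W η - w (S.inpoint (T.erase i h)) η =
        S.interpLinear α (S.inpoint T - S.inpoint (T.erase i h)) η -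
        alternatizeUncurryFin (S.interpLinear α)
          (vecCons (S.inpoint T - S.inpoint (T.erase i h)) η)) :
    S.DConst p T w 0 := by
  intro σ hσ
  obtain ⟨i, hi, h, σ₁, hσ₁, hsub₁⟩ := S.exists_subset_cone hT hσ
  obtain ⟨σ', hσ', hsub', hG', hfull⟩ := S.exists_full_cell hσ₁
  obtain ⟨c, L, h1, h2⟩ := hG i hi h σ' hσ'
  have hle := T.erase_le i h
  set G := T.erase i h with hGdef
  set Y := S.inpoint T - S.inpoint G with hYdef
  have hw := S.bary_inpoint_pos hi
  -- The function c + L x + λ_i(x) δ equals c + L x on the facet, where λ_i = 0, and W at the apex,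
  -- so it represents w on the cone.
  set δ := (S.bary i (S.inpoint T))⁻¹ • (W - (c + L (S.inpoint T))) with hδ
  have hWT : w (S.inpoint T) = W := by
    have := hcone i hi h _ (S.inpoint_mem_real G) 1 (by simp)
    simpa using this
  have hval : ∀ x ∈ convexHull ℝ (insert (S.inpoint T) σ'),
      w x = (c + S.bary i 0 • δ) + (L + (S.dbary i).smulRight δ) x := by
    intro x hx
    obtain ⟨y, hy, s, hs, rfl⟩ := mem_cone_iff (S.convex_cell hσ') ⟨_, hG'⟩ hx
    have hyG := S.cell_subset hσ' hy
    have hyi := (S.mem_real.1 hyG).2 i (T.not_mem_erase i h)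
    rw [hcone i hi h y hyG s hs, h1 y hy]
    have e : ∀ x, (c + S.bary i 0 • δ) + (L + (S.dbary i).smulRight δ) x =
        c + L x + S.bary i x • δ := by
      intro x
      rw [S.bary_eq i x, _root_.add_apply, ContinuousLinearMap.smulRight_apply]
      module
    have e2 : S.bary i (s • S.inpoint T + (1 - s) • y) = s * S.bary i (S.inpoint T) := by
      rw [S.bary_eq i] at hyi ⊢
      rw [S.bary_eq i (S.inpoint T), map_add, map_smul, map_smul, smul_eq_mul, smul_eq_mul]
      linear_combination (1 - s) * hyi
    rw [e, e2, mul_smul, hδ, smul_inv_smul₀ hw.ne', map_add, map_smul, map_smul]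
    module
  refine ⟨_, _, fun x hx => hval x ?_, fun ξ hξ => ?_⟩
  · exact convexHull_mono (Set.insert_subset_insert hsub') (hsub₁ hx)
  rw [alt_zero_apply]
  set L' := L + (S.dbary i).smulRight δ
  have hL' : ∀ η ∈ S.dir G, L' η = L η := fun η hη => by
    simp [L', (S.mem_dir_erase.1 hη).2]
  have hAlt : ∀ ξ : Fin (p + 2) → Vec n, (∀ j, ξ j ∈ S.dir G) → alternatizeUncurryFin L' ξ = 0 := by
    intro ξ hξ
    rw [← alt_zero_apply ξ, ← h2 ξ hξ]
    exact alternatizeUncurryFin_congr fun j => by rw [hL' _ (hξ j)]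
  have hsub : σ' ⊆ convexHull ℝ (insert (S.inpoint T) σ') :=
    (Set.subset_insert _ _).trans (subset_convexHull ℝ _)
  have hWmem : S.inpoint T ∈ convexHull ℝ (insert (S.inpoint T) σ') :=
    subset_convexHull ℝ _ (Set.mem_insert _ _)
  -- The component of dw along Y. In Cartan's identity the first term is W - w(W_G), and the second
  -- is that of the interpolation of `α`, since the contraction of w by Y agrees with it on G; `hW`
  -- makes them cancel. If dim T = p + 1, the degree exceeds dim G and there is nothing to check.
  have hcon : ∀ q, ∀ e : q + 1 = p + 2, ∀ η : Fin q → Vec n, (∀ j, η j ∈ S.dir G) →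
      alternatizeUncurryFin L' (vecCons Y η ∘ Fin.cast e.symm) = 0 := by
    intro q e η hη
    obtain rfl : q = p + 1 := by omega
    change alternatizeUncurryFin L' (vecCons Y η) = 0
    rcases Nat.lt_or_ge (p + 1) T.dim with hpT | hpT
    · rw [alternatizeUncurryFin_vecCons]
      have e1 : L' Y = W - w (S.inpoint G) := by
        rw [← hWT, hval _ hWmem, hval _ (hsub hG'), hYdef, map_sub]; abel
      have e2 : alternatizeUncurryFin ((contract Y).comp L') η =
          alternatizeUncurryFin ((contract Y).comp (S.interpLinear α)) η := by
        refine alternatizeUncurryFin_congr fun j => ?_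
        simp only [ContinuousLinearMap.comp_apply, contract_apply]
        refine linear_eq_of_mem_vectorSpan (σ := σ')
          (L := (ContinuousAlternatingMap.apply ℝ _ ℝ _).comp L')
          (L' := (ContinuousAlternatingMap.apply ℝ _ ℝ _).comp (S.interpLinear α))
          (fun a ha b hb => ?_) (hfull (hη j))
        have hYt : ∃ l, vecCons Y (j.removeNth η) l ∈ S.transverse G :=
          ⟨0, S.inpoint_sub_mem_transverse le_rfl hle⟩
        have ea := htr i hi h a (S.cell_subset hσ' ha) _ hYt
        have eb := htr i hi h b (S.cell_subset hσ' hb) _ hYt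
        rw [hval a (hsub ha), S.interp_eq] at ea
        rw [hval b (hsub hb), S.interp_eq] at eb
        simp only [ContinuousAlternatingMap.add_apply] at ea eb
        simp only [ContinuousLinearMap.comp_apply, map_sub, ContinuousAlternatingMap.apply_apply]
        linarith
      have e3 := alternatizeUncurryFin_vecCons (S.interpLinear α) Y η
      have e4 := hW i hi h hpT η hη
      rw [e2, e1, ContinuousAlternatingMap.sub_apply]
      linarith
    · have := S.form_eq_zero_of_dim_lt (T := G) (p := p + 1)
        (by rw [hGdef, Face.dim_erase h hi]; omega) (contract Y (alternatizeUncurryFin L')) hη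
      exact this
  exact S.form_eq_zero_of_erase hi h _ hAlt hcon hξ

/-- Existence of closed piecewise affine forms with given vertex values. -/
theorem exists_Z (H : S.IsTransversal) (p : ℕ) (α : Fin (n + 1) → Alt (p + 1) (Vec n))
    (κ : Alt (p + 1) (Vec n)) :
    ∃ w : Vec n → Alt (p + 1) (Vec n), (∀ T, S.Z (p + 1) T w) ∧
      (∀ i, w (S.vertex i) = α i) ∧
      ∀ T : Face n, p < T.dim → ∀ ξ : Fin (p + 1) → Vec n, (∀ j, ξ j ∈ S.dir T) →
        w (S.inpoint T) ξ = S.interp α (S.inpoint T) ξ + κ ξ -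
          alternatizeUncurryFin (S.interpLinear α) (vecCons (S.inpoint T) ξ) := by
  set θ := alternatizeUncurryFin (S.interpLinear α) with hθ
  -- The term -θ contracted by W_T makes the differences val T - val G satisfy the condition of
  -- `dconst_cone`, while κ cancels in them and stays free. Composing with the projection changes
  -- tangential components only, so those in directions of 𝕎_T remain affine.
  set val : Face n → Alt (p + 1) (Vec n) := fun T => S.interp α (S.inpoint T) +
    (κ - contract (S.inpoint T) θ).compContinuousLinearMap ((S.dir T).subtypeL.comp (proj H T))
    with hval
  have hval_dir : ∀ T, ∀ ξ : Fin (p + 1) → Vec n, (∀ j, ξ j ∈ S.dir T) →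
      val T ξ = S.interp α (S.inpoint T) ξ + κ ξ - θ (vecCons (S.inpoint T) ξ) := by
    intro T ξ hξ
    have e : (⇑((S.dir T).subtypeL.comp (proj H T)) ∘ ξ) = ξ :=
      funext fun j => proj_of_mem_dir H (hξ j)
    simp only [hval, ContinuousAlternatingMap.add_apply,
      ContinuousAlternatingMap.compContinuousLinearMap_apply, e,
      ContinuousAlternatingMap.sub_apply, contract_apply]
    ring
  have hval_tr : ∀ T, ∀ ξ : Fin (p + 1) → Vec n, (∃ j, ξ j ∈ S.transverse T) →
      val T ξ = S.interp α (S.inpoint T) ξ := by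
    rintro T ξ ⟨j, hj⟩
    simp only [hval, ContinuousAlternatingMap.add_apply,
      ContinuousAlternatingMap.compContinuousLinearMap_apply]
    have e : ((S.dir T).subtypeL.comp (proj H T)) (ξ j) = 0 := by
      rw [ContinuousLinearMap.comp_apply, proj_of_mem_transverse H hj, _root_.map_zero]
    rw [ContinuousAlternatingMap.map_coord_zero (κ - contract (S.inpoint T) θ) j e, add_zero]
  obtain ⟨w, hcont, hlow, hcone⟩ := S.exists_pl val α p
  have hWT : ∀ T : Face n, p < T.dim → w (S.inpoint T) = val T := by
    intro T hT
    have hT1 : 1 < T.1.card := Face.one_lt_card (by omega)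
    obtain ⟨i, hi⟩ := T.2
    have := hcone T hT i hi hT1 _ (S.inpoint_mem_real _) 1 (by simp)
    simpa using this
  have main : ∀ T, S.DConst p T w 0 ∧ ∀ y ∈ S.real T, ∀ ξ : Fin (p + 1) → Vec n,
      (∃ j, ξ j ∈ S.transverse T) → w y ξ = S.interp α y ξ := by
    intro T
    induction T using Face.facet_induction with
    | _ T ih =>
      rcases Nat.lt_or_ge p T.dim with hT | hT
      · refine ⟨dconst_cone hT (α := α) (fun i hi h => (ih i hi h).1) (fun i hi h => (ih i hi h).2)
          (hcone T hT) fun i hi h hpT η hη => ?_, fun x hx ξ hξ => ?_⟩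
        · have hle := T.erase_le i h
          have hG : p < (T.erase i h).dim := by rw [Face.dim_erase h hi]; omega
          rw [hWT _ hG, hval_dir _ _ fun j => S.dir_mono hle (hη j), hval_dir _ _ hη,
            S.interp_eq α (S.inpoint T), S.interp_eq α (S.inpoint (T.erase i h)), map_sub,
            ← hθ]
          simp only [← contract_apply, contract_eq, map_sub,
            ContinuousAlternatingMap.add_apply, ContinuousAlternatingMap.sub_apply]
          ring
        · have hT1 : 1 < T.1.card := Face.one_lt_card (by omega)
          obtain ⟨i, hi, y, hy, s, hs, rfl⟩ := S.exists_mem_cone hT1 hx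
          obtain ⟨j, hj⟩ := hξ
          rw [hcone T hT i hi hT1 y hy s hs, ContinuousAlternatingMap.add_apply,
            ContinuousAlternatingMap.smul_apply, ContinuousAlternatingMap.smul_apply,
            hval_tr T ξ ⟨j, hj⟩,
            (ih i hi hT1).2 y hy ξ ⟨j, S.transverse_anti (T.erase_le i hT1) hj⟩,
            S.interp_eq α (S.inpoint T), S.interp_eq α y, S.interp_eq α (_ + _), map_add, map_smul,
            map_smul]
          simp only [ContinuousAlternatingMap.add_apply, ContinuousAlternatingMap.smul_apply,
            smul_eq_mul]
          ring
      · refine ⟨fun σ hσ => ⟨S.interp α 0, S.interpLinear α, fun x hx => ?_, fun ξ hξ => ?_⟩,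
          fun x hx ξ _ => by rw [hlow T hT x hx]⟩
        · rw [hlow T hT x (S.cell_subset hσ hx), S.interp_eq]
        · rw [S.form_eq_zero_of_dim_lt (by omega) _ hξ]; rfl
  refine ⟨w, fun T => ⟨hcont.continuousOn, (main T).1, fun ξ hξ => ?_⟩, fun i => ?_,
    fun T hT ξ hξ => by rw [hWT T hT, hval_dir T ξ hξ]⟩
  · refine S.affineFns_congr (fun x hx => (main T).2 x hx ξ hξ) ?_
    have := S.form_mem_affineFns T (S.interp α 0) (S.interpLinear α) ξ
    simpa only [← interp_eq] using this
  · rw [hlow (Face.single i) (by simp [Face.dim, Face.single]) _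
      (S.vertex_mem_real (Finset.mem_singleton_self i)), S.interp_vertex]

end SplitSimplex

end FES

namespace FES

open ContinuousAlternatingMap Matrix

namespace SplitSimplex

/-! ### Polynomial maps and their exterior derivatives -/

section Polynomial

variable {D E : Type} [NormedAddCommGroup D] [NormedSpace ℝ D] [NormedAddCommGroup E]
  [NormedSpace ℝ E]

theorem IsPolynomial.contDiff {r : ℕ} {q : D → E} (hq : IsPolynomial r q) : ContDiff ℝ ∞ q := by
  obtain ⟨c, hc⟩ := hq
  rw [funext hc]
  exact ContDiff.sum fun i _ => (c i).contDiff.comp (contDiff_pi.2 fun _ => contDiff_id)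

theorem IsPolynomial.differentiable {r : ℕ} {q : D → E} (hq : IsPolynomial r q) :
    Differentiable ℝ q := hq.contDiff.differentiable (by simp)

theorem IsPolynomial.exists_affine {q : D → E} (hq : IsPolynomial 1 q) :
    ∃ (c : E) (L : D →L[ℝ] E), ∀ y, q y = c + L y := by
  obtain ⟨c, hc⟩ := hq
  refine ⟨c 0 0, (c 1).toContinuousLinearMap 0 0, fun y => ?_⟩
  rw [hc, Finset.sum_range_succ, Finset.sum_range_one]
  congr 1
  · exact congrArg _ (Subsingleton.elim _ _)
  · rw [ContinuousMultilinearMap.toContinuousLinearMap_apply]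
    congr 1
    ext i
    rw [Subsingleton.elim i 0, Function.update_self]

theorem isPolynomial_quadratic (c : E) (L : D →L[ℝ] E) (B : D →L[ℝ] D →L[ℝ] E) :
    IsPolynomial 2 fun y => c + L y + B y y := by
  refine ⟨fun i => match i with
    | 0 => ContinuousMultilinearMap.constOfIsEmpty ℝ _ c
    | 1 => (ContinuousMultilinearMap.ofSubsingleton ℝ D E (0 : Fin 1)) L
    | 2 => ContinuousLinearMap.uncurryLeft (Ei := fun _ : Fin 2 => D)
      (((ContinuousMultilinearMap.ofSubsingletonₗᵢ (𝕜 := ℝ) (G := D) (G' := E) (0 : Fin 1)).toContinuousLinearEquiv :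
        (D →L[ℝ] E) →L[ℝ] _).comp B)
    | _ => 0, fun y => ?_⟩
  rw [Finset.sum_range_succ, Finset.sum_range_succ, Finset.sum_range_one]
  rfl

theorem isPolynomial_affine (r : ℕ) (hr : 1 ≤ r) (c : E) (L : D →L[ℝ] E) :
    IsPolynomial r fun y => c + L y := by
  refine ⟨fun i => match i with
    | 0 => ContinuousMultilinearMap.constOfIsEmpty ℝ _ c
    | 1 => (ContinuousMultilinearMap.ofSubsingleton ℝ D E (0 : Fin 1)) L
    | _ => 0, fun y => ?_⟩
  obtain ⟨r, rfl⟩ := Nat.exists_eq_add_of_le' hr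
  rw [Finset.sum_range_succ', Finset.sum_range_succ']
  simp [add_comm]

theorem fderiv_quadratic (c : E) (L : D →L[ℝ] E) (B : D →L[ℝ] D →L[ℝ] E) (y : D) :
    fderiv ℝ (fun y => c + L y + B y y) y = L + (B y + B.flip y) := by
  have hB : HasFDerivAt (fun y => B y y) (B y + B.flip y) y :=
    (B.hasFDerivAt (x := y)).clm_apply (hasFDerivAt_id y)
  exact (((L.hasFDerivAt (x := y)).const_add c).fun_add hB).fderiv

theorem extDeriv_affine {k : ℕ} (c : Alt k D) (L : D →L[ℝ] Alt k D) (y : D) :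
    extDeriv (fun y => c + L y) y = alternatizeUncurryFin L := by
  rw [extDeriv, ((L.hasFDerivAt (x := y)).const_add c).fderiv]

/-- The Poincaré operator, on affine forms. -/
def affinePrimitive {k : ℕ} (c : Alt (k + 1) D) (L : D →L[ℝ] Alt (k + 1) D) (y : D) : Alt k D :=
  (1 / (k + 1 : ℝ)) • c.curryLeft y + (1 / (k + 2 : ℝ)) • (L y).curryLeft y

theorem affinePrimitive_eq {k : ℕ} (c : Alt (k + 1) D) (L : D →L[ℝ] Alt (k + 1) D) :
    affinePrimitive c L = fun y => 0 + ((1 / (k + 1 : ℝ)) • c.curryLeft) y +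
      ((1 / (k + 2 : ℝ)) • ((curryLeftLI (𝕜 := ℝ) (E := D) (F := ℝ)
        (n := k)).toContinuousLinearMap.comp L)) y y := by
  ext1 y
  rw [zero_add]; rfl

theorem isPolynomial_affinePrimitive {k : ℕ} (c : Alt (k + 1) D) (L : D →L[ℝ] Alt (k + 1) D) :
    IsPolynomial 2 (affinePrimitive c L) := by
  rw [affinePrimitive_eq]
  exact isPolynomial_quadratic _ _ _

theorem isPolynomial_add_affinePrimitive {k : ℕ} (c' : Alt k D) (L' : D →L[ℝ] Alt k D)
    (c : Alt (k + 1) D) (L : D →L[ℝ] Alt (k + 1) D) :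
    IsPolynomial 2 fun y => c' + L' y + affinePrimitive c L y := by
  have e : (fun y => c' + L' y + affinePrimitive c L y) = fun y =>
      c' + (L' + (1 / (k + 1 : ℝ)) • c.curryLeft) y + ((1 / (k + 2 : ℝ)) • ((curryLeftLI (𝕜 := ℝ)
        (E := D) (F := ℝ) (n := k)).toContinuousLinearMap.comp L)) y y := by
    ext1 y
    rw [affinePrimitive_eq, _root_.add_apply]
    abel_nf
  rw [e]
  exact isPolynomial_quadratic _ _ _

/-- The homotopy formula. Alternating the contraction of c gives (k+1) c. The derivative of the
quadratic term has two parts, which alternate to (k+1) L y and, by closedness and Cartan's identity,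
to L y. -/
theorem extDeriv_affinePrimitive {k : ℕ} (c : Alt (k + 1) D) (L : D →L[ℝ] Alt (k + 1) D)
    (hL : alternatizeUncurryFin L = 0) (y : D) :
    extDeriv (affinePrimitive c L) y = c + L y := by
  set B := (1 / (k + 2 : ℝ)) • ((curryLeftLI (𝕜 := ℝ) (E := D) (F := ℝ)
        (n := k)).toContinuousLinearMap.comp L)
  rw [extDeriv, affinePrimitive_eq, fderiv_quadratic]
  have e1 : B y = (1 / (k + 2 : ℝ)) • (L y).curryLeft := rfl
  have e2 : B.flip y = (1 / (k + 2 : ℝ)) • (contract y).comp L := rfl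
  have h := contract_alternatizeUncurryFin L y
  rw [hL, _root_.map_zero, eq_comm, sub_eq_zero] at h
  rw [e1, e2]
  simp only [alternatizeUncurryFin_add, alternatizeUncurryFin_smul, ← h,
    alternatizeUncurryFin_curryLeft]
  ext ξ
  simp only [ContinuousAlternatingMap.add_apply, ContinuousAlternatingMap.smul_apply, smul_eq_mul,
    nsmul_eq_mul]
  have hk1 : (k + 1 : ℝ) ≠ 0 := by positivity
  have hk2 : (k + 2 : ℝ) ≠ 0 := by positivity
  push_cast
  field_simp
  ring

theorem uniqueDiffOn_of_span {A : Set D} [FiniteDimensional ℝ D] (hA : Convex ℝ A) (h0 : 0 ∈ A)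
    (hspan : Submodule.span ℝ A = ⊤) : UniqueDiffOn ℝ A := by
  refine uniqueDiffOn_convex hA ?_
  rw [hA.interior_nonempty_iff_affineSpan_eq_top, ← AffineSubspace.direction_eq_top_iff_of_nonempty
    ⟨0, subset_affineSpan ℝ A h0⟩, direction_affineSpan, vectorSpan_eq_span_vsub_set_right ℝ h0]
  simpa using hspan

/-- The definitions supply possibly different polynomials representing one form on a cell. On a
full-dimensional cell their derivatives agree, also at boundary points. -/
theorem extDeriv_eq_of_eqOn {k : ℕ} {A : Set D} (hA : UniqueDiffOn ℝ A) {q q' : D → Alt k D}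
    (hq : Differentiable ℝ q) (hq' : Differentiable ℝ q') (h : ∀ y ∈ A, q y = q' y) {y : D}
    (hy : y ∈ A) : extDeriv q y = extDeriv q' y := by
  rw [extDeriv, extDeriv, ← (hq y).fderivWithin (hA y hy), ← (hq' y).fderivWithin (hA y hy),
    fderivWithin_congr h (h y hy)]

end Polynomial

variable {n : ℕ} {S : SplitSimplex n}

theorem uniqueDiffOn_cell {m : ℕ} {T : Face n} {σ : Set (Vec n)} (hσ : σ ∈ S.refinement m T)
    (hW : S.inpoint T ∈ σ) (hfull : S.dir T ≤ vectorSpan ℝ σ) :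
    UniqueDiffOn ℝ {y : S.dir T | S.inpoint T + (y : Vec n) ∈ σ} := by
  refine uniqueDiffOn_of_span ?_ (by simpa using hW) ?_
  · have := (S.convex_cell hσ).affine_preimage
      (((S.dir T).subtype.toAffineMap + AffineMap.const ℝ _ (S.inpoint T)))
    refine (congrArg (Convex ℝ) ?_).mp this
    ext y
    simp [add_comm]
  · rw [eq_top_iff, ← Submodule.map_le_map_iff_of_injective (f := (S.dir T).subtype)
      (Submodule.subtype_injective _), Submodule.map_subtype_top]
    refine hfull.trans ?_
    rw [vectorSpan_eq_span_vsub_set_right ℝ hW, Submodule.span_le]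
    rintro _ ⟨x, hx, rfl⟩
    have hd := S.sub_mem_dir (S.cell_subset hσ hx) (S.inpoint_mem_real T)
    exact ⟨⟨x - S.inpoint T, hd⟩, Submodule.subset_span (by simpa using hx), rfl⟩

theorem inpoint_add_mem_real {m : ℕ} {T : Face n} {σ : Set (Vec n)} (hσ : σ ∈ S.refinement m T)
    {y : S.dir T} (hy : S.inpoint T + (y : Vec n) ∈ σ) :
    S.radial T ⟨S.inpoint T + (y : Vec n), S.cell_subset hσ hy⟩ = y := by
  ext1
  simp [radial]

/-! ### Forms on `T` with values in the alternating forms on the tangent space -/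

/-- A form on `T` which is affine and closed on each cell. -/
def ClosedAffine (S : SplitSimplex n) (m : ℕ) (T : Face n) {k : ℕ} (u : S.real T → Alt k (S.dir T)) :
    Prop :=
  ∀ σ ∈ S.refinement m T, ∃ (c : Alt k (S.dir T)) (L : S.dir T →L[ℝ] Alt k (S.dir T)),
    (∀ x : S.real T, (x : Vec n) ∈ σ → u x = c + L (S.radial T x)) ∧ alternatizeUncurryFin L = 0

/-- On a full cell, the affine representative of u and the polynomial whose exterior derivative
vanishes coincide. Comparing derivatives at W_T, which such a cell contains, shows that the affine
one is closed. -/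
theorem mem_K {k : ℕ} {T : Face n} {u : S.real T → Alt k (S.dir T)} :
    u ∈ S.K k T ↔ Continuous u ∧ S.ClosedAffine (k - 1) T u := by
  constructor
  · rintro ⟨⟨h1, h2⟩, h3⟩
    refine ⟨h1, fun σ hσ => ?_⟩
    obtain ⟨τ, hτ, hsub, hW, hfull⟩ := S.exists_full_cell hσ
    obtain ⟨q, hq, hqu⟩ := h2 τ hτ
    obtain ⟨q', ⟨r, hq'⟩, hqu'⟩ := h3 τ hτ
    obtain ⟨c, L, hcL⟩ := hq.exists_affine
    refine ⟨c, L, fun x hx => by rw [hqu x (hsub hx), hcL], ?_⟩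
    have h := extDeriv_eq_of_eqOn (S.uniqueDiffOn_cell hτ hW hfull) hq.differentiable
      hq'.differentiable (fun y hy => ?_) (y := 0) (by simpa using hW)
    · rw [show q = fun y => c + L y from funext hcL, extDeriv_affine] at h
      have := (hqu' ⟨_, S.inpoint_mem_real T⟩ hW).2
      rw [h, eq_comm]
      refine this.trans (congrArg (extDeriv q') (Subtype.ext ?_))
      simp [radial]
    · have e := inpoint_add_mem_real hτ hy
      have h1 := hqu ⟨_, S.cell_subset hτ hy⟩ hy
      have h2 := (hqu' ⟨_, S.cell_subset hτ hy⟩ hy).1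
      rw [e] at h1 h2
      rw [← h1, ← h2]
  · rintro ⟨h1, h2⟩
    refine ⟨⟨h1, fun σ hσ => ?_⟩, fun σ hσ => ?_⟩
    · obtain ⟨c, L, h3, h4⟩ := h2 σ hσ
      exact ⟨_, isPolynomial_affine 1 le_rfl c L, h3⟩
    · obtain ⟨c, L, h3, h4⟩ := h2 σ hσ
      exact ⟨_, ⟨1, isPolynomial_affine 1 le_rfl c L⟩, fun x hx => ⟨h3 x hx, by
        rw [extDeriv_affine, h4]; rfl⟩⟩

theorem segment_mem_real {T : Face n} {x : Vec n} (hx : x ∈ S.real T) {t : ℝ}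
    (ht : t ∈ Set.Icc (0 : ℝ) 1) : S.inpoint T + t • (x - S.inpoint T) ∈ S.real T := by
  have := S.convex_real T (S.inpoint_mem_real T) hx (sub_nonneg.2 ht.2) ht.1 (by ring)
  convert this using 1
  module

theorem extendZero_apply {T : Face n} {E : Type} [Zero E] (u : S.real T → E) {x : Vec n}
    (hx : x ∈ S.real T) : S.extendZero T u x = u ⟨x, hx⟩ :=
  Subtype.val_injective.extend_apply u 0 ⟨x, hx⟩

/-- With a the value at the inpoint and b the value at x of a form affine on the segment between
them, this yields the two coefficients of `Q`. -/
theorem integral_poincare {F : Type} [NormedAddCommGroup F] [NormedSpace ℝ F] [CompleteSpace F]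
    (k : ℕ) (a b : F) : (∫ t in (0 : ℝ)..1, t ^ k • ((1 - t) • a + t • b)) =
      (1 / ((k + 1 : ℝ) * (k + 2))) • a + (1 / (k + 2 : ℝ)) • b := by
  have e : ∀ t : ℝ, t ^ k • ((1 - t) • a + t • b) = (t ^ k) • a + (t ^ (k + 1)) • (b - a) :=
    fun t => by rw [pow_succ]; module
  simp only [e]
  rw [intervalIntegral.integral_add, intervalIntegral.integral_smul_const,
    intervalIntegral.integral_smul_const, integral_pow, integral_pow]
  · simp only [one_pow, ne_eq, Nat.add_eq_zero_iff, one_ne_zero, and_false, not_false_eq_true,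
      zero_pow, sub_zero, Nat.cast_add, Nat.cast_one]
    have hk1 : (k + 1 : ℝ) ≠ 0 := by positivity
    have hk2 : (k + 2 : ℝ) ≠ 0 := by positivity
    rw [smul_sub, ← sub_eq_zero]
    have e2 : (1 / (k + 1 : ℝ)) = 1 / ((k + 1 : ℝ) * (k + 2)) + 1 / (k + 2) := by
      field_simp; ring
    have e3 : (k + 1 + 1 : ℝ) = k + 2 := by ring
    rw [e2, e3]
    module
  · exact Continuous.intervalIntegrable (by fun_prop) _ _
  · exact Continuous.intervalIntegrable (by fun_prop) _ _

/-- The Poincaré operator, on forms that are affine on the segments issued from the inpoint. -/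
theorem poincareOn_eq {T : Face n} {E : Type} [NormedAddCommGroup E] [NormedSpace ℝ E]
    (X : S.real T → E) {k : ℕ} (u : S.real T → Alt (k + 1) E) (x : S.real T)
    (hu : ∀ t (ht : t ∈ Set.Icc (0 : ℝ) 1), u ⟨_, segment_mem_real x.2 ht⟩ =
      (1 - t) • u ⟨_, S.inpoint_mem_real T⟩ + t • u x) :
    S.poincareOn T X u x = (1 / ((k + 1 : ℝ) * (k + 2))) •
      (u ⟨_, S.inpoint_mem_real T⟩).curryLeft (X x) + (1 / (k + 2 : ℝ)) • (u x).curryLeft (X x) := by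
  rw [poincareOn]
  refine Eq.trans ?_ (integral_poincare k _ _)
  refine intervalIntegral.integral_congr fun t ht => ?_
  rw [Set.uIcc_of_le zero_le_one] at ht
  beta_reduce
  rw [S.extendZero_apply u (segment_mem_real x.2 ht), hu t ht]
  rfl

theorem ClosedAffine.segment {m k : ℕ} {T : Face n} {u : S.real T → Alt k (S.dir T)}
    (hu : S.ClosedAffine m T u) (x : S.real T) (t : ℝ) (ht : t ∈ Set.Icc (0 : ℝ) 1) :
    u ⟨_, segment_mem_real x.2 ht⟩ = (1 - t) • u ⟨_, S.inpoint_mem_real T⟩ + t • u x := by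
  obtain ⟨σ, hσ, hx⟩ := S.exists_mem_cell m x.2
  obtain ⟨τ, hτ, hsub, hW, -⟩ := S.exists_full_cell hσ
  obtain ⟨c, L, h, -⟩ := hu τ hτ
  have hmem : S.inpoint T + t • ((x : Vec n) - S.inpoint T) ∈ τ := by
    have := S.convex_cell hτ hW (hsub hx) (sub_nonneg.2 ht.2) ht.1 (by ring)
    convert this using 1
    module
  have e1 : S.radial T ⟨_, segment_mem_real x.2 ht⟩ = t • S.radial T x := by
    ext1; simp [radial]
  have e2 : S.radial T ⟨_, S.inpoint_mem_real T⟩ = 0 := by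
    ext1; simp [radial]
  rw [h _ hmem, h _ hW, h _ (hsub hx), e1, e2, map_smul, _root_.map_zero]
  module

/-- In the coordinate with origin W_T, the value at the inpoint is c. The two coefficients of c add
up to 1/(k+1), which gives `affinePrimitive`. -/
theorem ClosedAffine.poincare_eq {m k : ℕ} {T : Face n} {u : S.real T → Alt (k + 1) (S.dir T)}
    (hu : S.ClosedAffine m T u) {σ : Set (Vec n)} (hσ : σ ∈ S.refinement m T) :
    ∃ (c : Alt (k + 1) (S.dir T)) (L : S.dir T →L[ℝ] Alt (k + 1) (S.dir T)),
      alternatizeUncurryFin L = 0 ∧ ∀ x : S.real T, (x : Vec n) ∈ σ →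
        u x = c + L (S.radial T x) ∧ S.poincare T u x = affinePrimitive c L (S.radial T x) := by
  obtain ⟨τ, hτ, hsub, hW, -⟩ := S.exists_full_cell hσ
  obtain ⟨c, L, h, hL⟩ := hu τ hτ
  refine ⟨c, L, hL, fun x hx => ⟨h x (hsub hx), ?_⟩⟩
  have e2 : S.radial T ⟨_, S.inpoint_mem_real T⟩ = 0 := by
    ext1; simp [radial]
  rw [poincare, S.poincareOn_eq _ _ _ (hu.segment x), h x (hsub hx), h _ hW, e2, _root_.map_zero,
    add_zero, affinePrimitive]
  have hk1 : (k + 1 : ℝ) ≠ 0 := by positivity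
  have hk2 : (k + 2 : ℝ) ≠ 0 := by positivity
  have e2 : (1 / (k + 1 : ℝ)) = 1 / ((k + 1 : ℝ) * (k + 2)) + 1 / (k + 2) := by
    field_simp; ring
  have e3 : (c + L (S.radial T x)).curryLeft (S.radial T x) = c.curryLeft (S.radial T x) +
    (L (S.radial T x)).curryLeft (S.radial T x) := rfl
  rw [e2, e3]
  module

end SplitSimplex

end FES

namespace FES

open ContinuousAlternatingMap Matrix

namespace SplitSimplex

variable {n : ℕ} {S : SplitSimplex n}

/-! ### Description of `A^k(T)` -/

theorem transverselyAffine_iff {T : Face n} {k : ℕ} {w : Vec n → Alt k (Vec n)}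
    {w' : S.real T → Alt k (Vec n)} (h : ∀ x : S.real T, w' x = w x) :
    S.TransverselyAffine T w' ↔ S.TransAffine T w := by
  refine forall₂_congr fun ξ _ => ⟨fun ⟨f, hf⟩ => ?_, fun ⟨c, L, hL⟩ => ?_⟩
  · refine ⟨f 0, LinearMap.toContinuousLinearMap f.linear, fun x hx => ?_⟩
    have h1 := f.map_vadd 0 x
    simp only [vadd_eq_add, add_zero] at h1
    beta_reduce
    rw [← h ⟨x, hx⟩, hf ⟨x, hx⟩, h1, add_comm]; rfl
  · refine ⟨AffineMap.const ℝ _ c + (L : Vec n →ₗ[ℝ] ℝ).toAffineMap, fun x => ?_⟩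
    rw [h]
    exact hL x x.2

theorem alternatizeUncurryFin_pull {T : Face n} {k : ℕ} (L : Vec n →L[ℝ] Alt k (Vec n)) :
    alternatizeUncurryFin (((compContinuousLinearMapCLM (F := ℝ) (ι := Fin k)
      (S.dir T).subtypeL).comp L).comp (S.dir T).subtypeL) =
      (alternatizeUncurryFin L).compContinuousLinearMap (S.dir T).subtypeL := by
  ext ξ
  rw [alternatizeUncurryFin_apply, compContinuousLinearMap_apply, alternatizeUncurryFin_apply]
  rfl

theorem DConst.closedAffine_pull {m : ℕ} {T : Face n} {k : ℕ} {w : Vec n → Alt k (Vec n)}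
    (hw : S.DConst m T w 0) : S.ClosedAffine m T (S.pull T fun x : S.real T => w x) := by
  intro σ hσ
  obtain ⟨c, L, h1, h2⟩ := hw σ hσ
  refine ⟨(c + L (S.inpoint T)).compContinuousLinearMap (S.dir T).subtypeL,
    ((compContinuousLinearMapCLM (F := ℝ) (ι := Fin k) (S.dir T).subtypeL).comp L).comp
      (S.dir T).subtypeL, fun x hx => ?_, ?_⟩
  · have e : (x : Vec n) = S.inpoint T + (S.radial T x : Vec n) := by simp [radial]
    change (w x).compContinuousLinearMap _ = _
    rw [h1 x hx]
    conv_lhs => rw [e, map_add, ← add_assoc]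
    rfl
  · rw [alternatizeUncurryFin_pull]
    ext ξ
    exact h2 _ fun j => (ξ j).2

/-- By general position, w on a cell is the pullback of w extended by the projection onto T, plus
the affine interpolation of the remaining parts β of the vertex values. As β vanishes on vectors
tangent to T, it does not contribute to the exterior derivative on T. -/
theorem dconst_of_closedAffine (H : S.IsTransversal) {m : ℕ} {T : Face n} {k : ℕ}
    {w : Vec n → Alt k (Vec n)} (hw : S.ClosedAffine m T (S.pull T fun x : S.real T => w x))
    (htr : S.TransAffine T w) : S.DConst m T w 0 := by
  intro σ hσ
  obtain ⟨c, L, h1, h2⟩ := hw σ hσ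
  set π := compContinuousLinearMapCLM (F := ℝ) (ι := Fin k) (proj H T) with hπ
  set β : Fin (n + 1) → Alt k (Vec n) := fun i => w (S.vertex i) -
    π ((w (S.vertex i)).compContinuousLinearMap (S.dir T).subtypeL) with hβ
  have hpd : ∀ ξ : Fin k → Vec n, (hξ : ∀ j, ξ j ∈ S.dir T) →
      (⇑(proj H T) ∘ ξ) = fun j => (⟨ξ j, hξ j⟩ : S.dir T) := fun ξ hξ =>
    funext fun j => Subtype.ext (proj_of_mem_dir H (hξ j))
  have hβd : ∀ i, ∀ ξ : Fin k → Vec n, (∀ j, ξ j ∈ S.dir T) → β i ξ = 0 := by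
    intro i ξ hξ
    simp only [hβ, hπ, ContinuousAlternatingMap.sub_apply,
      compContinuousLinearMapCLM_apply, compContinuousLinearMap_apply, hpd ξ hξ]
    exact sub_self _
  have hinterp : ∀ x, ∀ ξ : Fin k → Vec n, S.interp β x ξ = S.interp (fun i => β i ξ) x :=
    fun x ξ => by
      simp only [interp, ContinuousAlternatingMap.sum_apply, ContinuousAlternatingMap.smul_apply]
  refine ⟨π (c - L (proj H T (S.inpoint T))) + S.interp β 0,
    (π.comp L).comp (proj H T) + S.interpLinear β, fun x hx => ?_, fun ξ hξ => ?_⟩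
  · have hxT := S.cell_subset hσ hx
    have e : π (c - L (proj H T (S.inpoint T))) + S.interp β 0 +
        ((π.comp L).comp (proj H T) + S.interpLinear β) x =
        π (c + L (proj H T (x - S.inpoint T))) + S.interp β x := by
      rw [S.interp_eq β x, _root_.add_apply, ContinuousLinearMap.comp_apply,
        ContinuousLinearMap.comp_apply, map_sub, map_sub, map_add, map_sub, map_sub]
      abel
    have e2 : proj H T (x - S.inpoint T) = S.radial T ⟨x, hxT⟩ :=
      Subtype.ext (proj_of_mem_dir H (S.sub_mem_dir hxT (S.inpoint_mem_real T)))
    rw [e, e2, ← h1 ⟨x, hxT⟩ hx, ← sub_eq_zero]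
    refine form_eq_zero_of_transversal H T _ (fun ξ hξ => ?_) fun ξ hξ => ?_
    · rw [ContinuousAlternatingMap.sub_apply, ContinuousAlternatingMap.add_apply, hinterp]
      simp only [hβd _ ξ hξ]
      simp only [hπ, compContinuousLinearMapCLM_apply, compContinuousLinearMap_apply, hpd ξ hξ,
        pull]
      simp only [interp, smul_zero, Finset.sum_const_zero, add_zero]
      exact sub_self _
    · have h3 := S.affineFns_eq_interp (htr ξ hξ) hxT
      obtain ⟨j, hj⟩ := hξ
      have h0 : ∀ f : Alt k (S.dir T), π f ξ = 0 := fun f =>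
        f.map_coord_zero j (proj_of_mem_transverse H hj)
      rw [ContinuousAlternatingMap.sub_apply, ContinuousAlternatingMap.add_apply, hinterp, h0]
      simp only [hβ, ContinuousAlternatingMap.sub_apply, h0, sub_zero]
      rw [h3]; ring
  · rw [alternatizeUncurryFin_add, ContinuousAlternatingMap.add_apply, alt_zero_apply]
    have e1 : alternatizeUncurryFin ((π.comp L).comp (proj H T)) ξ = 0 := by
      have : alternatizeUncurryFin ((π.comp L).comp (proj H T)) ξ =
          alternatizeUncurryFin L fun j => proj H T (ξ j) := by
        rw [alternatizeUncurryFin_apply, alternatizeUncurryFin_apply]; rfl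
      rw [this, h2]; rfl
    have e2 : alternatizeUncurryFin (S.interpLinear β) ξ = 0 := by
      rw [alternatizeUncurryFin_apply]
      refine Finset.sum_eq_zero fun i _ => ?_
      have hz : ∀ l, S.dbary l (ξ i) • β l (i.removeNth ξ) = 0 := fun l => by
        rw [hβd l (i.removeNth ξ) fun j => hξ (i.succAbove j), smul_zero]
      rw [interpLinear_apply, ContinuousAlternatingMap.sum_apply]
      simp only [ContinuousAlternatingMap.smul_apply, hz, Finset.sum_const_zero, smul_zero]
    rw [e1, e2, add_zero]

theorem DConst.poincareTrace_eq {m k : ℕ} {T : Face n} {v : Vec n → Alt (k + 1) (Vec n)}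
    {θ : Alt (k + 2) (Vec n)} (hv : S.DConst m T v θ) (x : S.real T) :
    S.poincareTrace T (fun x : S.real T => v x) x = S.Q T v x := by
  rw [poincareTrace, S.poincareOn_eq]
  · rfl
  · intro t ht
    have := hv.segment le_rfl x.2 (1 - t) ⟨by linarith [ht.2], by linarith [ht.1]⟩
    rw [sub_sub_cancel] at this
    rw [← this]
    change v _ = v _
    congr 1
    module

theorem DConst.poincare_pull {m k : ℕ} {T : Face n} {v : Vec n → Alt (k + 1) (Vec n)}
    (hv : S.DConst m T v 0) :
    S.poincare T (S.pull T fun x : S.real T => v x) = S.pull T fun x : S.real T => S.Q T v x := by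
  ext1 x
  rw [poincare, S.poincareOn_eq _ _ _ (hv.closedAffine_pull.segment x)]
  ext ξ
  have e : ∀ f : Alt (k + 1) (Vec n), ((f.compContinuousLinearMap (S.dir T).subtypeL).curryLeft
      (S.radial T x)) ξ = f (vecCons ((x : Vec n) - S.inpoint T) fun j => (ξ j : Vec n)) := by
    intro f
    change f _ = f _
    congr 1
    ext1 j
    refine Fin.cases rfl (fun _ => rfl) j
  simp only [ContinuousAlternatingMap.add_apply, ContinuousAlternatingMap.smul_apply, pull, e]
  rfl

theorem continuous_iff {T : Face n} {E : Type} [TopologicalSpace E] {w : Vec n → E} :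
    Continuous (fun x : S.real T => w x) ↔ ContinuousOn w (S.real T) :=
  continuousOn_iff_continuous_domRestrict.symm

/-- On a full cell, the pullback of `v` is determined by that of `u`. -/
theorem extDeriv_unique {k : ℕ} {T : Face n} {u a : S.real T → Alt k (S.dir T)}
    {v b : S.real T → Alt (k + 1) (S.dir T)} (h : S.ExtDeriv (k - 1) T u v) (ha : a ∈ S.K k T)
    (hb : b ∈ S.K (k + 1) T) (hu : u = a + S.poincare T b) : v = b := by
  ext1 x
  obtain ⟨σ, hσ, hx⟩ := S.exists_mem_cell (k - 1) x.2
  obtain ⟨τ, hτ, hsub, hW, hfull⟩ := S.exists_full_cell hσ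
  obtain ⟨τ', hτ', hsub'⟩ := S.exists_coarser_cell_pred hτ
  obtain ⟨ca, La, ha1, ha2⟩ := (mem_K.1 ha).2 τ hτ
  obtain ⟨c, L, hL, hcL⟩ := (mem_K.1 hb).2.poincare_eq hτ'
  obtain ⟨q, ⟨r, hq⟩, hqu⟩ := h τ hτ
  have hd1 : Differentiable ℝ fun y => ca + La y := (isPolynomial_affine 1 le_rfl ca La).differentiable
  have hd2 := (isPolynomial_affinePrimitive c L).differentiable
  have key := extDeriv_eq_of_eqOn (S.uniqueDiffOn_cell hτ hW hfull) hq.differentiable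
    (hd1.fun_add hd2) (fun y hy => ?_) (y := S.radial T x) (by simpa [radial] using hsub hx)
  · rw [(hqu x (hsub hx)).2, key, extDeriv_fun_add (hd1 _) (hd2 _), extDeriv_affine, ha2,
      extDeriv_affinePrimitive c L hL, zero_add, (hcL x (hsub' (hsub hx))).1]
  · have e := inpoint_add_mem_real hτ hy
    have h1 := (hqu ⟨_, S.cell_subset hτ hy⟩ hy).1
    have h2 := ha1 ⟨_, S.cell_subset hτ hy⟩ hy
    have h3 := (hcL ⟨_, S.cell_subset hτ hy⟩ (hsub' hy)).2
    rw [e] at h1 h2 h3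
    rw [← h1, hu, Pi.add_apply, h2, h3]

theorem extDeriv_add_poincare {k : ℕ} {T : Face n} {a : S.real T → Alt k (S.dir T)}
    {b : S.real T → Alt (k + 1) (S.dir T)} (ha : a ∈ S.K k T) (hb : b ∈ S.K (k + 1) T) :
    S.ExtDeriv (k - 1) T (a + S.poincare T b) b := by
  intro σ hσ
  obtain ⟨τ', hτ', hsub'⟩ := S.exists_coarser_cell_pred hσ
  obtain ⟨ca, La, ha1, ha2⟩ := (mem_K.1 ha).2 σ hσ
  obtain ⟨c, L, hL, hcL⟩ := (mem_K.1 hb).2.poincare_eq hτ'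
  have hd1 : Differentiable ℝ fun y => ca + La y := (isPolynomial_affine 1 le_rfl ca La).differentiable
  have hd2 := (isPolynomial_affinePrimitive c L).differentiable
  refine ⟨fun y => ca + La y + affinePrimitive c L y, ⟨2, isPolynomial_add_affinePrimitive _ _ _ _⟩,
    fun x hx => ⟨?_, ?_⟩⟩
  · rw [Pi.add_apply, ha1 x hx, (hcL x (hsub' hx)).2]
  · rw [extDeriv_fun_add (hd1 _) (hd2 _), extDeriv_affine, ha2, extDeriv_affinePrimitive c L hL,
      zero_add, (hcL x (hsub' hx)).1]

theorem Z.pull_mem_K {k : ℕ} {T : Face n} {w : Vec n → Alt k (Vec n)} (hw : S.Z k T w) :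
    (S.pull T fun x : S.real T => w x) ∈ S.K k T :=
  mem_K.2 ⟨(compContinuousLinearMapCLM (F := ℝ) (ι := Fin k)
    (S.dir T).subtypeL).continuous.comp (continuous_iff.2 hw.cont), hw.dconst.closedAffine_pull⟩

theorem Z.mem_C0P {k m : ℕ} (hm : k - 1 = m) {T : Face n} {w : Vec n → Alt k (Vec n)}
    (hw : S.Z k T w) : (fun x : S.real T => w x) ∈ S.C0P 1 m T := by
  subst hm
  refine ⟨continuous_iff.2 hw.cont, fun σ hσ => ?_⟩
  obtain ⟨c, L, h, -⟩ := hw.dconst σ hσ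
  refine ⟨_, isPolynomial_affine 1 le_rfl (c + L (S.inpoint T)) (L.comp (S.dir T).subtypeL),
    fun x hx => ?_⟩
  have e : (x : Vec n) = S.inpoint T + (S.radial T x : Vec n) := by simp [radial]
  beta_reduce
  rw [h x hx]
  conv_lhs => rw [e, map_add, ← add_assoc]
  rfl

theorem Q_mem_C0P {k : ℕ} {T : Face n} {w : Vec n → Alt k (Vec n)} {v : Vec n → Alt (k + 1) (Vec n)}
    (hw : S.Z k T w) (hv : S.Z (k + 1) T v) :
    (fun x : S.real T => w x + S.Q T v x) ∈ S.C0P 2 (k - 1) T := by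
  refine ⟨(continuous_iff.2 hw.cont).add (continuous_iff.2 (continuousOn_Q hv.cont)),
    fun σ hσ => ?_⟩
  obtain ⟨τ, hτ, hsub⟩ := S.exists_coarser_cell_pred hσ
  obtain ⟨cw, Lw, hw1, -⟩ := hw.dconst σ hσ
  obtain ⟨c, L, h, -⟩ := hv.dconst τ hτ
  refine ⟨_, isPolynomial_quadratic (cw + Lw (S.inpoint T)) ((Lw +
      (1 / ((k + 1 : ℝ) * (k + 2))) • (v (S.inpoint T)).curryLeft +
      (1 / (k + 2 : ℝ)) • (c + L (S.inpoint T)).curryLeft).comp (S.dir T).subtypeL)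
    ((1 / (k + 2 : ℝ)) • ((((curryLeftLI (𝕜 := ℝ) (E := Vec n) (F := ℝ)
      (n := k)).toContinuousLinearMap.comp L).bilinearComp
        (S.dir T).subtypeL (S.dir T).subtypeL))), fun x hx => ?_⟩
  have e : (x : Vec n) = S.inpoint T + (S.radial T x : Vec n) := by simp [radial]
  have e1 : w x = cw + Lw (S.inpoint T) + Lw (S.radial T x) := by
    rw [hw1 x hx, add_assoc, ← map_add, ← e]
  have e2 : v x = c + L (S.inpoint T) + L (S.radial T x) := by
    rw [h x (hsub hx), add_assoc, ← map_add, ← e]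
  have e3 : (x : Vec n) - S.inpoint T = S.radial T x := rfl
  beta_reduce
  rw [Q, e1, e2, e3]
  simp only [contract_eq, _root_.add_apply, _root_.smul_apply, ContinuousLinearMap.comp_apply,
    ContinuousLinearMap.bilinearComp_apply]
  have e4 : (c + L (S.inpoint T) + L (S.radial T x)).curryLeft (S.radial T x : Vec n) =
    (c + L (S.inpoint T)).curryLeft (S.radial T x : Vec n) +
      (L (S.radial T x)).curryLeft (S.radial T x : Vec n) := rfl
  have e5 : (S.dir T).subtypeL (S.radial T x) = (S.radial T x : Vec n) := rfl
  rw [e4, smul_add, e5]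
  change _ = _ + (_ + _ + _) + (1 / (k + 2 : ℝ)) • (L (S.radial T x)).curryLeft (S.radial T x : Vec n)
  abel

/-- Elements of `A^k(T)` are the pairs `(w + P_T v, v)`, where `v` and `w` are closed and piecewise
affine. -/
theorem mem_A_iff (H : S.IsTransversal) {k : ℕ} {T : Face n} {u : Vec n → Alt k (Vec n)}
    {v : Vec n → Alt (k + 1) (Vec n)} :
    (fun x : S.real T => (u x, v x)) ∈ S.A k T ↔ S.Z k T (u - S.Q T v) ∧ S.Z (k + 1) T v := by
  constructor
  · rintro ⟨h1, h2, h3, ⟨a, ha, b, hb, hab⟩, h5, h6⟩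
    -- In the decomposition of the pullback of u given by M^k(T), the form b must be its exterior
    -- derivative, the pullback of v. Hence a is the pullback of u - Q_T v.
    obtain rfl := extDeriv_unique h3 ha hb hab
    have htv := (transverselyAffine_iff (w := v) fun x => rfl).1 h5
    have hv : S.Z (k + 1) T v := ⟨continuous_iff.1 h2.1,
      dconst_of_closedAffine H (mem_K.1 hb).2 htv, htv⟩
    have htw := (transverselyAffine_iff (w := u - S.Q T v) fun x => by
      rw [Pi.sub_apply, hv.dconst.poincareTrace_eq]; rfl).1 h6
    have haw : a = S.pull T fun x : S.real T => (u - S.Q T v) x := by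
      rw [hv.dconst.poincare_pull] at hab
      rw [eq_sub_of_add_eq hab.symm]; rfl
    exact ⟨⟨(continuous_iff.1 h1.1).sub (continuousOn_Q hv.cont),
      dconst_of_closedAffine H (haw ▸ (mem_K.1 ha).2) htw, htw⟩, hv⟩
  · rintro ⟨hw, hv⟩
    have e : (S.pull T fun x : S.real T => u x) = (S.pull T fun x : S.real T => (u - S.Q T v) x) +
        S.poincare T (S.pull T fun x : S.real T => v x) := by
      rw [hv.dconst.poincare_pull]
      ext1 x
      change (u x).compContinuousLinearMap _ = (u x - S.Q T v x).compContinuousLinearMap _ +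
        (S.Q T v x).compContinuousLinearMap _
      ext ξ
      simp
    refine ⟨?_, hv.mem_C0P rfl, ?_, ?_, (transverselyAffine_iff fun x => rfl).2 hv.trans,
      (transverselyAffine_iff fun x => ?_).2 hw.trans⟩
    · have := Q_mem_C0P hw hv
      simpa using this
    · have := extDeriv_add_poincare hw.pull_mem_K hv.pull_mem_K
      rwa [← e] at this
    · exact ⟨_, hw.pull_mem_K, _, hv.pull_mem_K, e⟩
    · rw [Pi.sub_apply, hv.dconst.poincareTrace_eq]; rfl

end SplitSimplex

end FES

namespace FES

open ContinuousAlternatingMap Matrix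

/-! ### Piecewise smooth functions are Lipschitz -/

section Lipschitz

variable {E F : Type} [NormedAddCommGroup E] [NormedSpace ℝ E] [NormedAddCommGroup F]

/-- Continuous induction along a segment. The set of parameters where the bound from x holds is
closed in [0, 1]. If t belongs to it, points just after t lie only in pieces that contain the point
at t, and the Lipschitz bound on such a piece carries the estimate further. -/
theorem lipschitzOnWith_of_cover {ι : Type} [Finite ι] {s : Set E} (hs : Convex ℝ s)
    {A : ι → Set E} (hA : ∀ i, IsClosed (A i)) (hcov : s ⊆ ⋃ i, A i) {f : E → F}
    (hf : ContinuousOn f s) {K : NNReal} (hK : ∀ i, LipschitzOnWith K f (s ∩ A i)) :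
    LipschitzOnWith K f s := by
  refine LipschitzOnWith.of_dist_le_mul fun x hx y hy => ?_
  set γ : ℝ → E := fun t => AffineMap.lineMap x y t with hγ
  have hγc : Continuous γ := AffineMap.lineMap_continuous
  have hγs : ∀ t ∈ Set.Icc (0 : ℝ) 1, γ t ∈ s := fun t ht => by
    rw [hγ]; exact hs.segment_subset hx hy (by
      rw [segment_eq_image_lineMap]; exact ⟨t, ht, rfl⟩)
  set P : Set ℝ := {t | dist (f (γ t)) (f x) ≤ K * (t * dist x y)} with hP
  have key : Set.Icc (0 : ℝ) 1 ⊆ P := by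
    refine IsClosed.Icc_subset_of_forall_exists_gt ?_ ?_ fun t ht z hz => ?_
    · have hc : ContinuousOn (fun t => f (γ t)) (Set.Icc 0 1) :=
        hf.comp hγc.continuousOn hγs
      have h1 : ContinuousOn (fun t => K * (t * dist x y) - dist (f (γ t)) (f x)) (Set.Icc 0 1) :=
        ContinuousOn.sub (by fun_prop) (continuous_id.dist continuous_const |>.comp_continuousOn hc)
      have := h1.preimage_isClosed_of_isClosed isClosed_Icc (isClosed_Ici (a := (0 : ℝ)))
      convert this using 1
      ext t
      simp [hP, and_comm]
    · simp [hP, hγ]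
    -- Finitely many closed pieces: those avoiding γ(t) are avoided by all nearby points of the
    -- path.
    · have hev : ∀ᶠ r in nhds t, ∀ i, γ t ∉ A i → γ r ∉ A i := by
        rw [Filter.eventually_all]
        intro i
        by_cases hi : γ t ∈ A i
        · simp [hi]
        · filter_upwards [hγc.continuousAt.preimage_mem_nhds ((hA i).isOpen_compl.mem_nhds hi)]
            with r hr _ using hr
      have hlt : t < min z 1 := lt_min hz ht.2.2
      obtain ⟨r, hr1, hr2⟩ := ((hev.filter_mono nhdsWithin_le_nhds).and
        (Ioc_mem_nhdsGT hlt)).exists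
      have hr01 : r ∈ Set.Icc (0 : ℝ) 1 :=
        ⟨ht.2.1.trans hr2.1.le, hr2.2.trans (min_le_right _ _)⟩
      have ht01 : t ∈ Set.Icc (0 : ℝ) 1 := ⟨ht.2.1, ht.2.2.le⟩
      obtain ⟨i, hi⟩ := Set.mem_iUnion.1 (hcov (hγs r hr01))
      have hti : γ t ∈ A i := by
        by_contra h
        exact hr1 i h hi
      refine ⟨r, ?_, hr2.1, hr2.2.trans (min_le_left _ _)⟩
      have h1 := (hK i).dist_le_mul _ ⟨hγs r hr01, hi⟩ _ ⟨hγs t ht01, hti⟩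
      have h2 : dist (γ r) (γ t) = (r - t) * dist x y := by
        rw [hγ, dist_lineMap_lineMap, Real.dist_eq, abs_of_pos (sub_pos.2 hr2.1)]
      have h3 : dist (f (γ t)) (f x) ≤ K * (t * dist x y) := ht.1
      rw [hP, Set.mem_ofPred_eq]
      calc dist (f (γ r)) (f x) ≤ dist (f (γ r)) (f (γ t)) + dist (f (γ t)) (f x) :=
            dist_triangle _ _ _
        _ ≤ K * ((r - t) * dist x y) + K * (t * dist x y) := add_le_add (h2 ▸ h1) h3
        _ = _ := by ring
  have h1 := key ⟨zero_le_one, le_rfl⟩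
  simpa [hP, hγ, dist_comm] using h1

theorem exists_lipschitzOnWith_of_cover [NormedSpace ℝ F] {s : Set E} (hs : Convex ℝ s) (hsc : IsCompact s)
    {𝒜 : Set (Set E)} (hfin : 𝒜.Finite) (hA : ∀ A ∈ 𝒜, IsClosed A) (hcov : s ⊆ ⋃₀ 𝒜) {f : E → F}
    (hf : ContinuousOn f s)
    (hp : ∀ A ∈ 𝒜, ∃ q : E → F, ContDiff ℝ 1 q ∧ ∀ x ∈ s ∩ A, f x = q x) :
    ∃ K, LipschitzOnWith K f s := by
  have := hfin.to_subtype
  have hK : ∀ A : 𝒜, ∃ K, LipschitzOnWith K f (s ∩ A) := by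
    rintro ⟨A, hAm⟩
    obtain ⟨q, hq, hfq⟩ := hp A hAm
    obtain ⟨K, hK⟩ := (hq.locallyLipschitz.locallyLipschitzOn
      (s := s ∩ A)).exists_lipschitzOnWith_of_compact (hsc.inter_right (hA A hAm))
    exact ⟨K, fun x hx y hy => by rw [hfq x hx, hfq y hy]; exact hK hx hy⟩
  choose K hK using hK
  cases nonempty_fintype 𝒜
  refine ⟨∑ i, K i, lipschitzOnWith_of_cover (A := fun A : 𝒜 => A.1) hs (fun A => hA _ A.2)
    (by rwa [Set.sUnion_eq_iUnion] at hcov) hf fun i => (hK i).weaken ?_⟩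
  exact Finset.single_le_sum (f := K) (fun _ _ => zero_le) (Finset.mem_univ i)

end Lipschitz

/-! ### Integration on the standard simplex -/

/-- The standard simplex. -/
def stdSimp (k : ℕ) : Set (Fin k → ℝ) := {t | (∀ j, 0 ≤ t j) ∧ ∑ j, t j ≤ 1}

theorem isClosed_stdSimp (k : ℕ) : IsClosed (stdSimp k) := by
  have h1 : IsClosed {t : Fin k → ℝ | ∀ j, 0 ≤ t j} := by
    rw [Set.ofPred_forall]
    exact isClosed_iInter fun j => isClosed_le continuous_const (continuous_apply j)
  exact h1.inter (isClosed_le (continuous_finsetSum _ fun j _ => continuous_apply j)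
    continuous_const)

theorem stdSimp_le_one {k : ℕ} {t : Fin k → ℝ} (ht : t ∈ stdSimp k) (j : Fin k) : t j ≤ 1 :=
  (Finset.single_le_sum (fun i _ => ht.1 i) (Finset.mem_univ j)).trans ht.2

theorem isCompact_stdSimp (k : ℕ) : IsCompact (stdSimp k) := by
  refine (isCompact_Icc (a := (0 : Fin k → ℝ)) (b := 1)).of_isClosed_subset (isClosed_stdSimp k) ?_
  exact fun t ht => ⟨ht.1, stdSimp_le_one ht⟩

theorem convex_stdSimp (k : ℕ) : Convex ℝ (stdSimp k) := by
  intro x hx y hy a b ha hb hab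
  refine ⟨fun j => add_nonneg (mul_nonneg ha (hx.1 j)) (mul_nonneg hb (hy.1 j)), ?_⟩
  have : ∑ j, (a • x + b • y) j = a * ∑ j, x j + b * ∑ j, y j := by
    simp [Finset.sum_add_distrib, Finset.mul_sum]
  rw [this]
  nlinarith [hx.2, hy.2]

theorem insertNth_mem_stdSimp {k : ℕ} {j : Fin (k + 1)} {s : ℝ} {r : Fin k → ℝ} :
    j.insertNth (α := fun _ => ℝ) s r ∈ stdSimp (k + 1) ↔
      r ∈ stdSimp k ∧ s ∈ Set.Icc 0 (1 - ∑ i, r i) := by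
  simp only [stdSimp, Set.mem_ofPred_eq, Fin.forall_iff_succAbove j, Fin.insertNth_apply_same,
    Fin.insertNth_apply_succAbove, Fin.sum_univ_succAbove _ j, Set.mem_Icc]
  constructor
  · rintro ⟨⟨h1, h2⟩, h3⟩
    exact ⟨⟨h2, by linarith⟩, h1, by linarith⟩
  · rintro ⟨⟨h1, h2⟩, h3, h4⟩
    exact ⟨⟨h3, h1⟩, by linarith⟩

theorem integral_stdSimp_succ {k : ℕ} (j : Fin (k + 1)) {g : (Fin (k + 1) → ℝ) → ℝ}
    (hg : IntegrableOn g (stdSimp (k + 1))) :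
    ∫ t in stdSimp (k + 1), g t =
      ∫ r in stdSimp k, ∫ s in (0 : ℝ)..(1 - ∑ i, r i), g (j.insertNth (α := fun _ => ℝ) s r) := by
  have hm := volume_preserving_piFinSuccAbove (fun _ : Fin (k + 1) => ℝ) j
  have hmeas := (isClosed_stdSimp (k + 1)).measurableSet
  have h1 : Integrable ((stdSimp (k + 1)).indicator g) := (integrable_indicator_iff hmeas).2 hg
  rw [← integral_indicator hmeas, ← hm.symm.integral_comp' , Measure.volume_eq_prod,
    integral_prod_symm, ← integral_indicator (isClosed_stdSimp k).measurableSet]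
  · refine integral_congr_ae (Filter.Eventually.of_forall fun r => ?_)
    simp only
    have e : ∀ s, (stdSimp (k + 1)).indicator g
        ((MeasurableEquiv.piFinSuccAbove (fun _ => ℝ) j).symm (s, r)) =
        (stdSimp k).indicator (fun r => (Set.Icc 0 (1 - ∑ i, r i)).indicator
          (fun s => g (j.insertNth (α := fun _ => ℝ) s r)) s) r := by
      intro s
      change (stdSimp (k + 1)).indicator g (j.insertNth (α := fun _ => ℝ) s r) = _
      by_cases hr : r ∈ stdSimp k
      · by_cases hs : s ∈ Set.Icc 0 (1 - ∑ i, r i)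
        · rw [Set.indicator_of_mem (insertNth_mem_stdSimp.2 ⟨hr, hs⟩), Set.indicator_of_mem hr,
            Set.indicator_of_mem hs]
        · rw [Set.indicator_of_notMem fun h => hs (insertNth_mem_stdSimp.1 h).2,
            Set.indicator_of_mem hr, Set.indicator_of_notMem hs]
      · rw [Set.indicator_of_notMem fun h => hr (insertNth_mem_stdSimp.1 h).1,
          Set.indicator_of_notMem hr]
    simp only [e]
    by_cases hr : r ∈ stdSimp k
    · simp only [Set.indicator_of_mem hr]
      rw [integral_indicator measurableSet_Icc, integral_Icc_eq_integral_Ioc,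
        intervalIntegral.integral_of_le (by linarith [hr.2])]
    · simp only [Set.indicator_of_notMem hr, integral_zero]
  · have := hm.symm.integrable_comp_emb (MeasurableEquiv.measurableEmbedding _) (g := (stdSimp (k + 1)).indicator g)
    exact this.2 h1

theorem insertNth_add_single {k : ℕ} (j : Fin (k + 1)) (s h : ℝ) (r : Fin k → ℝ) :
    j.insertNth (α := fun _ => ℝ) s r + h • Pi.single j 1 =
      j.insertNth (α := fun _ => ℝ) (s + h) r := by
  ext i
  refine Fin.succAboveCases j ?_ (fun i => ?_) i
  · simp
  · simp

theorem lineDeriv_insertNth {k : ℕ} (j : Fin (k + 1)) (φ : (Fin (k + 1) → ℝ) → ℝ) (s : ℝ)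
    (r : Fin k → ℝ) :
    lineDeriv ℝ φ (j.insertNth (α := fun _ => ℝ) s r) (Pi.single j 1) =
      deriv (fun s => φ (j.insertNth (α := fun _ => ℝ) s r)) s := by
  simp only [lineDeriv, insertNth_add_single]
  rw [deriv_comp_const_add (f := fun s => φ (j.insertNth (α := fun _ => ℝ) s r)), add_zero]

/-- The fundamental theorem of calculus, integrated over the standard simplex. -/
theorem integral_lineDeriv_stdSimp {k : ℕ} (j : Fin (k + 1)) {φ : (Fin (k + 1) → ℝ) → ℝ}
    {K : NNReal} (hφ : LipschitzWith K φ) :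
    IntegrableOn (fun t => lineDeriv ℝ φ t (Pi.single j 1)) (stdSimp (k + 1)) ∧
    ∫ t in stdSimp (k + 1), lineDeriv ℝ φ t (Pi.single j 1) =
      (∫ r in stdSimp k, φ (j.insertNth (α := fun _ => ℝ) (1 - ∑ i, r i) r)) -
        ∫ r in stdSimp k, φ (j.insertNth (α := fun _ => ℝ) 0 r) := by
  have hint : IntegrableOn (fun t => lineDeriv ℝ φ t (Pi.single j 1)) (stdSimp (k + 1)) := by
    refine Measure.integrableOn_of_bounded (M := K * ‖(Pi.single j 1 : Fin (k + 1) → ℝ)‖)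
      (isCompact_stdSimp (k + 1)).measure_lt_top.ne
      (measurable_lineDeriv hφ.continuous).aestronglyMeasurable
      (Filter.Eventually.of_forall fun t => norm_lineDeriv_le_of_lipschitz ℝ hφ)
  have hc : ∀ c : (Fin k → ℝ) → ℝ, Continuous c → IntegrableOn
      (fun r => φ (j.insertNth (α := fun _ => ℝ) (c r) r)) (stdSimp k) := fun c hc =>
    ContinuousOn.integrableOn_compact (isCompact_stdSimp k) (hφ.continuous.comp
      (hc.finInsertNth j continuous_id)).continuousOn
  refine ⟨hint, ?_⟩
  rw [integral_stdSimp_succ j hint, ← integral_sub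
    (hc (fun r => 1 - ∑ i, r i) (by fun_prop)) (hc (fun _ => 0) continuous_const)]
  refine setIntegral_congr_fun (isClosed_stdSimp k).measurableSet fun r hr => ?_
  simp only [lineDeriv_insertNth]
  -- On each slice φ is Lipschitz, hence absolutely continuous, which is enough for the fundamental
  -- theorem of calculus.
  refine AbsolutelyContinuousOnInterval.integral_deriv_eq_sub
    (LipschitzOnWith.absolutelyContinuousOnInterval (K := K) ?_)
  refine LipschitzWith.lipschitzOnWith (LipschitzWith.of_dist_le_mul fun a b => ?_)
  refine (hφ.dist_le_mul _ _).trans (mul_le_mul_of_nonneg_left ?_ K.2)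
  refine (dist_pi_le_iff dist_nonneg).2 fun i => ?_
  refine Fin.succAboveCases j ?_ (fun i => ?_) i <;> simp

/-- The reflection exchanging a coordinate with the complement to one of the sum of all of them. -/
def reflect {k : ℕ} (j : Fin k) : (Fin k → ℝ) →ₗ[ℝ] (Fin k → ℝ) :=
  LinearMap.id - (LinearMap.toSpanSingleton ℝ (Fin k → ℝ) (Pi.single j 1)) ∘ₗ
    (LinearMap.proj (R := ℝ) (φ := fun _ => ℝ) j + ∑ i : Fin k, LinearMap.proj (R := ℝ) (φ := fun _ => ℝ) i)

theorem reflect_apply {k : ℕ} (j : Fin k) (t : Fin k → ℝ) :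
    reflect j t = t - (t j + ∑ i, t i) • Pi.single j 1 := by
  simp [reflect]

theorem reflect_comp_self {k : ℕ} (j : Fin k) : reflect j ∘ₗ reflect j = LinearMap.id := by
  ext1 i
  ext1
  simp only [LinearMap.comp_apply, LinearMap.id_apply, reflect_apply]
  ext l
  simp only [Pi.sub_apply, Pi.smul_apply, smul_eq_mul, Finset.sum_sub_distrib, ← Finset.mul_sum,
    Pi.single_eq_same, Finset.sum_pi_single', Finset.mem_univ, if_true, mul_one]
  ring

/-- The map replaces r_j by 1 - ∑ r_i. Its linear part is an involution, so it preserves the volume,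
and it maps the simplex onto itself. -/
theorem integral_stdSimp_reflect {k : ℕ} (j : Fin k) (g : (Fin k → ℝ) → ℝ) :
    ∫ r in stdSimp k, g (reflect j r + Pi.single j 1) = ∫ r in stdSimp k, g r := by
  have hdet : |LinearMap.det (reflect j)| = 1 := by
    have h := congrArg LinearMap.det (reflect_comp_self j)
    rw [LinearMap.det_comp, LinearMap.det_id] at h
    rcases mul_self_eq_one_iff.1 h with h | h <;> rw [h] <;> simp
  have hne : LinearMap.det (reflect j) ≠ 0 := fun h => by rw [h] at hdet; simp at hdet
  have hm : MeasurePreserving (reflect j) := by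
    refine ⟨(LinearMap.continuous_of_finiteDimensional _).measurable, ?_⟩
    rw [Real.map_linearMap_volume_pi_eq_smul_volume_pi hne, abs_inv, hdet]
    simp
  have hm2 : MeasurePreserving (fun r : Fin k → ℝ => reflect j r + Pi.single j 1) :=
    (measurePreserving_add_right volume (Pi.single j (1 : ℝ) : Fin k → ℝ)).comp hm
  have hemb : MeasurableEmbedding fun r : Fin k → ℝ => reflect j r + Pi.single j 1 := by
    refine MeasurableEmbedding.comp (measurableEmbedding_addRight _)
      (Continuous.measurableEmbedding (LinearMap.continuous_of_finiteDimensional _) ?_)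
    intro a b hab
    have := congrArg (reflect j) hab
    rwa [← LinearMap.comp_apply, ← LinearMap.comp_apply, reflect_comp_self] at this
  have hpre : (fun r : Fin k → ℝ => reflect j r + Pi.single j 1) ⁻¹' stdSimp k = stdSimp k := by
    ext r
    have hs : ∑ i, (reflect j r + Pi.single j 1 : Fin k → ℝ) i = 1 - r j := by
      simp only [reflect_apply, Pi.add_apply, Pi.sub_apply, Pi.smul_apply, smul_eq_mul,
        Finset.sum_add_distrib, Finset.sum_sub_distrib, ← Finset.mul_sum,
        Finset.sum_pi_single', Finset.mem_univ, if_true, mul_one]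
      ring
    have hj : (reflect j r + Pi.single j 1 : Fin k → ℝ) j = 1 - ∑ i, r i := by
      simp [reflect_apply, ← sub_eq_neg_add]
    have ho : ∀ i, i ≠ j → (reflect j r + Pi.single j 1 : Fin k → ℝ) i = r i := fun i hi => by
      simp [reflect_apply, Pi.single_eq_of_ne hi]
    simp only [Set.mem_preimage, stdSimp, Set.mem_ofPred_eq, hs]
    constructor
    · rintro ⟨h1, h2⟩
      refine ⟨fun i => ?_, by linarith [h1 j, hj]⟩
      by_cases hi : i = j
      · rw [hi]; linarith
      · rw [← ho i hi]; exact h1 i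
    · rintro ⟨h1, h2⟩
      refine ⟨fun i => ?_, by linarith [h1 j]⟩
      by_cases hi : i = j
      · rw [hi, hj]; linarith
      · rw [ho i hi]; exact h1 i
  conv_lhs => rw [← hpre]
  exact hm2.setIntegral_preimage_emb hemb g _

/-- The slanted facet ∑ t_i = 1 is parametrized by omitting one coordinate. Omitting consecutive
coordinates gives parametrizations related by a reflection. -/
theorem integral_face_eq {k : ℕ} (φ : (Fin (k + 1) → ℝ) → ℝ) (j : Fin (k + 1)) :
    ∫ r in stdSimp k, φ (j.insertNth (α := fun _ => ℝ) (1 - ∑ i, r i) r) =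
      ∫ r in stdSimp k, φ ((0 : Fin (k + 1)).insertNth (α := fun _ => ℝ) (1 - ∑ i, r i) r) := by
  induction j using Fin.induction with
  | zero => rfl
  | succ j ih =>
    rw [← ih, ← integral_stdSimp_reflect j]
    congr 1
    ext r
    congr 1
    have hs : ∑ i, (reflect j r + Pi.single j 1 : Fin k → ℝ) i = 1 - r j := by
      simp only [reflect_apply, Pi.add_apply, Pi.sub_apply, Pi.smul_apply, smul_eq_mul,
        Finset.sum_add_distrib, Finset.sum_sub_distrib, ← Finset.mul_sum,
        Finset.sum_pi_single', Finset.mem_univ, if_true, mul_one]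
      ring
    rw [hs]
    ext i
    refine Fin.succAboveCases j.succ ?_ (fun i => ?_) i
    · have e : j.succ = j.castSucc.succAbove j := by simp
      rw [Fin.insertNth_apply_same, e, Fin.insertNth_apply_succAbove]
      ring
    · rw [Fin.insertNth_apply_succAbove]
      by_cases hi : i = j
      · subst hi
        simp [reflect_apply, ← sub_eq_neg_add]
      · have e : j.succ.succAbove i = j.castSucc.succAbove i := by
          have hi' : (i : ℕ) ≠ j := fun h => hi (Fin.ext h)
          ext
          simp only [Fin.succAbove, Fin.lt_def, Fin.val_castSucc, Fin.val_succ]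
          split_ifs <;> simp <;> omega
        rw [e, Fin.insertNth_apply_succAbove]
        simp [reflect_apply, Pi.single_eq_of_ne hi]

end FES

namespace FES

open ContinuousAlternatingMap Matrix

/-! ### Stokes' formula on a simplex -/

section Stokes

variable {E : Type} [NormedAddCommGroup E]

/-- The edges of a simplex issued from its first vertex. -/
def edges {k : ℕ} (V : Fin (k + 1) → E) (j : Fin k) : E := V j.succ - V 0

theorem edges_facet_succ {k : ℕ} (V : Fin (k + 2) → E) (j : Fin (k + 1)) :
    edges (V ∘ Fin.succAbove j.succ) = j.removeNth (edges V) := by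
  ext1 i
  simp [edges, Fin.removeNth]

variable [NormedSpace ℝ E]

/-- The affine parametrization of the simplex with given vertices. -/
def chart {k : ℕ} (V : Fin (k + 1) → E) (t : Fin k → ℝ) : E := V 0 + ∑ j, t j • (V j.succ - V 0)

/-- The integral of a form on the simplex with given vertices. -/
def simplexIntegral {k : ℕ} (V : Fin (k + 1) → E) (u : E → Alt k E) : ℝ :=
  ∫ t in stdSimp k, u (chart V t) (edges V)

theorem continuous_chart {k : ℕ} (V : Fin (k + 1) → E) : Continuous (chart V) := by
  unfold chart; fun_prop

theorem chart_facet_zero {k : ℕ} (V : Fin (k + 2) → E) (r : Fin k → ℝ) :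
    chart (V ∘ Fin.succAbove 0) r =
      chart V ((0 : Fin (k + 1)).insertNth (α := fun _ => ℝ) (1 - ∑ i, r i) r) := by
  rw [chart, chart, Fin.sum_univ_succ]
  have : ∀ i : Fin k, r i • (V i.succ.succ - V (Fin.succ 0)) =
      r i • (V i.succ.succ - V 0) - r i • (V (Fin.succ 0) - V 0) := fun i => by module
  simp only [Function.comp_apply, Fin.succAbove_zero, Fin.insertNth_zero', Fin.cons_zero,
    Fin.cons_succ, this, Finset.sum_sub_distrib, ← Finset.sum_smul]
  module

theorem chart_facet_succ {k : ℕ} (V : Fin (k + 2) → E) (j : Fin (k + 1)) (r : Fin k → ℝ) :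
    chart (V ∘ Fin.succAbove j.succ) r = chart V (j.insertNth (α := fun _ => ℝ) 0 r) := by
  rw [chart, chart, Fin.sum_univ_succAbove _ j]
  simp

/-- The boundary of the image of the standard simplex, on constant forms. -/
theorem map_sub_zero_eq_sum {k : ℕ} (f : Alt k E) (h : Fin (k + 1) → E) :
    f (fun i => h i.succ - h 0) = ∑ j : Fin (k + 1), (-1 : ℝ) ^ (j : ℕ) * f (j.removeNth h) := by
  induction k with
  | zero => simp [Subsingleton.elim (fun i : Fin 0 => h i.succ - h 0) ((0 : Fin 1).removeNth h)]
  | succ k ih =>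
    have hneg : ∀ (x y : E) (ξ : Fin k → E),
        f (vecCons (x - y) ξ) = f (vecCons x ξ) - f (vecCons y ξ) := fun x y ξ => by
      have := map_vecCons_smul f (-1) y ξ
      rw [sub_eq_add_neg, map_vecCons_add, ← neg_one_smul ℝ y, this]; ring
    -- Contracting by h_1 - h_0 leaves the differences of the shorter family h_0, h_2, h_3, …, to
    -- which the induction hypothesis applies.
    set h' : Fin (k + 1) → E := vecCons (h 0) fun i => h i.succ.succ with hh'
    have e1 : (fun i : Fin (k + 1) => h i.succ - h 0) =
        vecCons (h 1 - h 0) fun i => h' i.succ - h' 0 := by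
      ext1 i
      refine Fin.cases ?_ (fun i => ?_) i <;> simp [hh']
    have h0 : (0 : Fin (k + 1)).removeNth h' = fun i => h i.succ.succ := by
      ext1 l; simp [hh', Fin.removeNth]
    have h00 : (0 : Fin (k + 2)).removeNth h = vecCons (h 1) fun i => h i.succ.succ := by
      ext1 l
      refine Fin.cases ?_ (fun l => ?_) l <;> simp [Fin.removeNth]
    have h01 : (Fin.succ 0 : Fin (k + 2)).removeNth h = vecCons (h 0) fun i => h i.succ.succ := by
      ext1 l
      refine Fin.cases ?_ (fun l => ?_) l <;> simp [Fin.removeNth]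
    have hs : ∀ i : Fin k, f (vecCons (h 1 - h 0) (i.succ.removeNth h')) =
        -f (i.succ.succ.removeNth h) := fun i => by
      cases k with
      | zero => exact i.elim0
      | succ k =>
        have hr : i.succ.removeNth h' =
            vecCons (h 0) (i.removeNth fun i : Fin (k + 1) => h i.succ.succ) := by
          ext1 l
          refine Fin.cases ?_ (fun l => ?_) l <;> simp [hh', Fin.removeNth]
        have hr2 : i.succ.succ.removeNth h =
            vecCons (h 0) (vecCons (h 1) (i.removeNth fun i : Fin (k + 1) => h i.succ.succ)) := by
          ext1 l
          refine Fin.cases ?_ (fun l => ?_) l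
          · simp [Fin.removeNth]
          · refine Fin.cases ?_ (fun l => ?_) l <;> simp [Fin.removeNth]
        rw [hr, hr2, hneg, map_vecCons_same, sub_zero, map_vecCons_swap]
    rw [e1, ← contract_apply, ih, Fin.sum_univ_succ, Fin.sum_univ_succ (n := k + 1),
      Fin.sum_univ_succ (n := k)]
    simp only [contract_apply, h0, h00, h01, hs, hneg, Fin.val_succ, pow_succ, Fin.val_zero,
      pow_zero, mul_neg, mul_one, neg_mul, one_mul, neg_neg]
    ring

/-- The fundamental theorem of calculus in the direction j produces the facet t_j = 0, opposite to
vertex j + 1, and the slanted facet. The slanted terms for the different j, brought to the same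
parametrization, add up by `map_sub_zero_eq_sum` to the integral on the facet opposite to vertex 0.
Lipschitz regularity suffices, the formula for v being needed almost everywhere only. -/
theorem stokes_chart {k : ℕ} (V : Fin (k + 2) → E) {u : E → Alt k E} {v : E → Alt (k + 1) E}
    (hu : ∀ ξ, ∃ K, LipschitzOnWith K (fun t => u (chart V t) ξ) (stdSimp (k + 1)))
    (hv : ∀ᵐ t, t ∈ interior (stdSimp (k + 1)) → v (chart V t) (edges V) =
      ∑ j : Fin (k + 1), (-1 : ℝ) ^ (j : ℕ) *
        lineDeriv ℝ (fun t => u (chart V t) (j.removeNth (edges V))) t (Pi.single j 1)) :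
    simplexIntegral V v =
      ∑ i : Fin (k + 2), (-1 : ℝ) ^ (i : ℕ) * simplexIntegral (V ∘ i.succAbove) u := by
  choose K hK using fun j : Fin (k + 1) => hu (j.removeNth (edges V))
  choose φ hφ hφu using fun j => (hK j).extend_real
  have hmeas := (isClosed_stdSimp (k + 1)).measurableSet
  have hmeas' := (isClosed_stdSimp k).measurableSet
  have hint : ∀ (j : Fin (k + 1)) (c : (Fin k → ℝ) → ℝ) (i : Fin (k + 1)), Continuous c →
      IntegrableOn (fun r => φ j (i.insertNth (α := fun _ => ℝ) (c r) r)) (stdSimp k) :=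
    fun j c i hc => ContinuousOn.integrableOn_compact (isCompact_stdSimp k)
      ((hφ j).continuous.comp (hc.finInsertNth i continuous_id)).continuousOn
  have h1 : simplexIntegral V v = ∫ t in stdSimp (k + 1), ∑ j : Fin (k + 1),
      (-1 : ℝ) ^ (j : ℕ) * lineDeriv ℝ (φ j) t (Pi.single j 1) := by
    refine setIntegral_congr_ae hmeas ?_
    have hfr := measure_eq_zero_iff_ae_notMem.1
      ((convex_stdSimp (k + 1)).addHaar_frontier volume)
    filter_upwards [hv, hfr] with t ht ht' hts
    have hti : t ∈ interior (stdSimp (k + 1)) := by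
      by_contra h
      exact ht' ⟨subset_closure hts, h⟩
    rw [ht hti]
    refine Finset.sum_congr rfl fun j _ => ?_
    congr 1
    refine Filter.EventuallyEq.lineDeriv_eq ?_
    filter_upwards [mem_interior_iff_mem_nhds.1 hti] with s hs using hφu j hs
  rw [h1, integral_finsetSum _ fun j _ => (integral_lineDeriv_stdSimp j (hφ j)).1.const_mul _,
    Fin.sum_univ_succ (n := k + 1)]
  have h2 : simplexIntegral (V ∘ Fin.succAbove 0) u = ∑ j : Fin (k + 1), (-1 : ℝ) ^ (j : ℕ) *
      ∫ r in stdSimp k, φ j (j.insertNth (α := fun _ => ℝ) (1 - ∑ i, r i) r) := by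
    simp only [integral_face_eq, ← integral_const_mul]
    rw [← integral_finsetSum _ fun j _ => (hint j (fun r => 1 - ∑ i, r i) 0 (by fun_prop)).const_mul _]
    refine setIntegral_congr_fun hmeas' fun r hr => ?_
    have e : edges (V ∘ Fin.succAbove 0) = fun i : Fin k => edges V i.succ - edges V 0 := by
      ext1 i
      simp [edges]
    have hmem : (0 : Fin (k + 1)).insertNth (α := fun _ => ℝ) (1 - ∑ i, r i) r ∈
        stdSimp (k + 1) := insertNth_mem_stdSimp.2 ⟨hr, by linarith [hr.2], le_rfl⟩
    rw [e, map_sub_zero_eq_sum, chart_facet_zero]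
    exact Finset.sum_congr rfl fun j _ => by rw [← hφu j hmem]
  have h3 : ∀ j : Fin (k + 1), simplexIntegral (V ∘ Fin.succAbove j.succ) u =
      ∫ r in stdSimp k, φ j (j.insertNth (α := fun _ => ℝ) 0 r) := by
    intro j
    refine setIntegral_congr_fun hmeas' fun r hr => ?_
    have hmem : j.insertNth (α := fun _ => ℝ) 0 r ∈ stdSimp (k + 1) :=
      insertNth_mem_stdSimp.2 ⟨hr, le_rfl, by linarith [hr.2]⟩
    rw [edges_facet_succ, chart_facet_succ, ← hφu j hmem]
  rw [h2]
  simp only [h3, integral_const_mul, (integral_lineDeriv_stdSimp _ (hφ _)).2, Fin.val_zero,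
    pow_zero, one_mul, Fin.val_succ, pow_succ, mul_sub, Finset.sum_sub_distrib]
  rw [sub_eq_add_neg, ← Finset.sum_neg_distrib]
  congr 1
  exact Finset.sum_congr rfl fun j _ => by ring

end Stokes

end FES

namespace FES

open ContinuousAlternatingMap Matrix

theorem chart_mem_of_convex {E : Type} [NormedAddCommGroup E] [NormedSpace ℝ E] {s : Set E}
    (hs : Convex ℝ s) {k : ℕ} {V : Fin (k + 1) → E} (hV : ∀ i, V i ∈ s) {t : Fin k → ℝ}
    (ht : t ∈ stdSimp k) : chart V t ∈ s := by
  have := hs.sum_mem (t := Finset.univ) (w := vecCons (1 - ∑ j, t j) t)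
    (z := V) (fun i _ => ?_) (by simp [Fin.sum_univ_succ]) fun i _ => hV i
  · rw [Fin.sum_univ_succ] at this
    convert this using 1
    simp only [chart, cons_val_zero, cons_val_succ, smul_sub, Finset.sum_sub_distrib, sub_smul,
      one_smul, Finset.sum_smul]
    abel
  · refine Fin.cases ?_ (fun j => ?_) i
    · simpa using ht.2
    · simpa using ht.1 j

theorem extDeriv_comp {X D : Type} [NormedAddCommGroup X] [NormedSpace ℝ X] [NormedAddCommGroup D]
    [NormedSpace ℝ D] {k : ℕ} {q : D → Alt k D} {c : X → D} {t : X}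
    (hq : DifferentiableAt ℝ q (c t)) {a : Fin (k + 1) → X} {e : Fin (k + 1) → D}
    (hc : ∀ j (s : ℝ), c (t + s • a j) = c t + s • e j) {φ : Fin (k + 1) → X → ℝ}
    (hφ : ∀ j, φ j =ᶠ[nhds t] fun s => q (c s) (j.removeNth e)) :
    extDeriv q (c t) e = ∑ j : Fin (k + 1), (-1 : ℝ) ^ (j : ℕ) * lineDeriv ℝ (φ j) t (a j) := by
  rw [extDeriv, alternatizeUncurryFin_apply]
  refine Finset.sum_congr rfl fun j _ => ?_
  have h1 : HasFDerivAt (fun y => q y (j.removeNth e))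
      ((ContinuousAlternatingMap.apply ℝ D ℝ (j.removeNth e)).comp (fderiv ℝ q (c t))) (c t) :=
    (ContinuousAlternatingMap.apply ℝ D ℝ (j.removeNth e)).hasFDerivAt.comp _ hq.hasFDerivAt
  have h2 := (h1.hasLineDerivAt (e j)).lineDeriv
  rw [(hφ j).lineDeriv_eq]
  have h3 : lineDeriv ℝ (fun s => q (c s) (j.removeNth e)) t (a j) =
      lineDeriv ℝ (fun y => q y (j.removeNth e)) (c t) (e j) := by
    simp only [lineDeriv, hc]
  rw [h3, h2, zsmul_eq_mul]
  push_cast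
  rfl

namespace SplitSimplex

variable {n : ℕ} (S : SplitSimplex n)

/-! ### Stokes' formula for the finite element spaces -/

/-- The ordered vertices of a face. -/
def verts (T : Face n) {k : ℕ} (h : T.1.card = k + 1) (i : Fin (k + 1)) : Vec n :=
  S.vertex (T.1.orderEmbOfFin h i)

theorem verts_facet (T : Face n) {k : ℕ} (h : T.1.card = k + 2) (i : Fin (k + 2)) :
    S.verts (T.facet h i) (T.facet_card h i) = S.verts T h ∘ i.succAbove := by
  ext1 j
  have := Finset.orderEmbOfFin_unique (T.facet_card h i)
    (f := fun j => T.1.orderEmbOfFin h (i.succAbove j)) (fun j => ?_)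
    ((T.1.orderEmbOfFin h).strictMono.comp (Fin.strictMono_succAbove i))
  · rw [verts, ← this]; rfl
  · refine Finset.mem_erase.2 ⟨fun hj => Fin.succAbove_ne i j ?_, Finset.orderEmbOfFin_mem _ _ _⟩
    exact (T.1.orderEmbOfFin h).injective hj

theorem verts_mem_real (T : Face n) {k : ℕ} (h : T.1.card = k + 1) (i : Fin (k + 1)) :
    S.verts T h i ∈ S.real T :=
  S.vertex_mem_real (Finset.orderEmbOfFin_mem _ _ _)

theorem chart_verts_mem (T : Face n) {k : ℕ} (h : T.1.card = k + 1) {t : Fin k → ℝ}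
    (ht : t ∈ stdSimp k) : chart (S.verts T h) t ∈ S.real T :=
  chart_mem_of_convex (S.convex_real T) (S.verts_mem_real T h) ht

theorem edges_verts_mem (T : Face n) {k : ℕ} (h : T.1.card = k + 1) (j : Fin k) :
    edges (S.verts T h) j ∈ S.dir T :=
  S.sub_mem_dir (S.verts_mem_real T h _) (S.verts_mem_real T h _)

variable {S}

theorem eval_eq {k : ℕ} {T : Face n} (h : T.1.card = k + 1) (u : Vec n → Alt k (Vec n))
    (v : Vec n → Alt (k + 1) (Vec n)) :
    S.eval h (fun x : S.real T => (u x, v x)) = simplexIntegral (S.verts T h) u := by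
  refine setIntegral_congr_fun (isClosed_stdSimp k).measurableSet fun t ht => ?_
  exact congrArg (fun f : Alt k (Vec n) => f (edges (S.verts T h)))
    (S.extendZero_apply _ (S.chart_verts_mem T h ht))

/-- With representatives defined on the whole space, restriction to a subface keeps the same
functions, and only the set on which they are considered changes. -/
theorem exists_rep {k : ℕ} {T : Face n} (p : S.Pairs k T) :
    ∃ (u : Vec n → Alt k (Vec n)) (v : Vec n → Alt (k + 1) (Vec n)),
      p = fun x : S.real T => (u x, v x) := by
  refine ⟨S.extendZero T fun x => (p x).1, S.extendZero T fun x => (p x).2, ?_⟩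
  ext1 x
  rw [S.extendZero_apply _ x.2, S.extendZero_apply _ x.2]

/-- The coordinate with origin `W_T` of the parametrization of `T`. -/
def chartDir (S : SplitSimplex n) (T : Face n) {k : ℕ} (h : T.1.card = k + 1) (t : Fin k → ℝ) :
    S.dir T :=
  ⟨_, S.sub_mem_dir (S.verts_mem_real T h 0) (S.inpoint_mem_real T)⟩ +
    ∑ j, t j • ⟨_, S.edges_verts_mem T h j⟩

theorem inpoint_add_chartDir (T : Face n) {k : ℕ} (h : T.1.card = k + 1) (t : Fin k → ℝ) :
    S.inpoint T + (S.chartDir T h t : Vec n) = chart (S.verts T h) t := by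
  simp only [chartDir, chart, Submodule.coe_add, Submodule.coe_sum, Submodule.coe_smul, edges]
  abel

theorem radial_chart (T : Face n) {k : ℕ} (h : T.1.card = k + 1) (t : Fin k → ℝ)
    (ht : chart (S.verts T h) t ∈ S.real T) : S.radial T ⟨_, ht⟩ = S.chartDir T h t := by
  ext1
  change chart (S.verts T h) t - S.inpoint T = _
  rw [← inpoint_add_chartDir]
  simp

theorem contDiff_chartDir (T : Face n) {k : ℕ} (h : T.1.card = k + 1) {r : ℕ∞} :
    ContDiff ℝ r (S.chartDir T h) := by
  unfold chartDir; fun_prop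

theorem chartDir_add_single (T : Face n) {k : ℕ} (h : T.1.card = k + 1) (t : Fin k → ℝ) (j : Fin k)
    (s : ℝ) : S.chartDir T h (t + s • Pi.single j 1) =
      S.chartDir T h t + s • ⟨_, S.edges_verts_mem T h j⟩ := by
  simp only [chartDir, Pi.add_apply, Pi.smul_apply, add_smul, Finset.sum_add_distrib, add_assoc]
  congr 2
  rw [Finset.sum_eq_single j]
  · simp
  · intro i _ hi
    simp [Pi.single_eq_of_ne hi]
  · simp

theorem exists_affine_chart (T : Face n) {k : ℕ} (h : T.1.card = k + 1) :
    ∃ f : (Fin k → ℝ) →ᵃ[ℝ] Vec n, ∀ t, f t = chart (S.verts T h) t := by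
  refine ⟨AffineMap.const ℝ _ (S.verts T h 0) +
    (∑ j, (LinearMap.toSpanSingleton ℝ (Vec n) (edges (S.verts T h) j)).comp
      (LinearMap.proj (R := ℝ) (φ := fun _ => ℝ) j)).toAffineMap, fun t => ?_⟩
  simp [chart, edges]

theorem lipschitz_of_mem_C0P (T : Face n) {k r m : ℕ} (h : T.1.card = k + 1) {F : Type}
    [NormedAddCommGroup F] [NormedSpace ℝ F] {u : Vec n → F}
    (hu : (fun x : S.real T => u x) ∈ S.C0P r m T) :
    ∃ K, LipschitzOnWith K (fun t => u (chart (S.verts T h) t)) (stdSimp k) := by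
  refine exists_lipschitzOnWith_of_cover (convex_stdSimp k) (isCompact_stdSimp k)
    (𝒜 := (fun σ => chart (S.verts T h) ⁻¹' σ) '' S.refinement m T)
    ((S.finite_refinement m T).image _) ?_ ?_ ?_ ?_
  · rintro _ ⟨σ, hσ, rfl⟩
    exact (S.isCompact_cell hσ).isClosed.preimage (continuous_chart _)
  · intro t ht
    obtain ⟨σ, hσ, h1⟩ := S.exists_mem_cell m (S.chart_verts_mem T h ht)
    exact ⟨_, ⟨σ, hσ, rfl⟩, h1⟩
  · exact (continuousOn_iff_continuous_domRestrict.2 hu.1).comp (continuous_chart _).continuousOn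
      fun t ht => S.chart_verts_mem T h ht
  · rintro _ ⟨σ, hσ, rfl⟩
    obtain ⟨q, hq, hqu⟩ := hu.2 σ hσ
    refine ⟨fun t => q (S.chartDir T h t), (hq.contDiff.of_le (by simp)).comp
      (contDiff_chartDir T h), fun t ht => ?_⟩
    beta_reduce
    rw [← radial_chart T h t (S.cell_subset hσ ht.2)]
    exact hqu ⟨_, _⟩ ht.2

/-- Convex sets have negligible frontiers, so almost every point of the chart is interior to a cell.
There u is polynomial near the point and its line derivatives give v; globally u is Lipschitz in the
chart. -/
theorem stokes_of_mem_A {k : ℕ} {T : Face n} (h : T.1.card = k + 2) {u : Vec n → Alt k (Vec n)}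
    {v : Vec n → Alt (k + 1) (Vec n)} (hA : (fun x : S.real T => (u x, v x)) ∈ S.A k T) :
    simplexIntegral (S.verts T h) v = ∑ i : Fin (k + 2), (-1 : ℝ) ^ (i : ℕ) *
      simplexIntegral (S.verts (T.facet h i) (T.facet_card h i)) u := by
  simp only [verts_facet]
  obtain ⟨h1, -, h3, -⟩ := hA
  refine stokes_chart _ (fun ξ => ?_) ?_
  · obtain ⟨K, hK⟩ := lipschitz_of_mem_C0P T h h1
    exact ⟨_, (ContinuousAlternatingMap.apply ℝ (Vec n) ℝ ξ).lipschitz.comp_lipschitzOnWith hK⟩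
  · have hfr : ∀ᵐ t, ∀ σ ∈ S.refinement (k - 1) T, t ∉ frontier (chart (S.verts T h) ⁻¹' σ) := by
      rw [ae_ball_iff (S.finite_refinement _ T).countable]
      intro σ hσ
      refine measure_eq_zero_iff_ae_notMem.1 (Convex.addHaar_frontier volume ?_)
      obtain ⟨f, hf⟩ := exists_affine_chart (S := S) T h
      rw [show chart (S.verts T h) = f from (funext hf).symm]
      exact (S.convex_cell hσ).affine_preimage f
    filter_upwards [hfr] with t ht hti
    have htT := S.chart_verts_mem T h (interior_subset hti)
    obtain ⟨σ, hσ, hmem⟩ := S.exists_mem_cell (k - 1) htT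
    obtain ⟨q, ⟨r, hq⟩, hqu⟩ := h3 σ hσ
    have hint : t ∈ interior (chart (S.verts T h) ⁻¹' σ) := by
      by_contra hc
      exact ht σ hσ ⟨subset_closure hmem, hc⟩
    have key := extDeriv_comp (q := q) (c := S.chartDir T h) (t := t) (hq.differentiable _)
      (chartDir_add_single T h t)
      (φ := fun j t => u (chart (S.verts T h) t) (j.removeNth (edges (S.verts T h))))
      (fun j => ?_)
    · rw [← key, ← radial_chart T h t htT, ← (hqu ⟨_, htT⟩ hmem).2]
      rfl
    · filter_upwards [mem_interior_iff_mem_nhds.1 hint] with s hs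
      have hsT := S.cell_subset hσ hs
      rw [← radial_chart T h s hsT, ← (hqu ⟨_, hsT⟩ hs).1]
      rfl

end SplitSimplex

end FES

namespace FES

open ContinuousAlternatingMap Matrix

namespace SplitSimplex

variable {n : ℕ} {S : SplitSimplex n}

/-! ### Elements of `A^k(S)` have a continuous exterior derivative -/

theorem dir_top : S.dir (Face.top n) = ⊤ := by
  rw [eq_top_iff]
  intro ξ _
  exact S.mem_dir.2 fun i hi => absurd (Finset.mem_univ i) hi

/-- The coordinate with origin `W_S`. -/
def topDir (S : SplitSimplex n) (x : Vec n) : S.dir (Face.top n) :=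
  ⟨x - S.inpoint (Face.top n), by rw [dir_top]; trivial⟩

theorem topDir_add (x y : Vec n) (s : ℝ) :
    S.topDir (x + s • y) = S.topDir x + s • ⟨y, by rw [dir_top]; trivial⟩ := by
  ext1
  simp only [topDir, Submodule.coe_add, Submodule.coe_smul]
  abel

theorem contDiff_topDir {r : ℕ∞} : ContDiff ℝ r S.topDir := by
  have : S.topDir = fun x => (LinearMap.toContinuousLinearMap
      ((LinearMap.id : Vec n →ₗ[ℝ] Vec n).codRestrict (S.dir (Face.top n)) fun x => by
        rw [dir_top]; trivial)) (x - S.inpoint (Face.top n)) := rfl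
  rw [this]
  fun_prop

theorem extendZero_of_notMem {T : Face n} {E : Type} [Zero E] (u : S.real T → E) {x : Vec n}
    (hx : x ∉ S.real T) : S.extendZero T u x = 0 :=
  Function.extend_apply' _ _ _ fun ⟨y, hy⟩ => hx (hy ▸ y.2)

theorem lipschitzOnWith_of_mem_C0P {r m : ℕ} {F : Type} [NormedAddCommGroup F] [NormedSpace ℝ F]
    {u : Vec n → F} (hu : (fun x : S.real (Face.top n) => u x) ∈ S.C0P r m (Face.top n)) :
    ∃ K, LipschitzOnWith K u (S.real (Face.top n)) := by
  refine exists_lipschitzOnWith_of_cover (S.convex_real _) (S.isCompact_real _)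
    (𝒜 := S.refinement m (Face.top n)) (S.finite_refinement m _)
    (fun σ hσ => (S.isCompact_cell hσ).isClosed) (fun x hx => S.exists_mem_cell m hx)
    (continuous_iff.1 hu.1) fun σ hσ => ?_
  obtain ⟨q, hq, hqu⟩ := hu.2 σ hσ
  exact ⟨fun x => q (S.topDir x), (hq.contDiff.of_le (by simp)).comp contDiff_topDir,
    fun x hx => hqu ⟨x, hx.1⟩ hx.2⟩

/-- The components of u are Lipschitz and can be integrated by parts against a test function. Their
line derivatives are, outside the negligible frontiers of the cells, those of the polynomial pieces,
whose alternating sum is v. -/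
theorem A_subset_C0d (k : ℕ) : S.A k (Face.top n) ⊆ S.C0d k := by
  intro p hp
  obtain ⟨u, v, rfl⟩ := exists_rep p
  obtain ⟨h1, h2, h3, -⟩ := hp
  refine ⟨h1.1.prodMk h2.1, fun φ hφ hφc hsupp ξ => ?_⟩
  obtain ⟨K, hK⟩ := lipschitzOnWith_of_mem_C0P h1
  have hext : ∀ i : Fin (k + 1), ∃ f : Vec n → ℝ, (∃ C, LipschitzWith C f) ∧
      Set.EqOn (fun x => u x (i.removeNth ξ)) f (S.real (Face.top n)) := fun i => by
    obtain ⟨f, hf, hfu⟩ := ((ContinuousAlternatingMap.apply ℝ (Vec n) ℝ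
      (i.removeNth ξ)).lipschitz.comp_lipschitzOnWith hK).extend_real
    exact ⟨f, ⟨_, hf⟩, hfu⟩
  choose f hf hfu using hext
  choose C hC using hf
  obtain ⟨D, hD⟩ := hφ.lipschitzWith_of_hasCompactSupport hφc (by simp)
  have hin : ∀ x ∈ tsupport φ, x ∈ S.real (Face.top n) := fun x hx => interior_subset (hsupp hx)
  have e1 : ∀ i : Fin (k + 1), ∫ x, fderiv ℝ φ x (ξ i) *
      S.extendZero _ (fun y : S.real (Face.top n) => u y) x (i.removeNth ξ) =
      - ∫ x, lineDeriv ℝ (f i) x (ξ i) * φ x := by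
    intro i
    rw [LipschitzWith.integral_lineDeriv_mul_eq (hC i) hD hφc, ← integral_neg]
    congr 1
    ext x
    rw [(hφ.differentiable (by simp) x).lineDeriv_eq_fderiv, map_neg, neg_mul, neg_neg]
    by_cases hx : x ∈ tsupport φ
    · rw [S.extendZero_apply _ (hin x hx)]
      congr 1
      exact hfu i (hin x hx)
    · rw [image_eq_zero_of_notMem_tsupport fun h => hx (tsupport_fderiv_subset ℝ h)]
      simp
  have hint : ∀ i : Fin (k + 1), Integrable fun x => lineDeriv ℝ (f i) x (ξ i) * φ x := by
    intro i
    refine Integrable.bdd_mul (c := C i * ‖ξ i‖) (hφ.continuous.integrable_of_hasCompactSupport hφc)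
      (measurable_lineDeriv (hC i).continuous).aestronglyMeasurable ?_
    exact Filter.Eventually.of_forall fun x => norm_lineDeriv_le_of_lipschitz ℝ (hC i)
  simp only [e1, mul_neg, Finset.sum_neg_distrib, neg_neg, ← integral_const_mul]
  rw [← integral_finsetSum _ fun i _ => (hint i).const_mul _]
  refine integral_congr_ae ?_
  have hfr : ∀ᵐ x, ∀ σ ∈ S.refinement (k - 1) (Face.top n), x ∉ frontier σ := by
    rw [ae_ball_iff (S.finite_refinement _ _).countable]
    exact fun σ hσ => measure_eq_zero_iff_ae_notMem.1 ((S.convex_cell hσ).addHaar_frontier volume)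
  filter_upwards [hfr] with x hx
  by_cases hxs : x ∈ tsupport φ
  · have hxT := hin x hxs
    obtain ⟨σ, hσ, hmem⟩ := S.exists_mem_cell (k - 1) hxT
    obtain ⟨q, ⟨r, hq⟩, hqu⟩ := h3 σ hσ
    have hi : x ∈ interior σ := by
      by_contra hc
      exact hx σ hσ ⟨subset_closure hmem, hc⟩
    have key := extDeriv_comp (q := q) (c := S.topDir) (t := x) (hq.differentiable _)
      (a := ξ) (fun j s => topDir_add x (ξ j) s) (φ := f) (fun j => ?_)
    · rw [S.extendZero_apply _ hxT]
      have e2 := (hqu ⟨x, hxT⟩ hmem).2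
      have e3 : v x ξ = extDeriv q (S.topDir x) fun j => ⟨ξ j, by rw [dir_top]; trivial⟩ := by
        change _ = extDeriv q (S.radial _ ⟨x, hxT⟩) _
        rw [← e2]; rfl
      rw [e3, key, Finset.mul_sum]
      exact Finset.sum_congr rfl fun i _ => by ring
    · filter_upwards [mem_interior_iff_mem_nhds.1 hi] with s hs
      have hsT := S.cell_subset hσ hs
      change _ = q (S.radial _ ⟨s, hsT⟩) _
      rw [← (hqu ⟨s, hsT⟩ hs).1, ← hfu j hsT]
      rfl
  · simp [image_eq_zero_of_notMem_tsupport hxs]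

end SplitSimplex

end FES

namespace FES

open ContinuousAlternatingMap Matrix

/-! ### Estimates for integrals over simplices and for test functions -/

/-- Change of the form in an integral over a simplex. -/
theorem abs_simplexIntegral_sub_le {E : Type} [NormedAddCommGroup E] [NormedSpace ℝ E] {k : ℕ}
    (V : Fin (k + 1) → E) : ∃ C : ℝ, 0 ≤ C ∧ ∀ (K : Set E) (u u' : E → Alt k E) (η : ℝ),
      (∀ t ∈ stdSimp k, chart V t ∈ K) → ContinuousOn u K → ContinuousOn u' K →
      (∀ x ∈ K, ‖u' x - u x‖ ≤ η) → |simplexIntegral V u' - simplexIntegral V u| ≤ C * η := by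
  refine ⟨(∏ j, ‖edges V j‖) * volume.real (stdSimp k), by positivity, ?_⟩
  intro K u u' η hK hu hu' h
  have hint : ∀ u : E → Alt k E, ContinuousOn u K →
      IntegrableOn (fun t => u (chart V t) (edges V)) (stdSimp k) := fun u hu =>
    ContinuousOn.integrableOn_compact (isCompact_stdSimp k)
      ((ContinuousAlternatingMap.apply ℝ E ℝ (edges V)).continuous.comp_continuousOn
        (hu.comp (continuous_chart V).continuousOn hK))
  rw [simplexIntegral, simplexIntegral, ← integral_sub (hint u' hu') (hint u hu)]
  have := norm_setIntegral_le_of_norm_le_const (μ := volume) (s := stdSimp k)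
    (f := fun t => u' (chart V t) (edges V) - u (chart V t) (edges V))
    (C := η * ∏ j, ‖edges V j‖) (isCompact_stdSimp k).measure_lt_top fun t ht => ?_
  · rw [Real.norm_eq_abs] at this
    calc _ ≤ _ := this
      _ = _ := by ring
  · rw [← ContinuousAlternatingMap.sub_apply]
    refine (ContinuousAlternatingMap.le_opNorm _ _).trans ?_
    gcongr
    exact h _ (hK t ht)

theorem exists_norm_fderiv_le {E F : Type} [NormedAddCommGroup E] [NormedSpace ℝ E]
    [NormedAddCommGroup F] [NormedSpace ℝ F] {g : E → F} (hg : ContDiff ℝ 1 g)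
    (hc : HasCompactSupport g) : ∃ M, ∀ y, ‖fderiv ℝ g y‖ ≤ M :=
  (hc.fderiv ℝ).exists_bound_of_continuous (hg.continuous_fderiv (by simp))

/-- The integral of a function against the second derivative of a test function. -/
theorem exists_integral_fderiv_fderiv {E F : Type} [NormedAddCommGroup E] [NormedSpace ℝ E]
    [MeasurableSpace E] [BorelSpace E] [FiniteDimensional ℝ E] [NormedAddCommGroup F]
    [NormedSpace ℝ F] [CompleteSpace F] {μ : Measure E} {u : E → F} (hu : Integrable u μ)
    {φ : E → ℝ} (hφ : ContDiff ℝ ∞ φ) (hφc : HasCompactSupport φ) :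
    ∃ J : E →L[ℝ] E →L[ℝ] F, (∀ a b, J a b = J b a) ∧
      ∀ a b, Integrable (fun y => fderiv ℝ (fderiv ℝ φ) y a b • u y) μ ∧
        J a b = ∫ y, fderiv ℝ (fderiv ℝ φ) y a b • u y ∂μ := by
  have hφ2 : ContDiff ℝ 1 (fderiv ℝ φ) := (contDiff_infty_iff_fderiv.1 hφ).2.of_le (by simp)
  have hcont2 : Continuous (fderiv ℝ (fderiv ℝ φ)) := hφ2.continuous_fderiv (by simp)
  obtain ⟨M, hM⟩ := exists_norm_fderiv_le hφ2 (hφc.fderiv ℝ)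
  have hM0 : 0 ≤ M := (norm_nonneg _).trans (hM 0)
  have hb : ∀ y a b, ‖fderiv ℝ (fderiv ℝ φ) y a b‖ ≤ M * ‖a‖ * ‖b‖ := fun y a b =>
    (ContinuousLinearMap.le_opNorm₂ _ a b).trans (mul_le_mul_of_nonneg_right
      (mul_le_mul_of_nonneg_right (hM y) (norm_nonneg a)) (norm_nonneg b))
  have hint : ∀ a b, Integrable (fun y => fderiv ℝ (fderiv ℝ φ) y a b • u y) μ := fun a b =>
    hu.bdd_smul (M * ‖a‖ * ‖b‖) ((hcont2.clm_apply continuous_const).clm_apply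
      continuous_const).aestronglyMeasurable (Filter.Eventually.of_forall fun y => hb y a b)
  obtain ⟨J, hJ⟩ : ∃ J : E →ₗ[ℝ] E →ₗ[ℝ] F,
      ∀ a b, J a b = ∫ y, fderiv ℝ (fderiv ℝ φ) y a b • u y ∂μ := by
    refine ⟨LinearMap.mk₂ ℝ (fun a b => ∫ y, fderiv ℝ (fderiv ℝ φ) y a b • u y ∂μ)
      (fun a a' b => ?_) (fun c a b => ?_) (fun a b b' => ?_) (fun c a b => ?_), fun a b => rfl⟩
    · rw [← integral_add (hint a b) (hint a' b)]
      simp only [map_add, _root_.add_apply, add_smul]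
    · rw [← integral_smul]
      simp only [map_smul, _root_.smul_apply, smul_eq_mul, mul_smul]
    · rw [← integral_add (hint a b) (hint a b')]
      simp only [map_add, add_smul]
    · rw [← integral_smul]
      simp only [map_smul, smul_eq_mul, mul_smul]
  have hJb : ∀ a b, ‖J a b‖ ≤ M * (∫ y, ‖u y‖ ∂μ) * ‖a‖ * ‖b‖ := by
    intro a b
    have := norm_integral_le_of_norm_le (hu.norm.const_mul (M * ‖a‖ * ‖b‖))
      (f := fun y => fderiv ℝ (fderiv ℝ φ) y a b • u y) (Filter.Eventually.of_forall fun y => by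
        rw [norm_smul]
        exact mul_le_mul_of_nonneg_right (hb y a b) (norm_nonneg _))
    rw [integral_const_mul, ← hJ] at this
    calc _ ≤ _ := this
      _ = _ := by ring
  refine ⟨J.mkContinuous₂ _ hJb, fun a b => ?_, fun a b => ⟨hint a b, hJ a b⟩⟩
  rw [LinearMap.mkContinuous₂_apply, LinearMap.mkContinuous₂_apply, hJ, hJ]
  congr 1
  ext1 y
  congr 1
  exact (hφ.contDiffAt (x := y)).isSymmSndFDerivAt
    (by simpa using WithTop.coe_le_coe.2 (le_top : (2 : ℕ∞) ≤ ⊤)) a b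

namespace SplitSimplex

variable {n : ℕ} {S : SplitSimplex n}

/-! ### Continuous forms with continuous exterior derivative -/

theorem inpoint_mem_interior : S.inpoint (Face.top n) ∈ interior (S.real (Face.top n)) := by
  rw [mem_interior]
  refine ⟨{x | ∀ i, 0 < S.bary i x}, fun x hx => S.mem_real.2 ⟨fun i => (hx i).le,
    fun i hi => absurd (Finset.mem_univ i) hi⟩, ?_, fun i => S.bary_inpoint_pos (Finset.mem_univ i)⟩
  rw [Set.ofPred_forall]
  exact isOpen_iInter_of_finite fun i => isOpen_lt continuous_const (S.continuous_bary i)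

theorem continuousOn_extendZero {T : Face n} {E : Type} [NormedAddCommGroup E] {u : S.real T → E}
    (hu : Continuous u) : ContinuousOn (S.extendZero T u) (S.real T) := by
  rw [← continuous_iff]
  convert hu using 2 with x
  exact S.extendZero_apply u x.2

theorem integrable_extendZero {T : Face n} {E : Type} [NormedAddCommGroup E] {u : S.real T → E}
    (hu : Continuous u) : Integrable (S.extendZero T u) := by
  refine (integrableOn_iff_integrable_of_support_subset fun x hx => ?_).1
    ((continuousOn_extendZero hu).integrableOn_compact (S.isCompact_real T))
  by_contra h
  exact hx (extendZero_of_notMem u h)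

/-- The weak derivative of v must be shown to vanish. Testing v against first derivatives of φ,
which are again test functions, amounts to testing u against second derivatives of φ; these are
symmetric, so the alternating sum is zero. -/
theorem d_mem_C0d {k : ℕ} {p : S.Pairs k (Face.top n)} (hp : p ∈ S.C0d k) :
    S.d p ∈ S.C0d (k + 1) := by
  refine ⟨(continuous_snd.comp hp.1).prodMk continuous_const, fun φ hφ hφc hsupp ξ => ?_⟩
  have h0 : S.extendZero (Face.top n) (fun y => (S.d p y).2) = 0 := by
    ext1 x
    by_cases hx : x ∈ S.real (Face.top n)
    · rw [S.extendZero_apply _ hx]; rfl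
    · rw [extendZero_of_notMem _ hx]; rfl
  set u := S.extendZero (Face.top n) fun y => (p y).1 with hu
  have hui : Integrable u := integrable_extendZero (continuous_fst.comp hp.1)
  have hφ2 : ContDiff ℝ 1 (fderiv ℝ φ) := (contDiff_infty_iff_fderiv.1 hφ).2.of_le (by simp)
  obtain ⟨J, hsymm, hJ⟩ := exists_integral_fderiv_fderiv hui hφ hφc
  have hJint : ∀ a b ζ, J a b ζ = ∫ y, fderiv ℝ (fderiv ℝ φ) y a b * u y ζ := by
    intro a b ζ
    rw [(hJ a b).2]
    exact ((ContinuousAlternatingMap.apply ℝ (Vec n) ℝ ζ).integral_comp_comm (hJ a b).1).symm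
  have hz := congrArg (fun f => f ξ)
    (alternatizeUncurryFin_alternatizeUncurryFinCLM_comp_of_symmetric hsymm)
  have key : ∀ i : Fin (k + 2), ∫ x, fderiv ℝ φ x (ξ i) *
      S.extendZero (Face.top n) (fun y => (S.d p y).1) x (i.removeNth ξ) =
      - alternatizeUncurryFin (J (ξ i)) (i.removeNth ξ) := by
    intro i
    have h1 := hp.2 (fun x => fderiv ℝ φ x (ξ i)) ((contDiff_infty_iff_fderiv.1 hφ).2.clm_apply
      contDiff_const) ((hφc.fderiv ℝ).comp_left (g := fun f : Vec n →L[ℝ] ℝ => f (ξ i)) rfl)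
      ?_ (i.removeNth ξ)
    · refine h1.trans ?_
      rw [alternatizeUncurryFin_apply]
      congr 1
      refine Finset.sum_congr rfl fun j _ => ?_
      rw [zsmul_eq_mul, hsymm, hJint]
      push_cast
      congr 2
      ext x
      congr 1
      rw [fderiv_clm_apply (hφ2.differentiable (by simp) x) (differentiableAt_const _)]
      simp
    · refine (closure_mono fun x hx => ?_).trans ((tsupport_fderiv_subset ℝ).trans hsupp)
      rw [Function.mem_support] at hx ⊢
      exact fun h => hx (by rw [h]; rfl)
  rw [h0]
  simp only [key, Pi.zero_apply, alt_zero_apply, mul_zero, integral_zero]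
  rw [alternatizeUncurryFin_apply] at hz
  have : ∑ i : Fin (k + 2), (-1 : ℝ) ^ (i : ℕ) *
      - alternatizeUncurryFin (J (ξ i)) (i.removeNth ξ) = 0 := by
    rw [← neg_eq_zero, ← Finset.sum_neg_distrib]
    refine Eq.trans (Finset.sum_congr rfl fun i _ => ?_) hz
    rw [zsmul_eq_mul]
    push_cast
    rw [mul_neg, neg_neg]
    rfl
  rw [this, neg_zero]

end SplitSimplex

end FES

namespace FES

open ContinuousAlternatingMap Matrix

open scoped Convolution

/-! ### Stokes' formula for continuous forms with continuous exterior derivative -/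

theorem stokes_chart_of_contDiff {E : Type} [NormedAddCommGroup E] [NormedSpace ℝ E] {k : ℕ}
    (V : Fin (k + 2) → E) {g : E → Alt k E} (hg : ContDiff ℝ 1 g) :
    simplexIntegral V (extDeriv g) =
      ∑ i : Fin (k + 2), (-1 : ℝ) ^ (i : ℕ) * simplexIntegral (V ∘ i.succAbove) g := by
  have hchart : ContDiff ℝ 1 (chart V) := by unfold chart; fun_prop
  refine stokes_chart V (fun ξ => ?_) (Filter.Eventually.of_forall fun t _ => ?_)
  · have h : ContDiff ℝ 1 fun t => g (chart V t) ξ :=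
      (ContinuousAlternatingMap.apply ℝ E ℝ ξ).contDiff.comp (hg.comp hchart)
    exact h.locallyLipschitz.locallyLipschitzOn.exists_lipschitzOnWith_of_compact
      (isCompact_stdSimp _)
  · refine extDeriv_comp (hg.differentiable (by simp) _) (fun j s => ?_)
      fun j => Filter.EventuallyEq.rfl
    simp only [chart, edges, Pi.add_apply, Pi.smul_apply, add_smul, Finset.sum_add_distrib,
      ← add_assoc]
    congr 1
    rw [Finset.sum_eq_single j (fun i _ hi => by simp [hi]) (by simp)]
    simp

theorem contDiff_convolution_lsmul {n : ℕ} {F : Type} [NormedAddCommGroup F] [NormedSpace ℝ F]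
    [CompleteSpace F] {f : Vec n → ℝ} (hf : ContDiff ℝ 1 f) (hc : HasCompactSupport f)
    {u : Vec n → F} (hu : Integrable u) :
    ContDiff ℝ 1 (f ⋆[ContinuousLinearMap.lsmul ℝ ℝ, volume] u) ∧ ∀ x a,
      Integrable (fun y => fderiv ℝ f (x - y) a • u y) ∧
      fderiv ℝ (f ⋆[ContinuousLinearMap.lsmul ℝ ℝ, volume] u) x a =
        ∫ y, fderiv ℝ f (x - y) a • u y := by
  have h1 : ContDiff ℝ (1 : ℕ∞) (f ⋆[ContinuousLinearMap.lsmul ℝ ℝ, volume] u) :=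
    hc.contDiff_convolution_left _ (by exact_mod_cast hf) hu.locallyIntegrable
  obtain ⟨M, hM⟩ := exists_norm_fderiv_le hf hc
  have hint : ∀ x a, Integrable (fun y => fderiv ℝ f (x - y) a • u y) := fun x a =>
    hu.bdd_smul (M * ‖a‖) ((((hf.continuous_fderiv (by simp)).comp
      (continuous_const.sub continuous_id)).clm_apply continuous_const).aestronglyMeasurable)
      (Filter.Eventually.of_forall fun y => (ContinuousLinearMap.le_opNorm _ _).trans
        (mul_le_mul_of_nonneg_right (hM _) (norm_nonneg a)))
  refine ⟨by exact_mod_cast h1, fun x a => ⟨hint x a, ?_⟩⟩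
  rw [(hc.hasFDerivAt_convolution_left (ContinuousLinearMap.lsmul ℝ ℝ) hf hu.locallyIntegrable
    x).fderiv, convolution_eq_swap, ContinuousLinearMap.integral_apply]
  · rfl
  · have := hc.fderiv ℝ |>.convolutionExists_left ((ContinuousLinearMap.lsmul ℝ ℝ).precompL (Vec n))
      (hf.continuous_fderiv (by simp)) (hu.locallyIntegrable) x
    exact (this.integrable_swap)

/-- This allows passing from simplices in the interior to those touching the boundary, by shrinking
towards an interior point and letting the ratio tend to 1. -/
theorem continuousOn_simplexIntegral_homothety {E : Type} [NormedAddCommGroup E] [NormedSpace ℝ E]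
    {s : Set E} (hs : Convex ℝ s) {W : E} (hW : W ∈ s) {k : ℕ}
    {V : Fin (k + 1) → E} (hV : ∀ i, V i ∈ s) {u : E → Alt k E} (hu : ContinuousOn u s) :
    ContinuousOn (fun r : ℝ => simplexIntegral (fun i => W + r • (V i - W)) u) (Set.Icc 0 1) := by
  have hform : ∀ r : ℝ, ∀ t, u (chart (fun i => W + r • (V i - W)) t)
      (edges fun i => W + r • (V i - W)) =
      r ^ k * u (chart (fun i => W + r • (V i - W)) t) (edges V) := by
    intro r t
    have : (edges fun i => W + r • (V i - W)) = fun j => r • edges V j := by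
      ext1 j
      simp only [edges]
      module
    rw [this, ContinuousAlternatingMap.map_smul_univ]
    simp
  have hcont : ContinuousOn (fun q : ℝ × (Fin k → ℝ) =>
      q.1 ^ k * u (chart (fun i => W + q.1 • (V i - W)) q.2) (edges V))
      (Set.Icc 0 1 ×ˢ stdSimp k) := by
    refine (continuous_fst.pow k).continuousOn.mul
      ((ContinuousAlternatingMap.apply ℝ E ℝ (edges V)).continuous.comp_continuousOn
        (hu.comp ?_ ?_))
    · unfold chart; fun_prop
    · rintro ⟨r, t⟩ ⟨hr, ht⟩
      refine chart_mem_of_convex hs (fun i => ?_) ht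
      exact hs.add_smul_sub_mem hW (hV i) hr
  obtain ⟨M, hM⟩ := (isCompact_Icc.prod (isCompact_stdSimp k)).exists_bound_of_continuousOn hcont
  unfold simplexIntegral
  simp only [hform]
  refine continuousOn_of_dominated (bound := fun _ => M) (fun r hr => ?_) (fun r hr => ?_) ?_ ?_
  · exact (hcont.comp (f := fun t => (r, t)) (by fun_prop)
      fun t ht => ⟨hr, ht⟩).aestronglyMeasurable (isClosed_stdSimp k).measurableSet
  · exact (ae_restrict_mem (isClosed_stdSimp k).measurableSet).mono fun t ht => hM (r, t) ⟨hr, ht⟩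
  · exact integrableOn_const (isCompact_stdSimp k).measure_lt_top.ne
  · exact (ae_restrict_mem (isClosed_stdSimp k).measurableSet).mono fun t ht =>
      hcont.comp (f := fun r => (r, t)) (by fun_prop) fun r hr => ⟨hr, ht⟩

namespace SplitSimplex

variable {n : ℕ} {S : SplitSimplex n}

/-- Mollification. On K the exterior derivative of the mollified u is the mollified v, because the
reflected and translated bump is an admissible test function; the errors are controlled by uniform
continuity. -/
theorem exists_smooth_approx {k : ℕ} {p : S.Pairs k (Face.top n)} (hp : p ∈ S.C0d k)
    {K : Set (Vec n)} (hK : IsCompact K) (hKS : K ⊆ interior (S.real (Face.top n))) {η : ℝ}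
    (hη : 0 < η) : ∃ g : Vec n → Alt k (Vec n), ContDiff ℝ 1 g ∧ ∀ x ∈ K,
      ‖g x - S.extendZero _ (fun y => (p y).1) x‖ ≤ η ∧
      ‖extDeriv g x - S.extendZero _ (fun y => (p y).2) x‖ ≤ η := by
  set u := S.extendZero _ fun y => (p y).1 with hu
  set v := S.extendZero _ fun y => (p y).2 with hv
  have hui : Integrable u := integrable_extendZero (continuous_fst.comp hp.1)
  have hvi : Integrable v := integrable_extendZero (continuous_snd.comp hp.1)
  have hunif : ∀ {F : Type} [NormedAddCommGroup F] {w : S.real (Face.top n) → F},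
      Continuous w → ∃ δ > 0, ∀ x ∈ S.real (Face.top n), ∀ y ∈ S.real (Face.top n),
        dist x y < δ → dist (S.extendZero _ w x) (S.extendZero _ w y) < η := fun hw =>
    Metric.uniformContinuousOn_iff.1 ((S.isCompact_real _).uniformContinuousOn_of_continuous
      (continuousOn_extendZero hw)) η hη
  obtain ⟨δ₁, hδ₁, h1⟩ := hunif (continuous_fst.comp hp.1)
  obtain ⟨δ₂, hδ₂, h2⟩ := hunif (continuous_snd.comp hp.1)
  obtain ⟨δ₃, hδ₃, h3⟩ := hK.exists_cthickening_subset_open isOpen_interior hKS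
  -- The radii δ₁ and δ₂ control the oscillations of u and v, while δ₃ keeps the balls centred in K
  -- inside the interior of S.
  set ε := min δ₁ (min δ₂ δ₃) with hε
  have hε0 : 0 < ε := lt_min hδ₁ (lt_min hδ₂ hδ₃)
  let ρ : ContDiffBump (0 : Vec n) := ⟨ε / 2, ε, by positivity, by linarith⟩
  have hball : ∀ x ∈ K, Metric.closedBall x ε ⊆ interior (S.real (Face.top n)) := fun x hx =>
    ((Metric.closedBall_subset_closedBall ((min_le_right _ _).trans (min_le_right _ _))).trans
      (Metric.closedBall_subset_cthickening hx δ₃)).trans h3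
  have hmem : ∀ x ∈ K, ∀ y ∈ Metric.ball x ε, y ∈ S.real (Face.top n) := fun x hx y hy =>
    interior_subset (hball x hx (Metric.ball_subset_closedBall hy))
  have hρ : ContDiff ℝ ∞ (ρ.normed volume) := ρ.contDiff_normed
  have hρ1 : ContDiff ℝ 1 (ρ.normed volume) := hρ.of_le (by simp)
  obtain ⟨hg, hgd⟩ := contDiff_convolution_lsmul hρ1 ρ.hasCompactSupport_normed hui
  refine ⟨_, hg, fun x hx => ⟨?_, ?_⟩⟩
  · rw [← dist_eq_norm]
    exact ρ.dist_normed_convolution_le hui.1 fun y hy => (h1 y (hmem x hx y hy) x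
      (interior_subset (hKS hx)) (hy.trans_le (min_le_left _ _))).le
  · have hd : extDeriv (ρ.normed volume ⋆[ContinuousLinearMap.lsmul ℝ ℝ, volume] u) x =
        (ρ.normed volume ⋆[ContinuousLinearMap.lsmul ℝ ℝ, volume] v) x := by
      ext ξ
      have h4 := hp.2 (fun y => ρ.normed volume (x - y)) (hρ.comp (contDiff_const.sub contDiff_id))
        (ρ.hasCompactSupport_normed.comp_homeomorph (Homeomorph.subLeft x)) ?_ ξ
      · rw [extDeriv, alternatizeUncurryFin_apply, convolution_lsmul_swap]
        obtain ⟨M, hM⟩ := (ρ.hasCompactSupport_normed (μ := volume)).exists_bound_of_continuous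
          hρ.continuous
        have hint : Integrable fun y => ρ.normed volume (x - y) • v y :=
          hvi.bdd_smul M (hρ.continuous.comp
            (continuous_const.sub continuous_id)).aestronglyMeasurable
            (Filter.Eventually.of_forall fun y => hM _)
        have h5 := (ContinuousAlternatingMap.apply ℝ (Vec n) ℝ ξ).integral_comp_comm hint
        refine Eq.trans ?_ h5
        refine Eq.trans ?_ h4.symm
        rw [← Finset.sum_neg_distrib]
        refine Finset.sum_congr rfl fun i _ => ?_
        have h6 := (ContinuousAlternatingMap.apply ℝ (Vec n) ℝ (i.removeNth ξ)).integral_comp_comm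
          (hgd x (ξ i)).1
        rw [← (hgd x (ξ i)).2] at h6
        rw [zsmul_eq_mul, ← mul_neg, ← integral_neg]
        push_cast
        congr 1
        refine h6.symm.trans (integral_congr_ae (Filter.Eventually.of_forall fun y => ?_))
        have h7 : HasFDerivAt (fun y => ρ.normed volume (x - y))
            (-fderiv ℝ (ρ.normed volume) (x - y)) y :=
          (((hρ1.differentiable (by simp) (x - y)).hasFDerivAt).comp y
            ((hasFDerivAt_id y).const_sub x)).congr_fderiv (by ext a; simp)
        simp only [h7.fderiv, _root_.neg_apply, neg_mul, neg_neg]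
        rfl
      · refine (closure_minimal (fun y hy => ?_) Metric.isClosed_closedBall).trans (hball x hx)
        have : x - y ∈ Function.support (ρ.normed volume) := hy
        rw [ρ.support_normed_eq, mem_ball_zero_iff] at this
        rw [Metric.mem_closedBall, dist_comm, dist_eq_norm]
        exact this.le
    rw [hd, ← dist_eq_norm]
    exact ρ.dist_normed_convolution_le hvi.1 fun y hy => (h2 y (hmem x hx y hy) x
      (interior_subset (hKS hx)) (hy.trans_le ((min_le_right _ _).trans (min_le_left _ _)))).le

theorem stokes_of_mem_C0d_interior {k : ℕ} {p : S.Pairs k (Face.top n)} (hp : p ∈ S.C0d k)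
    {V : Fin (k + 2) → Vec n} (hV : ∀ i, V i ∈ interior (S.real (Face.top n))) :
    simplexIntegral V (S.extendZero _ fun y => (p y).2) = ∑ i : Fin (k + 2), (-1 : ℝ) ^ (i : ℕ) *
      simplexIntegral (V ∘ i.succAbove) (S.extendZero _ fun y => (p y).1) := by
  set K := convexHull ℝ (Set.range V) with hK
  have hKc : IsCompact K := (Set.finite_range V).isCompact_convexHull ℝ
  have hKS : K ⊆ interior (S.real (Face.top n)) :=
    convexHull_min (Set.range_subset_iff.2 hV) (S.convex_real _).interior
  have hVK : ∀ i, V i ∈ K := fun i => subset_convexHull ℝ _ ⟨i, rfl⟩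
  have hu : ContinuousOn (S.extendZero _ fun y => (p y).1) K :=
    (continuousOn_extendZero (continuous_fst.comp hp.1)).mono (hKS.trans interior_subset)
  have hv : ContinuousOn (S.extendZero _ fun y => (p y).2) K :=
    (continuousOn_extendZero (continuous_snd.comp hp.1)).mono (hKS.trans interior_subset)
  obtain ⟨C, hC, h⟩ := abs_simplexIntegral_sub_le V
  choose D hD hd using fun i : Fin (k + 2) => abs_simplexIntegral_sub_le (V ∘ i.succAbove)
  rw [← sub_eq_zero, ← abs_nonpos_iff]
  refine le_of_forall_pos_le_add fun ε hε => ?_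
  obtain ⟨η, hη, hηε⟩ : ∃ η > 0, (C + ∑ i, D i) * η ≤ ε := by
    have hpos : 0 < C + ∑ i, D i + 1 := by
      have := Finset.sum_nonneg fun i (_ : i ∈ Finset.univ) => hD i
      linarith
    refine ⟨ε / (C + ∑ i, D i + 1), by positivity, ?_⟩
    rw [mul_div_assoc', div_le_iff₀ hpos]
    nlinarith
  obtain ⟨g, hg, hgK⟩ := exists_smooth_approx hp hKc hKS hη
  have hg' : Continuous (extDeriv g) := by
    exact (alternatizeUncurryFinCLM ℝ (Vec n) ℝ (n := k)).continuous.comp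
      (hg.continuous_fderiv (by simp))
  have e1 := h K _ (extDeriv g) η (fun t ht => chart_mem_of_convex (convex_convexHull ℝ _) hVK ht)
    hv hg'.continuousOn fun x hx => (hgK x hx).2
  have e2 := fun i => hd i K _ g η (fun t ht => chart_mem_of_convex (convex_convexHull ℝ _)
    (fun j => hVK _) ht) hu hg.continuous.continuousOn fun x hx => (hgK x hx).1
  rw [stokes_chart_of_contDiff V hg] at e1
  have e3 : |∑ i : Fin (k + 2), (-1 : ℝ) ^ (i : ℕ) * (simplexIntegral (V ∘ i.succAbove) g -
      simplexIntegral (V ∘ i.succAbove) (S.extendZero _ fun y => (p y).1))| ≤ (∑ i, D i) * η := by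
    rw [Finset.sum_mul]
    refine (Finset.abs_sum_le_sum_abs _ _).trans (Finset.sum_le_sum fun i _ => ?_)
    rw [abs_mul, abs_pow, abs_neg, abs_one, one_pow, one_mul]
    exact e2 i
  simp only [mul_sub, Finset.sum_sub_distrib] at e3
  rw [zero_add]
  refine le_trans ?_ hηε
  rw [add_mul]
  rw [abs_le] at e1 e3 ⊢
  constructor <;> linarith [e1.1, e1.2, e3.1, e3.2]

/-- A homothety of centre W_S and ratio r < 1 moves the vertices into the interior. Both sides are
continuous in r on [0, 1], and equality on [0, 1) extends to r = 1. -/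
theorem stokes_of_mem_C0d {k : ℕ} {p : S.Pairs k (Face.top n)} (hp : p ∈ S.C0d k)
    {V : Fin (k + 2) → Vec n} (hV : ∀ i, V i ∈ S.real (Face.top n)) :
    simplexIntegral V (S.extendZero _ fun y => (p y).2) = ∑ i : Fin (k + 2), (-1 : ℝ) ^ (i : ℕ) *
      simplexIntegral (V ∘ i.succAbove) (S.extendZero _ fun y => (p y).1) := by
  set W := S.inpoint (Face.top n)
  have hW : W ∈ S.real (Face.top n) := S.inpoint_mem_real _
  have hu := continuousOn_extendZero (continuous_fst.comp hp.1)
  have hv := continuousOn_extendZero (continuous_snd.comp hp.1)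
  have c1 := continuousOn_simplexIntegral_homothety (S.convex_real _) hW hV hv
  have c2 := continuousOn_finsetSum Finset.univ fun (i : Fin (k + 2)) _ =>
    (continuousOn_const (c := (-1 : ℝ) ^ (i : ℕ))).mul
    (continuousOn_simplexIntegral_homothety (S.convex_real _) hW
      (V := V ∘ i.succAbove) (fun j => hV _) hu)
  have := Set.EqOn.of_subset_closure (s := Set.Ico (0 : ℝ) 1) (t := Set.Icc 0 1)
    (fun r hr => ?_) c1 c2 Set.Ico_subset_Icc_self (by rw [closure_Ico (by norm_num)])
    (Set.right_mem_Icc.2 zero_le_one)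
  · simpa [Function.comp_def] using this
  · refine stokes_of_mem_C0d_interior hp fun i => ?_
    have := (S.convex_real (Face.top n)).combo_interior_self_mem_interior
      inpoint_mem_interior (hV i) (sub_pos.2 hr.2) hr.1 (by ring)
    convert this using 1
    module

end SplitSimplex

end FES

namespace FES

open ContinuousAlternatingMap Matrix

/-! ### Integrals as degrees of freedom -/

theorem volume_stdSimp_pos (k : ℕ) : 0 < volume.real (stdSimp k) := by
  refine ENNReal.toReal_pos (ne_of_gt ?_) (isCompact_stdSimp k).measure_lt_top.ne
  have hpos : (0 : ℝ) < 1 / (k + 1) := by positivity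
  have hsub : Set.pi Set.univ (fun _ : Fin k => Set.Ioo (0 : ℝ) (1 / (k + 1))) ⊆ stdSimp k := by
    intro t ht
    refine ⟨fun j => (ht j trivial).1.le, ?_⟩
    refine (Finset.sum_le_sum fun j _ => (ht j trivial).2.le).trans ?_
    rw [Finset.sum_const, Finset.card_univ, Fintype.card_fin, nsmul_eq_mul, mul_one_div,
      div_le_one (by positivity)]
    linarith
  have ho : IsOpen (Set.pi Set.univ fun _ : Fin k => Set.Ioo (0 : ℝ) (1 / (k + 1))) :=
    isOpen_set_pi Set.finite_univ fun _ _ => isOpen_Ioo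
  exact (ho.measure_pos volume ⟨fun _ => (1 / (k + 1) / 2 : ℝ), fun j _ =>
    ⟨half_pos hpos, half_lt_self hpos⟩⟩).trans_le (measure_mono hsub)

section simplexIntegral

variable {E : Type} [NormedAddCommGroup E] [NormedSpace ℝ E] {k : ℕ} (V : Fin (k + 1) → E)

theorem simplexIntegral_const (f : Alt k E) :
    simplexIntegral V (fun _ => f) = volume.real (stdSimp k) * f (edges V) := by
  rw [simplexIntegral, setIntegral_const, smul_eq_mul]

theorem simplexIntegral_congr {K : Set E} (hK : ∀ t ∈ stdSimp k, chart V t ∈ K) {u u' : E → Alt k E}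
    (h : ∀ x ∈ K, u x = u' x) : simplexIntegral V u = simplexIntegral V u' :=
  setIntegral_congr_fun (isClosed_stdSimp k).measurableSet fun t ht => by rw [h _ (hK t ht)]

theorem simplexIntegral_smul (c : ℝ) (u : E → Alt k E) :
    simplexIntegral V (c • u) = c * simplexIntegral V u :=
  integral_const_mul c _

theorem simplexIntegral_add {K : Set E} (hK : ∀ t ∈ stdSimp k, chart V t ∈ K) {u u' : E → Alt k E}
    (hu : ContinuousOn u K) (hu' : ContinuousOn u' K) :
    simplexIntegral V (u + u') = simplexIntegral V u + simplexIntegral V u' := by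
  have hint : ∀ u : E → Alt k E, ContinuousOn u K →
      IntegrableOn (fun t => u (chart V t) (edges V)) (stdSimp k) := fun u hu =>
    ContinuousOn.integrableOn_compact (isCompact_stdSimp k)
      ((ContinuousAlternatingMap.apply ℝ E ℝ (edges V)).continuous.comp_continuousOn
        (hu.comp (continuous_chart V).continuousOn hK))
  exact integral_add (hint u hu) (hint u' hu')

theorem simplexIntegral_sub {K : Set E} (hK : ∀ t ∈ stdSimp k, chart V t ∈ K) {u u' : E → Alt k E}
    (hu : ContinuousOn u K) (hu' : ContinuousOn u' K) :
    simplexIntegral V (u - u') = simplexIntegral V u - simplexIntegral V u' := by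
  have h := simplexIntegral_add V hK (hu.sub hu') hu'
  rw [sub_add_cancel] at h
  linarith

end simplexIntegral

namespace SplitSimplex

variable {n : ℕ} {S : SplitSimplex n}

/-- Forms of top degree on T form a line: in the expansion on vertices, the surviving terms use each
vertex other than the base point exactly once, so they are signed values on the edges. -/
theorem form_eq_zero_of_edges {T : Face n} {k : ℕ} (h : T.1.card = k + 1) {f : Alt k (Vec n)}
    (hf : f (edges (S.verts T h)) = 0) {ξ : Fin k → Vec n} (hξ : ∀ j, ξ j ∈ S.dir T) : f ξ = 0 := by
  rw [S.map_eq_sum_vertex f (T.1.orderEmbOfFin h 0) ξ]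
  refine Finset.sum_eq_zero fun r _ => ?_
  by_cases hr : ∀ l, r l ∈ T.1
  swap
  · push Not at hr
    obtain ⟨l, hl⟩ := hr
    rw [Finset.prod_eq_zero (Finset.mem_univ l) (S.mem_dir.1 (hξ l) _ hl), zero_mul]
  by_cases hro : ∃ l, r l = T.1.orderEmbOfFin h 0
  · obtain ⟨l, hl⟩ := hro
    rw [f.map_coord_zero l (by simp [hl]), mul_zero]
  push Not at hro
  by_cases hinj : Function.Injective r
  swap
  · rw [Function.Injective] at hinj
    push Not at hinj
    obtain ⟨i, j, he, hij⟩ := hinj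
    rw [f.map_eq_zero_of_eq _ (by simp [he]) hij, mul_zero]
  have hτ : ∀ l, ∃ j : Fin k, T.1.orderEmbOfFin h j.succ = r l := by
    intro l
    have : r l ∈ Set.range (T.1.orderEmbOfFin h) := by
      rw [Finset.range_orderEmbOfFin]; exact hr l
    obtain ⟨j, hj⟩ := this
    rcases Fin.eq_zero_or_eq_succ j with rfl | ⟨j, rfl⟩
    · exact absurd hj.symm (hro l)
    · exact ⟨j, hj⟩
  choose τ hτ using hτ
  have hτi : Function.Injective τ := fun i j hij => hinj (by rw [← hτ, ← hτ, hij])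
  have := f.toAlternatingMap.map_perm (edges (S.verts T h))
    (Equiv.ofBijective τ (Finite.injective_iff_bijective.1 hτi))
  rw [show f.toAlternatingMap (edges (S.verts T h)) = 0 from hf, smul_zero] at this
  have he : (fun l => S.vertex (r l) - S.vertex (T.1.orderEmbOfFin h 0)) =
      edges (S.verts T h) ∘ Equiv.ofBijective τ (Finite.injective_iff_bijective.1 hτi) := by
    ext1 l
    simp only [edges, Function.comp_apply, Equiv.ofBijective_apply, verts, hτ]
  rw [he]
  exact mul_eq_zero_of_right _ this

theorem Q_const {k : ℕ} (T : Face n) (f : Alt (k + 1) (Vec n)) (x : Vec n) :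
    S.Q T (fun _ => f) x = (1 / (k + 1 : ℝ)) • contract (x - S.inpoint T) f := by
  rw [Q, ← add_smul]
  congr 1
  field_simp
  ring

theorem Q_add {k : ℕ} (T : Face n) (v v' : Vec n → Alt (k + 1) (Vec n)) :
    S.Q T (v + v') = S.Q T v + S.Q T v' := by
  ext1 x
  simp only [Q, contract_eq, Pi.add_apply, curryLeft_add, _root_.add_apply]
  module

theorem Q_smul {k : ℕ} (T : Face n) (c : ℝ) (v : Vec n → Alt (k + 1) (Vec n)) :
    S.Q T (c • v) = c • S.Q T v := by
  ext1 x
  simp only [Q, contract_eq, Pi.smul_apply, curryLeft_smul, _root_.smul_apply]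
  module

/-- By Stokes' formula the integral of w is that of Q_T w over the boundary. There w vanishes, so
Q_T w only involves w(W_T) and is 1/(m+2) times the primitive of the constant form w(W_T). The
integral is therefore 1/(m+2) times that of this constant form. -/
theorem Z.integral_eq (H : S.IsTransversal) {m : ℕ} {T : Face n} (h : T.1.card = m + 2)
    {w : Vec n → Alt (m + 1) (Vec n)} (hw : S.Z (m + 1) T w)
    (h0 : ∀ i ∈ T.1, ∀ hT : 1 < T.1.card, ∀ y ∈ S.real (T.erase i hT), w y = 0) :
    simplexIntegral (S.verts T h) w = volume.real (stdSimp (m + 1)) / (m + 2) *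
      w (S.inpoint T) (edges (S.verts T h)) := by
  have hA : ∀ w, S.Z (m + 1) T w → (fun x : S.real T => (S.Q T w x, w x)) ∈ S.A m T := fun w hw =>
    (mem_A_iff H).2 ⟨by rw [sub_self]; exact Z.zero _ _, hw⟩
  have h1 := stokes_of_mem_A h (hA w hw)
  have h2 := stokes_of_mem_A h (hA _ (Z.const (m + 1) T (w (S.inpoint T))))
  rw [simplexIntegral_const] at h2
  have h3 : ∀ i, simplexIntegral (S.verts (T.facet h i) (T.facet_card h i)) (S.Q T w) =
      (1 / (m + 2 : ℝ)) * simplexIntegral (S.verts (T.facet h i) (T.facet_card h i))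
        (S.Q T fun _ => w (S.inpoint T)) := by
    intro i
    rw [← simplexIntegral_smul]
    refine simplexIntegral_congr _ (K := S.real (T.facet h i))
      (fun t ht => S.chart_verts_mem _ _ ht) fun x hx => ?_
    rw [Pi.smul_apply, Q_const, Q, h0 _ (Finset.orderEmbOfFin_mem T.1 h i) (by omega) x hx,
      _root_.map_zero, smul_zero, add_zero, smul_smul]
    congr 1
    field_simp
  simp only [h3, mul_left_comm _ (1 / (m + 2 : ℝ)), ← Finset.mul_sum] at h1
  rw [h1, ← h2]
  ring

/-- Uniqueness of closed piecewise affine forms, given vertex values and integrals. -/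
theorem Z.eq_zero_of_integral (H : S.IsTransversal) {m : ℕ} {T : Face n}
    {w : Vec n → Alt (m + 1) (Vec n)} (hw : S.Z (m + 1) T w)
    (h0 : ∀ i ∈ T.1, w (S.vertex i) = 0)
    (hint : ∀ F ≤ T, ∀ h : F.1.card = m + 2, simplexIntegral (S.verts F h) w = 0)
    {x : Vec n} (hx : x ∈ S.real T) : w x = 0 := by
  refine hw.eq_zero H (by omega) h0 (fun F hF hd h1 ξ hξ => ?_) hx
  have hc : F.1.card = m + 2 := by have := F.card_pos; unfold Face.dim at hd; omega
  have h2 := (hw.mono H hF).integral_eq H hc h1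
  rw [hint F hF hc] at h2
  refine form_eq_zero_of_edges hc ?_ hξ
  have h3 : volume.real (stdSimp (m + 1)) / (m + 2 : ℝ) ≠ 0 :=
    (div_pos (volume_stdSimp_pos _) (by positivity)).ne'
  exact (mul_eq_zero.1 h2.symm).resolve_left h3

end SplitSimplex

end FES

namespace FES

open ContinuousAlternatingMap Matrix

/-! ### Forms with prescribed integrals -/

/-- The determinant of a family of `k` linear forms. -/
def detForm {E : Type} [NormedAddCommGroup E] [NormedSpace ℝ E] {k : ℕ} (l : Fin k → E →L[ℝ] ℝ) :
    Alt k E where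
  toAlternatingMap := (Matrix.detRowAlternating (R := ℝ) (n := Fin k)).compLinearMap
    (LinearMap.pi fun a => (l a : E →ₗ[ℝ] ℝ))
  cont := by
    change Continuous fun ξ : Fin k → E => (Matrix.of fun b a => l a (ξ b)).det
    exact Continuous.matrix_det (by fun_prop)

theorem detForm_apply {E : Type} [NormedAddCommGroup E] [NormedSpace ℝ E] {k : ℕ}
    (l : Fin k → E →L[ℝ] ℝ) (ξ : Fin k → E) :
    detForm l ξ = (Matrix.of fun b a => l a (ξ b)).det := rfl

namespace SplitSimplex

variable {n : ℕ} {S : SplitSimplex n}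

theorem orderEmbOfFin_zero_of_mem {T : Face n} {k : ℕ} (h : T.1.card = k + 1)
    (h0 : (0 : Fin (n + 1)) ∈ T.1) : T.1.orderEmbOfFin h 0 = 0 := by
  have : (0 : Fin (n + 1)) ∈ Set.range (T.1.orderEmbOfFin h) := by
    rw [Finset.range_orderEmbOfFin]; exact h0
  obtain ⟨j, hj⟩ := this
  exact le_antisymm (hj ▸ (T.1.orderEmbOfFin h).monotone (Fin.zero_le j)) (Fin.zero_le _)

/-- A constant form is determined by its values on the faces that contain the first vertex. -/
theorem exists_form_edges {k : ℕ} (e : (T : Face n) → T.1.card = k + 1 → ℝ) :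
    ∃ f : Alt k (Vec n), ∀ (T : Face n) (h : T.1.card = k + 1), (0 : Fin (n + 1)) ∈ T.1 →
      f (edges (S.verts T h)) = e T h := by
  classical
  let I := {T : Face n // T.1.card = k + 1 ∧ (0 : Fin (n + 1)) ∈ T.1}
  -- The determinants of the dλ_a, for a ranging over the vertices of U other than the first one,
  -- form a dual basis: on the edges of T the matrix is the identity if U = T, and has a zero column
  -- otherwise.
  let φ : I → Alt k (Vec n) := fun U =>
    detForm fun a => S.dbary (U.1.1.orderEmbOfFin U.2.1 a.succ)
  refine ⟨∑ U : I, e U.1 U.2.1 • φ U, fun T h h0 => ?_⟩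
  have hentry : ∀ U : I, ∀ a b : Fin k, S.dbary (U.1.1.orderEmbOfFin U.2.1 a.succ)
      (edges (S.verts T h) b) =
      if U.1.1.orderEmbOfFin U.2.1 a.succ = T.1.orderEmbOfFin h b.succ then 1 else 0 := by
    intro U a b
    have hne : U.1.1.orderEmbOfFin U.2.1 a.succ ≠ 0 := fun he => Fin.succ_ne_zero a
      ((U.1.1.orderEmbOfFin U.2.1).injective (he.trans (orderEmbOfFin_zero_of_mem U.2.1 U.2.2).symm))
    rw [edges, dbary_sub, verts, verts, bary_vertex, bary_vertex, orderEmbOfFin_zero_of_mem h h0,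
      if_neg hne, sub_zero]
  rw [ContinuousAlternatingMap.sum_apply, Finset.sum_eq_single (⟨T, h, h0⟩ : I)]
  · rw [ContinuousAlternatingMap.smul_apply, smul_eq_mul]
    have : φ ⟨T, h, h0⟩ (edges (S.verts T h)) = 1 := by
      rw [detForm_apply, ← Matrix.det_one (R := ℝ) (n := Fin k)]
      congr 1
      ext b a
      rw [Matrix.of_apply, hentry, Matrix.one_apply]
      simp [eq_comm]
    rw [this, mul_one]
  · intro U _ hU
    have hne : ∃ i ∈ U.1.1, i ∉ T.1 := by
      by_contra hc
      push Not at hc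
      exact hU (Subtype.ext (Subtype.ext (Finset.eq_of_subset_of_card_le hc (by rw [h, U.2.1]))))
    obtain ⟨i, hi, hiT⟩ := hne
    have : i ∈ Set.range (U.1.1.orderEmbOfFin U.2.1) := by
      rw [Finset.range_orderEmbOfFin]; exact hi
    obtain ⟨j, rfl⟩ := this
    rcases Fin.eq_zero_or_eq_succ j with rfl | ⟨a, rfl⟩
    · exact absurd (by rwa [orderEmbOfFin_zero_of_mem U.2.1 U.2.2]) hiT
    · rw [ContinuousAlternatingMap.smul_apply, detForm_apply,
        Matrix.det_eq_zero_of_column_eq_zero a, smul_zero]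
      intro b
      rw [Matrix.of_apply, hentry, if_neg]
      intro he
      exact hiT (he ▸ Finset.orderEmbOfFin_mem _ _ _)
  · simp

/-- Changing κ in `exists_Z` keeps the vertex values, hence the values on faces of dimension at most
p. It changes each integral on a (p+1)-face by a fixed non-zero multiple of κ evaluated on the
edges. A constant form can be prescribed only on the faces that contain the first vertex. -/
theorem exists_Z_integral (H : S.IsTransversal) {p : ℕ} (α : Fin (n + 1) → Alt (p + 1) (Vec n))
    (c : (T : Face n) → T.1.card = p + 2 → ℝ) :
    ∃ w : Vec n → Alt (p + 1) (Vec n), (∀ T, S.Z (p + 1) T w) ∧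
      (∀ i, w (S.vertex i) = α i) ∧
      ∀ (T : Face n) (h : T.1.card = p + 2), (0 : Fin (n + 1)) ∈ T.1 →
        simplexIntegral (S.verts T h) w = c T h := by
  obtain ⟨w₀, hw₀, hα₀, hi₀⟩ := exists_Z H p α 0
  set C : ℝ := volume.real (stdSimp (p + 1)) / (p + 2) with hC
  have hC0 : C ≠ 0 := (div_pos (volume_stdSimp_pos _) (by positivity)).ne'
  obtain ⟨κ, hκ⟩ := S.exists_form_edges fun T h => (c T h - simplexIntegral (S.verts T h) w₀) / C
  obtain ⟨w, hw, hα, hi⟩ := exists_Z H p α κ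
  refine ⟨w, hw, hα, fun T h h0 => ?_⟩
  have hd : T.dim = p + 1 := by unfold Face.dim; omega
  have h1 := ((hw T).sub (hw₀ T)).integral_eq H h fun i hi hT y hy => by
    have hlt : (T.erase i hT).dim < p + 1 := by rw [Face.dim_erase hT hi]; omega
    rw [Pi.sub_apply, (hw _).affine_of_dim_lt (by omega) hlt hy,
      (hw₀ _).affine_of_dim_lt (by omega) hlt hy]
    simp only [hα, hα₀, sub_self]
  rw [simplexIntegral_sub _ (fun t ht => S.chart_verts_mem T h ht) (hw T).cont (hw₀ T).cont,
    Pi.sub_apply, ContinuousAlternatingMap.sub_apply, hi T (by omega) _ (S.edges_verts_mem T h),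
    hi₀ T (by omega) _ (S.edges_verts_mem T h), hκ T h h0, ← hC] at h1
  have h2 : C * ((c T h - simplexIntegral (S.verts T h) w₀) / C) =
      c T h - simplexIntegral (S.verts T h) w₀ := mul_div_cancel₀ _ hC0
  simp only [alt_zero_apply] at h1
  linarith [h1, h2]

end SplitSimplex

end FES

namespace FES

open ContinuousAlternatingMap Matrix

/-! ### Unisolvence -/

theorem simplexIntegral_dim_zero {E : Type} [NormedAddCommGroup E] [NormedSpace ℝ E]
    (V : Fin 1 → E) (u : E → Alt 0 E) : simplexIntegral V u = u (V 0) (edges V) := by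
  have h : simplexIntegral V u = simplexIntegral V fun _ => u (V 0) :=
    setIntegral_congr_fun (isClosed_stdSimp 0).measurableSet fun t _ => by
      simp [chart]
  have hs : stdSimp 0 = Set.univ :=
    Set.eq_univ_of_forall fun t => ⟨fun j => j.elim0, by simp⟩
  rw [h, simplexIntegral_const, hs]
  simp [measureReal_def, volume_pi]

namespace SplitSimplex

variable {n : ℕ} {S : SplitSimplex n}

/-- Write u - Q_{T'} v as (u - Q_T v) + (Q_T v - Q_{T'} v); both terms belong to Z^k(T'). -/
theorem mem_A_mono (H : S.IsTransversal) {k : ℕ} {T' T : Face n} (hT : T' ≤ T)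
    {u : Vec n → Alt k (Vec n)} {v : Vec n → Alt (k + 1) (Vec n)}
    (hA : (fun x : S.real T => (u x, v x)) ∈ S.A k T) :
    (fun x : S.real T' => (u x, v x)) ∈ S.A k T' := by
  obtain ⟨h1, h2⟩ := (mem_A_iff H).1 hA
  refine (mem_A_iff H).2 ⟨?_, h2.mono H hT⟩
  have := (h1.mono H hT).add (h2.Q_sub_Q H hT)
  rwa [sub_add_sub_cancel] at this

theorem sub_mem_A (H : S.IsTransversal) {k : ℕ} {T : Face n} {u u' : Vec n → Alt k (Vec n)}
    {v v' : Vec n → Alt (k + 1) (Vec n)} (hA : (fun x : S.real T => (u x, v x)) ∈ S.A k T)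
    (hA' : (fun x : S.real T => (u' x, v' x)) ∈ S.A k T) :
    (fun x : S.real T => ((u - u') x, (v - v') x)) ∈ S.A k T := by
  obtain ⟨h1, h2⟩ := (mem_A_iff H).1 hA
  obtain ⟨h3, h4⟩ := (mem_A_iff H).1 hA'
  refine (mem_A_iff H).2 ⟨?_, h2.sub h4⟩
  have e : S.Q T (v - v') = S.Q T v - S.Q T v' := by
    have := Q_add (S := S) T (v - v') v'
    rw [sub_add_cancel] at this
    rw [this, add_sub_cancel_right]
  rw [e, sub_sub_sub_comm]
  exact h1.sub h3

theorem Q_eq_zero {k : ℕ} {T : Face n} {v : Vec n → Alt (k + 1) (Vec n)}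
    (hv : ∀ x ∈ S.real T, v x = 0) {x : Vec n} (hx : x ∈ S.real T) : S.Q T v x = 0 := by
  rw [Q, hv x hx, hv _ (S.inpoint_mem_real T), _root_.map_zero, smul_zero, smul_zero, add_zero]

/-- By Stokes' formula the integrals of v on (k+1)-faces vanish, hence v = 0 by uniqueness in
Z^{k+1}. Then u is itself in Z^k(T), and uniqueness there applies; for k = 0, u is constant and zero
at a vertex. -/
theorem eq_zero_of_mem_A (H : S.IsTransversal) {k : ℕ} {T : Face n}
    {u : Vec n → Alt k (Vec n)} {v : Vec n → Alt (k + 1) (Vec n)}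
    (hA : (fun x : S.real T => (u x, v x)) ∈ S.A k T)
    (hu0 : ∀ i ∈ T.1, u (S.vertex i) = 0) (hv0 : ∀ i ∈ T.1, v (S.vertex i) = 0)
    (hint : ∀ F ≤ T, ∀ h : F.1.card = k + 1, simplexIntegral (S.verts F h) u = 0)
    {x : Vec n} (hx : x ∈ S.real T) : u x = 0 ∧ v x = 0 := by
  obtain ⟨h1, h2⟩ := (mem_A_iff H).1 hA
  have hv : ∀ x ∈ S.real T, v x = 0 := fun x hx =>
    h2.eq_zero_of_integral H hv0 (fun G hG h => by
      rw [stokes_of_mem_A h (mem_A_mono H hG hA)]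
      exact Finset.sum_eq_zero fun i _ => by
        rw [hint _ ((G.facet_le h i).trans hG), mul_zero]) hx
  have hu : S.Z k T u := h1.congr fun x hx => by rw [Pi.sub_apply, Q_eq_zero hv hx, sub_zero]
  refine ⟨?_, hv x hx⟩
  cases k with
  | zero =>
    obtain ⟨i, hi⟩ := T.2
    rw [hu.eq_inpoint hx, ← hu.eq_inpoint (S.vertex_mem_real hi), hu0 i hi]
  | succ m => exact hu.eq_zero_of_integral H hu0 hint hx

theorem eq_of_mem_A (H : S.IsTransversal) {k : ℕ} {T : Face n} {u u' : Vec n → Alt k (Vec n)}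
    {v v' : Vec n → Alt (k + 1) (Vec n)} (hA : (fun x : S.real T => (u x, v x)) ∈ S.A k T)
    (hA' : (fun x : S.real T => (u' x, v' x)) ∈ S.A k T)
    (hu : ∀ i ∈ T.1, u (S.vertex i) = u' (S.vertex i))
    (hv : ∀ i ∈ T.1, v (S.vertex i) = v' (S.vertex i))
    (hint : ∀ F ≤ T, ∀ h : F.1.card = k + 1,
      simplexIntegral (S.verts F h) u = simplexIntegral (S.verts F h) u') :
    (fun x : S.real T => (u x, v x)) = fun x : S.real T => (u' x, v' x) := by
  ext1 x
  have := eq_zero_of_mem_A H (sub_mem_A H hA hA') (fun i hi => sub_eq_zero.2 (hu i hi))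
    (fun i hi => sub_eq_zero.2 (hv i hi)) (fun F hF h => by
      rw [simplexIntegral_sub _ (fun t ht => S.chart_verts_mem F h ht)
        ((continuous_iff.1 hA.1.1).mono (S.real_mono hF))
        ((continuous_iff.1 hA'.1.1).mono (S.real_mono hF)), hint F hF h, sub_self]) x.2
  exact Prod.ext (sub_eq_zero.1 this.1) (sub_eq_zero.1 this.2)

/-- If F misses the first vertex, it is a facet of the face G obtained by adding that vertex, and
the other facets of G contain it. Stokes' formula on G, satisfied by the prescribed values through
`hv`, determines the integral on F. -/
theorem integral_eq_of_zero_mem {k : ℕ} {u : Vec n → Alt k (Vec n)}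
    {v : Vec n → Alt (k + 1) (Vec n)} (hA : ∀ T, (fun x : S.real T => (u x, v x)) ∈ S.A k T)
    (c : (T : Face n) → T.1.card = k + 1 → ℝ)
    (hu : ∀ (F : Face n) (h : F.1.card = k + 1), (0 : Fin (n + 1)) ∈ F.1 →
      simplexIntegral (S.verts F h) u = c F h)
    (hv : ∀ (G : Face n) (h : G.1.card = k + 2), (0 : Fin (n + 1)) ∈ G.1 →
      simplexIntegral (S.verts G h) v = ∑ i : Fin (k + 2), (-1 : ℝ) ^ (i : ℕ) *
        c (G.facet h i) (G.facet_card h i)) (F : Face n) (h : F.1.card = k + 1) :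
    simplexIntegral (S.verts F h) u = c F h := by
  by_cases h0 : (0 : Fin (n + 1)) ∈ F.1
  · exact hu F h h0
  set G : Face n := ⟨insert 0 F.1, Finset.insert_nonempty _ _⟩ with hG
  have hGc : G.1.card = k + 2 := by rw [hG, Finset.card_insert_of_notMem h0, h]
  have h0G : (0 : Fin (n + 1)) ∈ G.1 := Finset.mem_insert_self _ _
  have he := orderEmbOfFin_zero_of_mem hGc h0G
  have hF : G.facet hGc 0 = F := by
    apply Subtype.ext
    change G.1.erase (G.1.orderEmbOfFin hGc 0) = F.1
    rw [he, hG, Finset.erase_insert h0]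
  have h1 := stokes_of_mem_A hGc (hA G)
  rw [hv G hGc h0G, Fin.sum_univ_succ (n := k + 1), Fin.sum_univ_succ (n := k + 1)] at h1
  have h2 : ∀ i : Fin (k + 1), simplexIntegral (S.verts (G.facet hGc i.succ)
      (G.facet_card hGc i.succ)) u = c (G.facet hGc i.succ) (G.facet_card hGc i.succ) := by
    intro i
    refine hu _ _ (Finset.mem_erase.2 ⟨fun h => ?_, h0G⟩)
    exact Fin.succ_ne_zero i ((G.1.orderEmbOfFin hGc).injective (h.symm.trans he.symm))
  simp only [h2, Fin.val_zero, pow_zero, one_mul, add_left_inj] at h1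
  have key : ∀ F', F' = F → ∀ h' : F'.1.card = k + 1,
      c F' h' = simplexIntegral (S.verts F' h') u → simplexIntegral (S.verts F h) u = c F h := by
    rintro _ rfl h' e
    exact e.symm
  exact key _ hF _ h1

/-- Existence of elements with prescribed degrees of freedom. -/
theorem exists_mem_A (H : S.IsTransversal) {k : ℕ} (α : Fin (n + 1) → Alt k (Vec n))
    (β : Fin (n + 1) → Alt (k + 1) (Vec n)) (c : (T : Face n) → T.1.card = k + 1 → ℝ)
    (hc : k = 0 → ∀ (T : Face n) (h : T.1.card = k + 1),
      c T h = α (T.1.orderEmbOfFin h 0) (edges (S.verts T h))) :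
    ∃ (u : Vec n → Alt k (Vec n)) (v : Vec n → Alt (k + 1) (Vec n)),
      (∀ T, (fun x : S.real T => (u x, v x)) ∈ S.A k T) ∧
      (∀ i, u (S.vertex i) = α i) ∧ (∀ i, v (S.vertex i) = β i) ∧
      ∀ (T : Face n) (h : T.1.card = k + 1), simplexIntegral (S.verts T h) u = c T h := by
  -- The integrals imposed on v are those that Stokes' formula requires of the exterior derivative
  -- of u. Then u is sought as Q_S v plus an element of Z^k.
  obtain ⟨v, hv, hβ, hvi⟩ := exists_Z_integral H β fun G h =>
    ∑ i : Fin (k + 2), (-1 : ℝ) ^ (i : ℕ) * c (G.facet h i) (G.facet_card h i)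
  have hA : ∀ w : Vec n → Alt k (Vec n), (∀ T, S.Z k T w) → ∀ T,
      (fun x : S.real T => ((S.Q (Face.top n) v + w) x, v x)) ∈ S.A k T := fun w hw T =>
    (mem_A_iff H).2 ⟨by
      rw [add_sub_right_comm]
      exact ((hv _).Q_sub_Q H T.le_top).add (hw T), hv T⟩
  cases k with
  | zero =>
    -- For k = 0 only a constant is free; it fixes the value at the first vertex, and Stokes'
    -- formula on the edges issued from it gives the other vertex values.
    have hw : ∀ T, S.Z 0 T fun _ => α 0 - S.Q (Face.top n) v (S.vertex 0) := fun T => Z.const 0 T _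
    refine ⟨_, v, hA _ hw, ?_⟩
    set u := S.Q (Face.top n) v + fun _ => α 0 - S.Q (Face.top n) v (S.vertex 0) with hu
    have hi := integral_eq_of_zero_mem (hA _ hw) c (fun F h h0 => by
      rw [simplexIntegral_dim_zero, hc rfl, verts, orderEmbOfFin_zero_of_mem h h0]
      simp) hvi
    refine ⟨fun i => ?_, hβ, hi⟩
    have h1 := (hi (Face.single i) (Finset.card_singleton i)).trans
      (hc rfl (Face.single i) (Finset.card_singleton i))
    have h2 : (Face.single i).1.orderEmbOfFin (Finset.card_singleton i) 0 = i :=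
      Finset.mem_singleton.1 (Finset.orderEmbOfFin_mem (Face.single i).1 _ 0)
    have h3 : S.verts (Face.single i) (Finset.card_singleton i) 0 = S.vertex i := congrArg _ h2
    rw [simplexIntegral_dim_zero, h3, h2] at h1
    ext ξ
    rw [Subsingleton.elim ξ]
    exact h1
  | succ p =>
    obtain ⟨w, hw, hα, hwi⟩ := exists_Z_integral H (fun i => α i - S.Q (Face.top n) v (S.vertex i))
      fun F h => c F h - simplexIntegral (S.verts F h) (S.Q (Face.top n) v)
    refine ⟨_, v, hA _ hw, fun i => by rw [Pi.add_apply, hα, add_sub_cancel], hβ,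
      integral_eq_of_zero_mem (hA _ hw) c (fun F h h0 => ?_) hvi⟩
    rw [simplexIntegral_add _ (fun t ht => S.chart_verts_mem F h ht) (continuousOn_Q (hv F).cont)
      (hw F).cont, hwi F h h0, add_sub_cancel]

theorem exists_mem_A_of_forms (H : S.IsTransversal) {k : ℕ} (u : Vec n → Alt k (Vec n))
    (v : Vec n → Alt (k + 1) (Vec n)) :
    ∃ (u' : Vec n → Alt k (Vec n)) (v' : Vec n → Alt (k + 1) (Vec n)),
      (∀ T, (fun x : S.real T => (u' x, v' x)) ∈ S.A k T) ∧
      (∀ i, u' (S.vertex i) = u (S.vertex i)) ∧ (∀ i, v' (S.vertex i) = v (S.vertex i)) ∧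
      ∀ (T : Face n) (h : T.1.card = k + 1),
        simplexIntegral (S.verts T h) u' = simplexIntegral (S.verts T h) u := by
  refine exists_mem_A H (fun i => u (S.vertex i)) (fun i => v (S.vertex i)) _ ?_
  rintro rfl T h
  exact simplexIntegral_dim_zero _ _

end SplitSimplex

end FES

namespace FES

open ContinuousAlternatingMap Matrix

namespace SplitSimplex

variable {n : ℕ} {S : SplitSimplex n}

/-! ### The finite element system -/

theorem zero_mem_A (H : S.IsTransversal) (k : ℕ) (T : Face n) : (0 : S.Pairs k T) ∈ S.A k T := by
  have : (fun x : S.real T => ((0 : Vec n → Alt k (Vec n)) x, (0 : Vec n → Alt (k + 1) (Vec n)) x))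
      ∈ S.A k T := (mem_A_iff H).2
    ⟨(Z.zero k T).congr fun x hx => by
      rw [Pi.sub_apply, Q_eq_zero (v := 0) (fun _ _ => rfl) hx, sub_zero], Z.zero _ T⟩
  exact this

theorem add_mem_A (H : S.IsTransversal) {k : ℕ} {T : Face n} {p q : S.Pairs k T}
    (hp : p ∈ S.A k T) (hq : q ∈ S.A k T) : p + q ∈ S.A k T := by
  obtain ⟨u, v, rfl⟩ := exists_rep p
  obtain ⟨u', v', rfl⟩ := exists_rep q
  obtain ⟨h1, h2⟩ := (mem_A_iff H).1 hp
  obtain ⟨h3, h4⟩ := (mem_A_iff H).1 hq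
  have : (fun x : S.real T => ((u + u') x, (v + v') x)) ∈ S.A k T := (mem_A_iff H).2
    ⟨by rw [Q_add, add_sub_add_comm]; exact h1.add h3, h2.add h4⟩
  exact this

theorem smul_mem_A (H : S.IsTransversal) {k : ℕ} {T : Face n} (c : ℝ) {p : S.Pairs k T}
    (hp : p ∈ S.A k T) : c • p ∈ S.A k T := by
  obtain ⟨u, v, rfl⟩ := exists_rep p
  obtain ⟨h1, h2⟩ := (mem_A_iff H).1 hp
  have : (fun x : S.real T => ((c • u) x, (c • v) x)) ∈ S.A k T := (mem_A_iff H).2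
    ⟨(h1.smul c).congr fun x _ => by
      rw [Q_smul, Pi.sub_apply, Pi.smul_apply, Pi.smul_apply, Pi.smul_apply, Pi.sub_apply, smul_sub],
      h2.smul c⟩
  exact this

theorem mem_A_closed (H : S.IsTransversal) {k : ℕ} {T : Face n} {v : Vec n → Alt k (Vec n)}
    (hv : S.Z k T v) :
    (fun x : S.real T => (v x, (0 : Vec n → Alt (k + 1) (Vec n)) x)) ∈ S.A k T :=
  (mem_A_iff H).2 ⟨hv.congr fun x hx => by
    rw [Pi.sub_apply, Q_eq_zero (v := 0) (fun _ _ => rfl) hx, sub_zero], Z.zero _ T⟩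

theorem d_mem_A (H : S.IsTransversal) {k : ℕ} {T : Face n} {p : S.Pairs k T}
    (hp : p ∈ S.A k T) : S.d p ∈ S.A (k + 1) T := by
  obtain ⟨u, v, rfl⟩ := exists_rep p
  exact mem_A_closed H ((mem_A_iff H).1 hp).2

theorem restr_mem_A (H : S.IsTransversal) {k : ℕ} {T' T : Face n} (hT : T' ≤ T) {p : S.Pairs k T}
    (hp : p ∈ S.A k T) : S.restr hT p ∈ S.A k T' := by
  obtain ⟨u, v, rfl⟩ := exists_rep p
  exact mem_A_mono H hT hp

theorem isFiniteElementSystem_A (H : S.IsTransversal) : S.IsFiniteElementSystem S.A where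
  zero_mem := zero_mem_A H
  add_mem _ _ _ hp _ hq := add_mem_A H hp hq
  smul_mem _ _ c _ hp := smul_mem_A H c hp
  d_mem _ _ _ hp := d_mem_A H hp
  d_d _ _ _ _ := rfl
  restr_mem _ _ _ hT _ hp := restr_mem_A H hT hp
  restr_d _ _ _ _ _ _ := rfl
  restr_restr _ _ _ _ _ _ _ _ := rfl
  const_mem T c := mem_A_closed H (Z.const 0 T _)
  d_const _ _ := rfl
  restr_const _ _ _ _ := rfl
  eval_add k T h p hp q hq := by
    obtain ⟨u, v, rfl⟩ := exists_rep p
    obtain ⟨u', v', rfl⟩ := exists_rep q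
    have := eval_eq (S := S) h (u + u') (v + v')
    rw [eval_eq, eval_eq]
    exact this.trans (simplexIntegral_add _ (fun t ht => S.chart_verts_mem T h ht)
      (continuous_iff.1 hp.1.1) (continuous_iff.1 hq.1.1))
  eval_smul k T h c p _ := by
    obtain ⟨u, v, rfl⟩ := exists_rep p
    rw [eval_eq]
    exact (eval_eq (S := S) h (c • u) (c • v)).trans (simplexIntegral_smul _ c u)
  stokes k T h p hp := by
    obtain ⟨u, v, rfl⟩ := exists_rep p
    refine (eval_eq (S := S) h v 0).trans ((stokes_of_mem_A h hp).trans ?_)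
    exact Finset.sum_congr rfl fun i _ => congrArg _ (eval_eq (S := S) _ u v).symm

theorem eq_vertex_of_mem_single {i : Fin (n + 1)} {x : Vec n} (hx : x ∈ S.real (Face.single i)) :
    x = S.vertex i := by
  simpa [real, Face.single] using hx

theorem exists_eq_single {T : Face n} (h : T.dim = 0) : ∃ i, T = Face.single i := by
  have := T.card_pos
  obtain ⟨i, hi⟩ := Finset.card_eq_one.1 (show T.1.card = 1 by unfold Face.dim at h; omega)
  exact ⟨i, Subtype.ext hi⟩

theorem sameDofs_iff {k : ℕ} {u u' : Vec n → Alt k (Vec n)} {v v' : Vec n → Alt (k + 1) (Vec n)} :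
    S.SameDofs (fun x : S.real (Face.top n) => (u x, v x)) (fun x => (u' x, v' x)) ↔
      ((∀ i, u (S.vertex i) = u' (S.vertex i)) ∧ ∀ i, v (S.vertex i) = v' (S.vertex i)) ∧
      ∀ (T : Face n) (h : T.1.card = k + 1),
        simplexIntegral (S.verts T h) u = simplexIntegral (S.verts T h) u' := by
  refine and_congr ⟨fun h => ?_, fun h T hT hd => ?_⟩ ⟨fun h T hc => ?_, fun h T hT hc => ?_⟩
  · have h1 : ∀ i, (u (S.vertex i), v (S.vertex i)) = (u' (S.vertex i), v' (S.vertex i)) := fun i =>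
      congrFun (h (Face.single i) (Face.le_top _) (by simp [Face.dim, Face.single]))
        ⟨S.vertex i, S.vertex_mem_real (Finset.mem_singleton_self i)⟩
    exact ⟨fun i => congrArg Prod.fst (h1 i), fun i => congrArg Prod.snd (h1 i)⟩
  · obtain ⟨i, rfl⟩ := exists_eq_single hd
    ext1 x
    change (u x, v x) = (u' x, v' x)
    rw [eq_vertex_of_mem_single x.2, h.1, h.2]
  · exact (eval_eq hc u v).symm.trans ((h T T.le_top hc).trans (eval_eq hc u' v'))
  · exact (eval_eq hc u v).trans ((h T hc).trans (eval_eq hc u' v').symm)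

/-- The degrees of freedom are read off the family, each on the vertex or k-face that carries it,
and realized on the whole simplex; those carried by faces not strictly inside T are irrelevant. On
each T' < T, unisolvence identifies the result with the given element. -/
theorem admitsExtensions_A (H : S.IsTransversal) : S.AdmitsExtensions S.A := by
  intro k T w hw hst
  choose u v huv using fun T' => exists_rep (w T')
  obtain ⟨u', v', hA, hα, hβ, hc⟩ := exists_mem_A H (fun i => u (Face.single i) (S.vertex i))
    (fun i => v (Face.single i) (S.vertex i)) (fun F h => simplexIntegral (S.verts F h) (u F)) (by
      rintro rfl F h
      obtain ⟨i, rfl⟩ := exists_eq_single (T := F) (by unfold Face.dim; omega)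
      have : (Face.single i).1.orderEmbOfFin h 0 = i :=
        Finset.mem_singleton.1 (Finset.orderEmbOfFin_mem (Face.single i).1 _ 0)
      rw [simplexIntegral_dim_zero, verts, this])
  refine ⟨_, hA T, fun T' hT' => ?_⟩
  have hr : ∀ T'' ≤ T', ∀ x ∈ S.real T'', (u T'' x, v T'' x) = (u T' x, v T' x) := by
    intro T'' h x hx
    have := congrFun (hst T' hT' T'' h) ⟨x, hx⟩
    rw [huv T', huv T''] at this
    exact this.symm
  have hA' := hw T' hT'
  rw [huv] at hA' ⊢
  refine eq_of_mem_A H (hA T') hA' (fun i hi => ?_) (fun i hi => ?_) fun F hF h => ?_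
  · rw [hα]
    exact congrArg Prod.fst (hr _ (Face.single_le hi) _
      (S.vertex_mem_real (Finset.mem_singleton_self i)))
  · rw [hβ]
    exact congrArg Prod.snd (hr _ (Face.single_le hi) _
      (S.vertex_mem_real (Finset.mem_singleton_self i)))
  · rw [hc]
    exact simplexIntegral_congr _ (fun t ht => S.chart_verts_mem F h ht)
      fun x hx => congrArg Prod.fst (hr F hF x hx)

/-- If v = 0 then u is in Z(T). In degree 0 it is constant; in positive degree the pair (Q_T u, u)
is in A and is mapped to (u, 0). -/
theorem locallyExact_A (H : S.IsTransversal) : S.LocallyExact S.A := by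
  intro T
  have hW : S.inpoint T ∈ S.real T := S.inpoint_mem_real T
  have hZ : ∀ {k : ℕ} {u : Vec n → Alt k (Vec n)} {v : Vec n → Alt (k + 1) (Vec n)},
      (fun x : S.real T => (u x, v x)) ∈ S.A k T →
      S.d (fun x : S.real T => (u x, v x)) = 0 → (∀ x ∈ S.real T, v x = 0) ∧ S.Z k T u := by
    intro k u v hA hd
    have hv : ∀ x ∈ S.real T, v x = 0 := fun x hx =>
      congrArg Prod.fst (congrFun hd (⟨x, hx⟩ : S.real T))
    exact ⟨hv, ((mem_A_iff H).1 hA).1.congr fun x hx => by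
      rw [Pi.sub_apply, Q_eq_zero hv hx, sub_zero]⟩
  refine ⟨fun c c' h => ?_, fun p hp => ⟨fun hd => ?_, ?_⟩, fun k p hp => ⟨fun hd => ?_, ?_⟩⟩
  · exact congrArg (fun q : Alt 0 (Vec n) × Alt 1 (Vec n) => q.1 0)
      (congrFun h (⟨_, hW⟩ : S.real T))
  · obtain ⟨u, v, rfl⟩ := exists_rep p
    obtain ⟨hv, hu⟩ := hZ hp hd
    refine ⟨u (S.inpoint T) 0, ?_⟩
    ext1 x
    refine Prod.ext ?_ (hv x x.2).symm
    ext ξ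
    rw [hu.eq_inpoint x.2, Subsingleton.elim ξ 0]
    rfl
  · rintro ⟨c, rfl⟩; rfl
  · obtain ⟨u, v, rfl⟩ := exists_rep p
    obtain ⟨hv, hu⟩ := hZ hp hd
    refine ⟨fun x : S.real T => (S.Q T u x, u x),
      (mem_A_iff H).2 ⟨by rw [sub_self]; exact Z.zero _ _, hu⟩, ?_⟩
    ext1 x
    exact Prod.ext rfl (hv x x.2).symm
  · rintro ⟨q, -, rfl⟩; rfl

/-- To extend an element from T, interpolate on S the degrees of freedom of any representative
defined on the whole space; on T unisolvence gives back the element. -/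
theorem A_eq_image_restr (H : S.IsTransversal) (k : ℕ) {T : Face n} (hT : T ≤ Face.top n) :
    S.A k T = S.restr hT '' S.A k (Face.top n) := by
  refine Set.Subset.antisymm (fun p hp => ?_) ?_
  · obtain ⟨u, v, rfl⟩ := exists_rep p
    obtain ⟨u', v', hA, hα, hβ, hc⟩ := exists_mem_A_of_forms H u v
    exact ⟨_, hA _, eq_of_mem_A H (hA T) hp (fun i _ => hα i) (fun i _ => hβ i) fun F _ h => hc F h⟩
  · rintro _ ⟨p, hp, rfl⟩
    exact restr_mem_A H hT hp

theorem stokes_of_mem_C0d_face {k : ℕ} {u : Vec n → Alt k (Vec n)} {v : Vec n → Alt (k + 1) (Vec n)}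
    (hp : (fun x : S.real (Face.top n) => (u x, v x)) ∈ S.C0d k) {T : Face n}
    (h : T.1.card = k + 2) :
    simplexIntegral (S.verts T h) v = ∑ i : Fin (k + 2), (-1 : ℝ) ^ (i : ℕ) *
      simplexIntegral (S.verts (T.facet h i) (T.facet_card h i)) u := by
  have h1 := stokes_of_mem_C0d hp (V := S.verts T h)
    fun i => S.real_mono T.le_top (S.verts_mem_real T h i)
  rw [simplexIntegral_congr (S.verts T h) (K := S.real (Face.top n)) (u' := v)
    (fun t ht => S.real_mono T.le_top (S.chart_verts_mem T h ht))
    fun x hx => S.extendZero_apply _ hx] at h1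
  rw [h1]
  refine Finset.sum_congr rfl fun i _ => ?_
  rw [← verts_facet, simplexIntegral_congr _ (K := S.real (Face.top n)) (u' := u)
    (fun t ht => S.real_mono (Face.le_top _) (S.chart_verts_mem _ _ ht))
    fun x hx => S.extendZero_apply _ hx]

/-- Existence and uniqueness are unisolvence. For commutation, the vertex values of the
differentials are among the data, and their integrals on (k+1)-faces agree by Stokes' formula, valid
on C⁰_dΛ^k(S) as well as on A^k(S). -/
theorem hasCommutingInterpolators_A (H : S.IsTransversal) : S.HasCommutingInterpolators S.A := by
  refine ⟨fun k p _ => ?_, fun k p hp q hq h => ⟨d_mem_C0d hp, d_mem_A H hq, ?_⟩⟩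
  · obtain ⟨u, v, rfl⟩ := exists_rep p
    obtain ⟨u', v', hA, hα, hβ, hc⟩ := exists_mem_A_of_forms H u v
    refine ⟨_, ⟨hA (Face.top n), sameDofs_iff.2 ⟨⟨fun i => (hα i).symm, fun i => (hβ i).symm⟩,
      fun T h => (hc T h).symm⟩⟩, ?_⟩
    rintro q ⟨hq, hd⟩
    obtain ⟨u₁, v₁, rfl⟩ := exists_rep q
    obtain ⟨⟨h1, h2⟩, h3⟩ := sameDofs_iff.1 hd
    exact eq_of_mem_A H hq (hA _) (fun i _ => (h1 i).symm.trans (hα i).symm)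
      (fun i _ => (h2 i).symm.trans (hβ i).symm) fun F _ h => (h3 F h).symm.trans (hc F h).symm
  · obtain ⟨u, v, rfl⟩ := exists_rep p
    obtain ⟨u', v', rfl⟩ := exists_rep q
    obtain ⟨⟨h1, h2⟩, h3⟩ := sameDofs_iff.1 h
    refine sameDofs_iff (u := v) (v := 0) (u' := v') (v' := 0) |>.2 ⟨⟨h2, fun _ => rfl⟩,
      fun T hT => ?_⟩
    rw [stokes_of_mem_C0d_face hp hT, stokes_of_mem_A hT (mem_A_mono H T.le_top hq)]
    simp only [h3]

end SplitSimplex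

end FES

end

/-! ### The theorem for Powell–Sabin/Worsey–Piper tetrahedra -/

theorem mainTheorem1 (S : FES.SplitSimplex 3) (hS : S.IsPowellSabin) :
    S.IsFiniteElementSystem S.A ∧
    S.Compatible S.A ∧
    (∀ (k : ℕ) (T : FES.Face 3) (hT : T ≤ FES.Face.top 3),
      S.A k T = S.restr hT '' S.A k (FES.Face.top 3)) ∧
    (∀ k : ℕ, S.A k (FES.Face.top 3) ⊆ S.C0d k) ∧
    S.HasCommutingInterpolators S.A := by
  have H := FES.SplitSimplex.isTransversal_of_isPowellSabin hS
  exact ⟨FES.SplitSimplex.isFiniteElementSystem_A H,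
    ⟨FES.SplitSimplex.admitsExtensions_A H, FES.SplitSimplex.locallyExact_A H⟩,
    fun k _ hT => FES.SplitSimplex.A_eq_image_restr H k hT, FES.SplitSimplex.A_subset_C0d,
    FES.SplitSimplex.hasCommutingInterpolators_A H⟩
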